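/- **Setting.** Let $\beta>0$, $\alpha,\gamma\ge 0$, and let $k=k_N$, $p=p_N\in\mathbb N$ satisfy $k_N/\ln N\to\gamma$, $p_N/N\to\alpha$ as $N\to\infty$, with $p_N\ge 1$ for all large $N$. Let $\tilde\xi^\nu_i$ ($\nu\le k$, $i\le N$) be i.i.d. with $\mathbb P(\tilde\xi^\nu_i=\pm1)=\tfrac12$, and $\xi^\mu_i$ ($\mu\le p$, $i\le N$) i.i.d. $\mathcal N(0,1)$, independent of the $\tilde\xi$. For $\sigma\in\{\pm1\}^N$ put $$H_N(\sigma)=-\frac1N\sum_{1\le i<j\le N}\Big(\sum_{\nu=1}^k\tilde\xi_i^\nu\tilde\xi_j^\nu+\sum_{\mu=1}^p\xi_i^\mu\xi_j^\mu\Big)\sigma_i\sigma_j,\qquad A_N(\beta)=\frac1N\,\mathbb E\ln\sum_\sigma e^{-\beta H_N(\sigma)} .$$ **Order parameters and interpolating averages.** For $x\in\mathbb R^k$, $\psi\in[0,1]$ and numbers $\bar q,\bar p$ with $\beta(1-\bar q)<1$, consider on $(\sigma,z)\in\{\pm1\}^N\times\mathbb R^p$ the random Gibbs measure whose density with respect to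 (counting measure) $\times$ (standard Gaussian measure) is proportional to $$\exp\Big\{\tfrac{\beta}{2N}\sum_{i,j,\nu}\tilde\xi_i^\nu\tilde\xi_j^\nu\sigma_i\sigma_j+\sum_{\nu,i} x_\nu\tilde\xi_i^\nu\sigma_i+\sqrt{\tfrac{\psi\beta}{N}}\sum_{\mu,i}\xi_i^\mu\sigma_iz_\mu+\sqrt{1-\psi}\Big(\sqrt{\alpha\beta\bar p}\sum_i\eta_i\sigma_i+\sqrt{\beta\bar q}\sum_\mu\theta_\mu z_\mu\Big)+\tfrac{1-\psi}{2}\beta(1-\bar q)\sum_\mu z_\mu^2\Big\},$$ with $\eta_i,\theta_\mu$ i.i.d. $\mathcal N(0,1)$ independent of the patterns. (At $\psi=1$, $x=0$ the $\sigma$-marginal is the Gibbs measure of $H_N$.) Let $\langle\cdot\rangle_{x,\psi}$ be the average over independent replicas $(\sigma^{(a)},z^{(a)})$ at fixed disorder, followed by the average over the disorder, and let $$m_\nu=\frac1N\sum_i\tilde\xi_i^\nu\sigma_i,\qquad q_{12}=\frac1N\sum_i\sigma_i^{(1)}\sigma_i^{(2)},\qquad p_{12}=\frac1p\sum_\mu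 z_\mu^{(1)}z_\mu^{(2)} .$$ **Replica symmetry.** Assume that there are $\bar m=(\bar m_\nu)_{\nu\ge1}\in\ell^2$ and $\bar q,\bar p\in\mathbb R$ with $\beta(1-\bar q)<1$, and fields $x^{(N)}\in\mathbb R^{k_N}$ with $\|x^{(N)}\|_2\to0$ (possibly $x^{(N)}=0$; a vanishing field is allowed because the symmetries of $H_N$ otherwise prevent the selection of a pure state), such that $\sum_{\nu>k_N}\bar m_\nu^2\to0$ and, for every $\psi\in[0,1)$, as $N\to\infty$, $$\Big\langle\sum_{\nu\le k_N}(m_\nu-\bar m_\nu)^2\Big\rangle_{x^{(N)},\psi}\to0,\qquad \big\langle(q_{12}-\bar q)^2\big\rangle_{x^{(N)},\psi}\to0,\qquad \big\langle(p_{12}-\bar p)^2\big\rangle_{x^{(N)},\psi}\to0 .$$ **Trial free energy.** Let $\mathbf E$ denote expectation over i.i.d. symmetric signs $\tilde\xi^\nu$, $\nu\ge1$, and an independent $\eta\sim\mathcal N(0,1)$. For $m\in\ell^2$, $q\in\mathbb R$ with $\beta(1-q)<1$, and $\mathsf p\ge 0$, put $$A(m,q,\mathsf p;\alpha,\beta)=-\frac{\alpha\beta}{2}-\frac{\alpha}{2}\ln\big(1-\beta(1-q)\big)+\frac{\alpha\beta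 q}{2(1-\beta(1-q))}-\frac\beta2\sum_\nu m_\nu^2+\ln2+\mathbf E\ln\cosh\Big(\beta\sum_\nu\tilde\xi^\nu m_\nu+\sqrt{\alpha\beta \mathsf p}\,\eta\Big)-\frac{\alpha\beta}{2}\mathsf p(1-q),$$ where the random series is the almost sure limit of its partial sums. **Theorem.** Under these assumptions the limit of the free-energy density exists and $$\lim_{N\to\infty}A_N(\beta)=A(\bar m,\bar q,\bar p;\alpha,\beta),$$ where $(\bar m,\bar q,\bar p)$ is an extremum of $A(\cdot,\cdot,\cdot;\alpha,\beta)$, in the sense that the Fréchet derivative of $A$ on $\ell^2\times\mathbb R\times[0,\infty)$ vanishes there, and where the order parameters satisfy the self-consistency equations $$\bar p=\frac{\beta\bar q}{(1-\beta(1-\bar q))^2},\qquad \bar q=\mathbf E\tanh^2\Big(\beta\sum_\nu\tilde\xi^\nu\bar m_\nu+\sqrt{\alpha\beta\bar p}\,\eta\Big),\qquad \bar m_\nu=\mathbf E\Big[\tilde\xi^\nu\tanh\Big(\beta\sum_{\tau}\tilde\xi^\tau\bar m_\tau+\sqrt{\alpha\beta\bar p}\,\eta\Big)\Big]\quad(\nu\ge1).$$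 Moreover, if $\alpha>0$, then a point $(m,q,\mathsf p)\in\ell^2\times\mathbb R\times[0,\infty)$ with $\beta(1-q)<1$ is an extremum of $A(\cdot,\cdot,\cdot;\alpha,\beta)$ (in the same sense) if and only if it satisfies these self-consistency equations. -/

import Mathlib

open Filter Topology MeasureTheory ProbabilityTheory
open scoped ENNReal

namespace MixedHebbian

/-! ### Neurons, patterns and quenched averages -/

/-- Configurations of `N` Ising neurons. -/
abbrev Config (N : ℕ) : Type := Fin N → ℤˣ

/-- The value `±1` of the `i`-th neuron, as a real number. -/
def spin {N : ℕ} (σ : Config N) (i : Fin N) : ℝ := ((σ i : ℤ) : ℝ)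

/-- The law of one Boolean pattern entry: `+1` and `-1` with probability `1/2` each. -/
noncomputable def booleanLaw : Measure ℝ :=
  (2⁻¹ : ℝ≥0∞) • Measure.dirac 1 + (2⁻¹ : ℝ≥0∞) • Measure.dirac (-1)

instance : IsProbabilityMeasure booleanLaw := by
  refine ⟨?_⟩
  simp [booleanLaw, ENNReal.inv_two_add_inv_two]

/-- The law of a standard Gaussian real variable. -/
noncomputable abbrev gauss : Measure ℝ := gaussianReal 0 1

/-- The joint law of `k` Boolean patterns and `p` Gaussian patterns, with i.i.d. entries. -/
noncomputable def patternLaw (N k p : ℕ) :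
    Measure ((Fin k → Fin N → ℝ) × (Fin p → Fin N → ℝ)) :=
  (Measure.pi fun _ => Measure.pi fun _ => booleanLaw).prod
    (Measure.pi fun _ => Measure.pi fun _ => gauss)

/-! ### The mixed Hebbian network -/

/-- The Hamiltonian of the mixed Hebbian network, with Boolean patterns `ξt` and Gaussian
patterns `ξ`. -/
noncomputable def hamiltonian {N k p : ℕ} (ξt : Fin k → Fin N → ℝ) (ξ : Fin p → Fin N → ℝ)
    (σ : Config N) : ℝ :=
  -(1 / (N : ℝ)) * ∑ i : Fin N, ∑ j ∈ Finset.Ioi i,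
    ((∑ ν, ξt ν i * ξt ν j) + ∑ μ, ξ μ i * ξ μ j) * (spin σ i * spin σ j)

/-- The partition function at inverse temperature `β`. -/
noncomputable def partitionFunction {N k p : ℕ} (β : ℝ) (ξt : Fin k → Fin N → ℝ)
    (ξ : Fin p → Fin N → ℝ) : ℝ :=
  ∑ σ : Config N, Real.exp (-β * hamiltonian ξt ξ σ)

/-- The finite-volume free-energy density `(1/N) 𝔼 ln Z`. -/
noncomputable def freeEnergy (N k p : ℕ) (β : ℝ) : ℝ :=
  1 / (N : ℝ) * ∫ ω, Real.log (partitionFunction β ω.1 ω.2) ∂(patternLaw N k p)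

/-! ### Order parameters -/

/-- The Mattis magnetization of a pattern `ξ`. -/
noncomputable def mattis {N : ℕ} (ξ : Fin N → ℝ) (σ : Config N) : ℝ :=
  1 / (N : ℝ) * ∑ i, ξ i * spin σ i

/-- The overlap `q₁₂` between the visible units of two replicas. -/
noncomputable def overlapVisible {N : ℕ} (σ τ : Config N) : ℝ :=
  1 / (N : ℝ) * ∑ i, spin σ i * spin τ i

/-- The overlap `p₁₂` between the hidden units of two replicas. -/
noncomputable def overlapHidden {p : ℕ} (z w : Fin p → ℝ) : ℝ :=
  1 / (p : ℝ) * ∑ μ, z μ * w μ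

/-! ### The interpolating (generalized) network

The Gaussian patterns are linearized by Gaussian hidden units `z`; the network interpolates, as
`ψ` runs from `1` to `0`, between the mixed Hebbian network (at `t = β`, `x = 0`, `ψ = 1`) and a
network whose hidden units are decoupled from the neurons. -/

/-- The quenched disorder of the generalized network. -/
structure Disorder (N k p : ℕ) where
  /-- Boolean patterns -/
  ξt : Fin k → Fin N → ℝ
  /-- Gaussian patterns -/
  ξ : Fin p → Fin N → ℝ
  /-- random fields on the neurons -/
  η : Fin N → ℝ
  /-- random fields on the hidden units -/
  θ : Fin p → ℝ

/-- The quenched average over the patterns and over the i.i.d. standard Gaussian fields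
`η`, `θ`. -/
noncomputable def quenched {N k p : ℕ} (F : Disorder N k p → ℝ) : ℝ :=
  ∫ ω, F ⟨ω.1.1, ω.1.2, ω.2.1, ω.2.2⟩ ∂((patternLaw N k p).prod
    ((Measure.pi fun _ : Fin N => gauss).prod (Measure.pi fun _ : Fin p => gauss)))

/-- The parameters of the generalized network: `t`, `x`, `ψ` and the scalar fields `A`, `B`,
`C`. -/
structure Parameters (k : ℕ) where
  t : ℝ
  x : Fin k → ℝ
  ψ : ℝ
  A : ℝ
  B : ℝ
  C : ℝ

/-- The generalized Boltzmann factor. -/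
noncomputable def boltzmann {N k p : ℕ} (β : ℝ) (P : Parameters k) (d : Disorder N k p)
    (σ : Config N) (z : Fin p → ℝ) : ℝ :=
  Real.exp (-(β * k / 2) - β / (2 * N) * ∑ i, ∑ μ, d.ξ μ i ^ 2) *
  Real.exp (P.t / (2 * N) * ∑ i, ∑ j, ∑ ν, d.ξt ν i * d.ξt ν j * spin σ i * spin σ j
    + ∑ ν, P.x ν * ∑ i, d.ξt ν i * spin σ i) *
  Real.exp (√P.ψ * √(β / N) * ∑ μ, ∑ i, d.ξ μ i * spin σ i * z μ) *
  Real.exp (P.A * √(1 - P.ψ) * ∑ i, d.η i * spin σ i) *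
  Real.exp (P.B * √(1 - P.ψ) * ∑ μ, d.θ μ * z μ) *
  Real.exp (P.C * ((1 - P.ψ) / 2) * ∑ μ, z μ ^ 2)

/-- The generalized partition function; the hidden units are integrated against the standard
Gaussian measure. -/
noncomputable def generalizedPartition {N k p : ℕ} (β : ℝ) (P : Parameters k)
    (d : Disorder N k p) : ℝ :=
  ∑ σ : Config N, ∫ z, boltzmann β P d σ z ∂(Measure.pi fun _ : Fin p => gauss)

/-- The two-replica Gibbs average `Ω(F)` at fixed disorder. -/
noncomputable def replicaGibbs {N k p : ℕ} (β : ℝ) (P : Parameters k) (d : Disorder N k p)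
    (F : Config N → (Fin p → ℝ) → Config N → (Fin p → ℝ) → ℝ) : ℝ :=
  (∑ σ : Config N, ∑ τ : Config N,
    ∫ z : (Fin p → ℝ) × (Fin p → ℝ),
      F σ z.1 τ z.2 * (boltzmann β P d σ z.1 * boltzmann β P d τ z.2)
      ∂((Measure.pi fun _ : Fin p => gauss).prod (Measure.pi fun _ : Fin p => gauss)))
    / generalizedPartition β P d ^ 2

/-- The interpolating parameters at time `t = β`, with field `x` on the Boolean patterns, and with
`A = √(α β p̄)`, `B = √(β q̄)`, `C = β (1 - q̄)`. -/
noncomputable def rsParameters {k : ℕ} (α β q p : ℝ) (x : Fin k → ℝ) (ψ : ℝ) : Parameters k where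
  t := β
  x := x
  ψ := ψ
  A := √(α * β * p)
  B := √(β * q)
  C := β * (1 - q)

/-- The square-summable sequences of Mattis magnetizations. -/
abbrev Magnetizations : Type := lp (fun _ : ℕ => ℝ) 2

/-- **Replica symmetry.** Along the interpolation `0 ≤ ψ < 1`, at `t = β`, the Mattis
magnetizations and the overlaps of two replicas converge in mean square to the constants `m`,
`q`, `p` when `N → ∞`. The Mattis vector of the `k N` Boolean patterns is compared with `m` in `ℓ²`
after extension by `0`.

The network is invariant under `σ ↦ -σ` and under the change of sign of each Boolean pattern, so
pure states can only be selected by a field `x` on the Boolean patterns that is switched off as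
`N → ∞`; the choice `x = 0` is allowed. -/
def IsReplicaSymmetric (α β : ℝ) (k p : ℕ → ℕ) (m : Magnetizations) (q pbar : ℝ) : Prop :=
  ∃ x : (N : ℕ) → Fin (k N) → ℝ,
    Tendsto (fun N => ∑ ν, x N ν ^ 2) atTop (𝓝 0) ∧
    Tendsto (fun N => ∑' ν, m (k N + ν) ^ 2) atTop (𝓝 0) ∧
    ∀ ψ ∈ Set.Ico (0 : ℝ) 1,
      Tendsto (fun N => quenched fun d : Disorder N (k N) (p N) =>
        replicaGibbs β (rsParameters α β q pbar (x N) ψ) d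
          fun σ _ _ _ => ∑ ν : Fin (k N), (mattis (d.ξt ν) σ - m ν) ^ 2) atTop (𝓝 0) ∧
      Tendsto (fun N => quenched fun d : Disorder N (k N) (p N) =>
        replicaGibbs β (rsParameters α β q pbar (x N) ψ) d
          fun σ _ τ _ => (overlapVisible σ τ - q) ^ 2) atTop (𝓝 0) ∧
      Tendsto (fun N => quenched fun d : Disorder N (k N) (p N) =>
        replicaGibbs β (rsParameters α β q pbar (x N) ψ) d
          fun _ z _ w => (overlapHidden z w - pbar) ^ 2) atTop (𝓝 0)

/-! ### The trial free energy and the self-consistency equations -/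

/-- The law of `((ξ̃^ν)_ν, η)`: independent Boolean variables and an independent standard
Gaussian. -/
noncomputable def siteLaw : Measure ((ℕ → ℝ) × ℝ) :=
  (Measure.infinitePi fun _ : ℕ => booleanLaw).prod gauss

/-- The random series `∑_ν ξ̃^ν m_ν`, as the limit of its partial sums (which converge almost
surely when `m` is square-summable). -/
noncomputable def booleanField (m : Magnetizations) (ξt : ℕ → ℝ) : ℝ :=
  limUnder atTop fun n => ∑ ν ∈ Finset.range n, ξt ν * m ν

/-- The effective local field `β ∑_ν ξ̃^ν m_ν + √(α β p̄) η`. -/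
noncomputable def localField (α β : ℝ) (m : Magnetizations) (pbar : ℝ) (s : (ℕ → ℝ) × ℝ) : ℝ :=
  β * booleanField m s.1 + √(α * β * pbar) * s.2

/-- The trial free-energy density `A(m, q̄, p̄; α, β)`. -/
noncomputable def trialFreeEnergy (α β : ℝ) (m : Magnetizations) (q pbar : ℝ) : ℝ :=
  -(α * β / 2) - α / 2 * Real.log (1 - β * (1 - q)) + α * β * q / (2 * (1 - β * (1 - q)))
    - β / 2 * ∑' ν, m ν ^ 2 + Real.log 2
    + ∫ s, Real.log (Real.cosh (localField α β m pbar s)) ∂siteLaw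
    - α * β / 2 * pbar * (1 - q)

/-- `(m, q̄, p̄)` is an extremum, i.e. a stationary point, of the trial free energy on
`ℓ² × ℝ × [0, ∞)`. -/
def IsStationaryPoint (α β : ℝ) (m : Magnetizations) (q pbar : ℝ) : Prop :=
  HasFDerivWithinAt (fun y : Magnetizations × ℝ × ℝ => trialFreeEnergy α β y.1 y.2.1 y.2.2)
    (0 : Magnetizations × ℝ × ℝ →L[ℝ] ℝ) {y | 0 ≤ y.2.2} (m, q, pbar)

/-- The self-consistency equations of the order parameters. -/
def SelfConsistent (α β : ℝ) (m : Magnetizations) (q pbar : ℝ) : Prop :=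
  pbar = β * q / (1 - β * (1 - q)) ^ 2 ∧
  q = ∫ s, Real.tanh (localField α β m pbar s) ^ 2 ∂siteLaw ∧
  ∀ ν : ℕ, m ν = ∫ s, s.1 ν * Real.tanh (localField α β m pbar s) ∂siteLaw

end MixedHebbian

open MixedHebbian

namespace MixedHebbian

/-! ### The Boolean law and random series -/

/-! The proof is an interpolation in which the hidden units are integrated out exactly. Given the
neurons, the hidden units are independent Gaussians, so at every ψ there remains a finite Gibbs
measure on the spins. Its energy contains (r/2) Σ_μ h_μ², with fields h_μ = √(ψβ/N) Σ_i ξ_i^μ σ_i +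
√(1-ψ) √(β q̄) θ_μ and r = 1/(1 - β(1-q̄)(1-ψ)). At ψ = 1 and x = 0 this is the original network up
to diagonal terms that do not depend on the spins. At ψ = 0 the hidden units no longer see the
neurons.

Along ψ = sin² u, Gaussian integration by parts in ξ, η and θ expresses the derivative of the mean
log-partition function through two-replica overlaps. The self-overlap terms Σ_μ ⟨h_μ²⟩ cancel
because β q̄ + β(1-q̄) = β, and the remaining explicit terms are absorbed by (p/2) ln r
(`hasDerivAt_pathFree`). Only averages of q₁₂, p₁₂ and q₁₂ p₁₂ survive, and replica symmetry gives
their limits for every ψ < 1. An O(N) bound uniform in u, from exponential moments of squared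
alignments (`integral_maxAlignment_le`), permits dominated convergence (`tendsto_pathFree_sub`). The
hypothesis concerns the hidden units themselves. Conditioning on the neurons can only decrease the
mean square deviation of p₁₂ (`le_quenched_hidden`), so it passes to the spin system.

At ψ = 0, completing the square around m̄ exhibits the energy as independent spins plus (βN/2)‖m_N -
m̄‖² plus a constant in the spins (`pathEnergy_zero`). This nonnegative perturbation has mean o(N).
By the Gibbs variational inequality it changes the free energy by o(N), and the local magnetizations
by o(N) in total square distance from the tanh of their fields (`sum_sq_magnetization_sub_tanh_le`).
The first fact gives the ln cosh term, the second the equations for q̄ and m̄. The equation for p̄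
is an explicit Gaussian computation at ψ = 0 (`pathAvg_pathOverlap_zero`). The field x costs O(N‖x‖)
in free energy and is removed at ψ = 1 (`abs_pathFree_sub_le`).

The extremality statement is independent of the network. The random series converges almost surely
and in L² by martingale theory, so E ln cosh is Fréchet differentiable in m ∈ ℓ². Integration by
parts in η makes it differentiable in the Gaussian variance up to the boundary point 0. The gradient
of A is then explicit (`hasFDerivWithinAt_trialFreeEnergy`). Its components are the defects of the
self-consistency equations, with factors β, αβ/2 and αβ/2, which explains the role of α > 0 in the
converse. -/

lemma integral_booleanLaw (f : ℝ → ℝ) : ∫ x, f x ∂booleanLaw = (f 1 + f (-1)) / 2 := by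
  have h : ∀ a : ℝ, Integrable f ((2⁻¹ : ℝ≥0∞) • Measure.dirac a) := fun a =>
    (integrable_dirac (by simp)).smul_measure (by simp)
  rw [booleanLaw, integral_add_measure (h _) (h _), integral_smul_measure, integral_smul_measure]
  simp
  ring

lemma ae_booleanLaw {P : ℝ → Prop} (h1 : P 1) (h2 : P (-1)) : ∀ᵐ x ∂booleanLaw, P x := by
  rw [booleanLaw, ae_add_measure_iff]
  constructor <;> refine Measure.ae_smul_measure ?_ _ <;> rw [ae_dirac_eq] <;> simpa

lemma integrable_booleanLaw (f : ℝ → ℝ) : Integrable f booleanLaw :=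
  ((integrable_dirac (by simp)).smul_measure (by simp)).add_measure
    ((integrable_dirac (by simp)).smul_measure (by simp))

/-- The law of the infinite sequence of signs. -/
noncomputable abbrev signLaw : Measure (ℕ → ℝ) := Measure.infinitePi fun _ : ℕ => booleanLaw

lemma ae_signLaw : ∀ᵐ s ∂signLaw, ∀ ν, s ν = 1 ∨ s ν = -1 := by
  rw [ae_all_iff]
  intro ν
  exact (measurePreserving_eval_infinitePi (fun _ : ℕ => booleanLaw) ν).quasiMeasurePreserving.ae
    (ae_booleanLaw (P := fun x => x = 1 ∨ x = -1) (by simp) (by simp))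

lemma iIndepFun_signLaw : iIndepFun (fun (ν : ℕ) (s : ℕ → ℝ) => s ν) signLaw :=
  iIndepFun_infinitePi (X := fun _ x => x) (fun _ => measurable_id)

lemma integral_sign (ν : ℕ) : ∫ s, s ν ∂signLaw = 0 := by
  have := (measurePreserving_eval_infinitePi (fun _ : ℕ => booleanLaw) ν)
  have h := integral_map (μ := signLaw) (φ := Function.eval ν) (f := fun x : ℝ => x)
    this.measurable.aemeasurable (by fun_prop)
  rw [this.map_eq, integral_booleanLaw] at h
  simpa using h.symm

lemma integrable_sign (ν : ℕ) : Integrable (fun s : ℕ → ℝ => s ν) signLaw :=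
  (measurePreserving_eval_infinitePi (fun _ : ℕ => booleanLaw) ν).integrable_comp_of_integrable
    (integrable_booleanLaw (fun x => x))

lemma integral_sign_mul (ν τ : ℕ) : ∫ s, s ν * s τ ∂signLaw = if ν = τ then 1 else 0 := by
  split_ifs with h
  · subst h
    have : (fun s : ℕ → ℝ => s ν * s ν) =ᵐ[signLaw] fun _ => 1 := by
      filter_upwards [ae_signLaw] with s hs
      rcases hs ν with h | h <;> simp [h]
    rw [integral_congr_ae this]; simp
  · have := (iIndepFun_signLaw.indepFun h).integral_mul_eq_mul_integral
      (integrable_sign ν).aestronglyMeasurable (integrable_sign τ).aestronglyMeasurable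
    simpa [integral_sign] using this

/-- Partial sums of the random series. -/
noncomputable def partialField (m : ℕ → ℝ) (n : ℕ) (s : ℕ → ℝ) : ℝ :=
  ∑ ν ∈ Finset.range n, s ν * m ν

lemma measurable_partialField (m : ℕ → ℝ) (n : ℕ) : Measurable (partialField m n) := by
  unfold partialField; fun_prop

lemma memLp_sign (ν : ℕ) (p : ℝ≥0∞) : MemLp (fun s : ℕ → ℝ => s ν) p signLaw := by
  refine MemLp.of_bound (measurable_pi_apply ν).aestronglyMeasurable 1 ?_
  filter_upwards [ae_signLaw] with s hs
  rcases hs ν with h | h <;> simp [h]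

lemma memLp_partialField (m : ℕ → ℝ) (n : ℕ) (p : ℝ≥0∞) : MemLp (partialField m n) p signLaw :=
  memLp_finsetSum _ fun ν _ => (memLp_sign ν p).mul_const (m ν)

lemma integral_partialField_sq (m : ℕ → ℝ) (n : ℕ) :
    ∫ s, partialField m n s ^ 2 ∂signLaw = ∑ ν ∈ Finset.range n, m ν ^ 2 := by
  have h : ∀ s, partialField m n s ^ 2 =
      ∑ ν ∈ Finset.range n, ∑ τ ∈ Finset.range n, s ν * s τ * (m ν * m τ) := by
    intro s
    rw [partialField, sq, Finset.sum_mul_sum]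
    refine Finset.sum_congr rfl fun _ _ => Finset.sum_congr rfl fun _ _ => by ring
  have hi : ∀ ν τ, Integrable (fun s : ℕ → ℝ => s ν * s τ * (m ν * m τ)) signLaw := fun ν τ =>
    ((memLp_sign ν 2).integrable_mul (memLp_sign τ 2)).mul_const _
  simp_rw [h]
  rw [integral_finsetSum _ fun ν _ => integrable_finsetSum _ fun τ _ => hi ν τ]
  refine Finset.sum_congr rfl fun ν hν => ?_
  rw [integral_finsetSum _ fun τ _ => hi ν τ]
  simp_rw [integral_mul_const, integral_sign_mul, ite_mul, one_mul, zero_mul]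
  rw [Finset.sum_ite_eq, if_pos hν, sq]

lemma summable_sq (m : Magnetizations) : Summable fun ν => m ν ^ 2 := by
  have := (lp.memℓp m).summable (by norm_num)
  simpa using this

lemma norm_sq_eq (m : Magnetizations) : ‖m‖ ^ 2 = ∑' ν, m ν ^ 2 := by
  have := lp.norm_rpow_eq_tsum (p := 2) (by norm_num) m
  simpa using this

/-- The increments are centred and independent of the past. The index is shifted by one because the
n-th natural σ-algebra already contains the sign number n. -/
lemma martingale_partialField (m : ℕ → ℝ) :
    Martingale (fun n => partialField m (n + 1))
      (Filtration.natural (fun (ν : ℕ) (s : ℕ → ℝ) => s ν)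
        (fun ν => (measurable_pi_apply ν).stronglyMeasurable)) signLaw := by
  have hadapt : ∀ n, StronglyMeasurable[Filtration.natural (fun (ν : ℕ) (s : ℕ → ℝ) => s ν)
        (fun ν => (measurable_pi_apply ν).stronglyMeasurable) n] (partialField m (n + 1)) := by
    intro n
    unfold partialField
    refine Finset.stronglyMeasurable_fun_sum _ fun ν hν => ?_
    refine StronglyMeasurable.mul_const ?_ _
    exact (Filtration.stronglyAdapted_natural (u := fun (ν : ℕ) (s : ℕ → ℝ) => s ν)
      (fun ν => (measurable_pi_apply ν).stronglyMeasurable) ν).mono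
        ((Filtration.natural _ _).mono (by simp at hν; omega))
  have hint : ∀ n, Integrable (partialField m n) signLaw := fun n =>
    (memLp_partialField m n 1).integrable le_rfl
  refine martingale_nat hadapt (fun n => hint _) fun n => ?_
  have hsplit : partialField m (n + 1 + 1) =
      partialField m (n + 1) + m (n + 1) • (fun s : ℕ → ℝ => s (n + 1)) := by
    ext s
    simp [partialField, Finset.sum_range_succ _ (n + 1), mul_comm]
  rw [hsplit]
  have h1 := condExp_add (hint (n + 1)) ((integrable_sign (n + 1)).smul (m (n + 1)))
    (Filtration.natural (fun (ν : ℕ) (s : ℕ → ℝ) => s ν)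
        (fun ν => (measurable_pi_apply ν).stronglyMeasurable) n)
  have h2 := condExp_smul (μ := signLaw) (m (n + 1)) (fun s : ℕ → ℝ => s (n + 1))
    (Filtration.natural (fun (ν : ℕ) (s : ℕ → ℝ) => s ν)
        (fun ν => (measurable_pi_apply ν).stronglyMeasurable) n)
  have h3 := iIndepFun.condExp_natural_ae_eq_of_lt
    (fun ν => (measurable_pi_apply ν).stronglyMeasurable) iIndepFun_signLaw (Nat.lt_succ_self n)
  have h4 := condExp_of_stronglyMeasurable (Filtration.le _ n) (hadapt n) (hint (n + 1))
  filter_upwards [h1, h2, h3] with s h1 h2 h3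
  rw [h1, Pi.add_apply, h2, h4, Pi.smul_apply]
  simp only [Nat.succ_eq_add_one] at h3
  rw [h3]
  simp [integral_sign]

/-- The partial sums form a martingale bounded in L² by ‖m‖, hence bounded in L¹, and Doob's
convergence theorem applies. This is what gives `limUnder` its meaning. -/
lemma ae_tendsto_booleanField (m : Magnetizations) :
    ∀ᵐ s ∂signLaw, Tendsto (fun n => partialField m n s) atTop (𝓝 (booleanField m s)) := by
  have hb : ∀ n, eLpNorm (partialField m (n + 1)) 1 signLaw ≤ (‖m‖₊ : ℝ≥0∞) := by
    intro n
    refine (eLpNorm_le_eLpNorm_of_exponent_le (q := 2) (by norm_num)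
      (measurable_partialField m _).aestronglyMeasurable).trans ?_
    have h := (memLp_partialField m (n + 1) 2).eLpNorm_eq_integral_rpow_norm (by norm_num)
      (by norm_num)
    rw [h]
    simp only [ENNReal.toReal_ofNat, Real.rpow_ofNat, Real.norm_eq_abs, sq_abs]
    rw [integral_partialField_sq]
    rw [show ((‖m‖₊ : NNReal) : ℝ≥0∞) = ENNReal.ofReal ‖m‖ by
      rw [ofReal_norm]; rfl]
    refine ENNReal.ofReal_le_ofReal ?_
    have : (∑ ν ∈ Finset.range (n + 1), m ν ^ 2) ≤ ‖m‖ ^ 2 := by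
      rw [norm_sq_eq]
      exact (summable_sq m).sum_le_tsum _ fun _ _ => sq_nonneg _
    rw [← one_div, ← Real.sqrt_eq_rpow]
    exact Real.sqrt_le_iff.2 ⟨norm_nonneg _, this⟩
  have := (martingale_partialField m).submartingale.exists_ae_tendsto_of_bdd hb
  filter_upwards [this] with s ⟨c, hc⟩
  exact tendsto_nhds_limUnder ⟨c, (tendsto_add_atTop_iff_nat 1).1 hc⟩

lemma measurable_booleanField (m : Magnetizations) : Measurable (booleanField m) := by
  refine StronglyMeasurable.measurable ?_
  exact StronglyMeasurable.limUnder fun n => (measurable_partialField m n).stronglyMeasurable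

/-- Fatou's lemma along the partial sums, whose second moments are known by orthogonality of the
signs. The lower integral is used because square integrability of the limit is only deduced from
this bound. -/
lemma lintegral_booleanField_sq_le (m : Magnetizations) :
    ∫⁻ s, ENNReal.ofReal (booleanField m s ^ 2) ∂signLaw ≤ ENNReal.ofReal (‖m‖ ^ 2) := by
  have h1 : ∫⁻ s, ENNReal.ofReal (booleanField m s ^ 2) ∂signLaw =
      ∫⁻ s, liminf (fun n => ENNReal.ofReal (partialField m n s ^ 2)) atTop ∂signLaw := by
    refine lintegral_congr_ae ?_
    filter_upwards [ae_tendsto_booleanField m] with s hs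
    exact ((ENNReal.tendsto_ofReal (hs.pow 2)).liminf_eq).symm
  rw [h1]
  refine (lintegral_liminf_le fun n => ?_).trans ?_
  · exact ((measurable_partialField m n).pow_const 2).ennreal_ofReal
  · refine liminf_le_of_le (by isBoundedDefault) fun b hb => ?_
    obtain ⟨n, hn⟩ := hb.exists
    refine hn.trans ?_
    rw [← ofReal_integral_eq_lintegral_ofReal ((memLp_partialField m n 2).integrable_sq)
      (ae_of_all _ fun _ => sq_nonneg _), integral_partialField_sq, norm_sq_eq]
    exact ENNReal.ofReal_le_ofReal ((summable_sq m).sum_le_tsum _ fun _ _ => sq_nonneg _)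

lemma memLp_booleanField (m : Magnetizations) : MemLp (booleanField m) 2 signLaw := by
  have hm := (measurable_booleanField m)
  rw [memLp_two_iff_integrable_sq hm.aestronglyMeasurable]
  refine ⟨(hm.pow_const 2).aestronglyMeasurable, ?_⟩
  rw [hasFiniteIntegral_iff_ofReal (ae_of_all _ fun _ => sq_nonneg _)]
  exact (lintegral_booleanField_sq_le m).trans_lt ENNReal.ofReal_lt_top

lemma integral_booleanField_sq_le (m : Magnetizations) :
    ∫ s, booleanField m s ^ 2 ∂signLaw ≤ ‖m‖ ^ 2 := by
  rw [integral_eq_lintegral_of_nonneg_ae (ae_of_all _ fun _ => sq_nonneg _)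
    ((measurable_booleanField m).pow_const 2).aestronglyMeasurable]
  refine ENNReal.toReal_le_of_le_ofReal (sq_nonneg _) (lintegral_booleanField_sq_le m)

lemma booleanField_add (m h : Magnetizations) :
    ∀ᵐ s ∂signLaw, booleanField (m + h) s = booleanField m s + booleanField h s := by
  filter_upwards [ae_tendsto_booleanField m, ae_tendsto_booleanField h,
    ae_tendsto_booleanField (m + h)] with s h1 h2 h3
  refine tendsto_nhds_unique h3 ((h1.add h2).congr fun n => ?_)
  simp [partialField, mul_add, Finset.sum_add_distrib]

lemma booleanField_smul (c : ℝ) (m : Magnetizations) :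
    ∀ᵐ s ∂signLaw, booleanField (c • m) s = c * booleanField m s := by
  filter_upwards [ae_tendsto_booleanField m, ae_tendsto_booleanField (c • m)] with s h1 h3
  refine tendsto_nhds_unique h3 ((h1.const_mul c).congr fun n => ?_)
  simp [partialField, Finset.mul_sum, mul_left_comm]

lemma booleanField_eq_of_support (m : Magnetizations) (k : ℕ) (hm : ∀ ν, k ≤ ν → m ν = 0)
    (s : ℕ → ℝ) : booleanField m s = ∑ ν ∈ Finset.range k, s ν * m ν := by
  refine (tendsto_const_nhds.congr' ?_).limUnder_eq
  filter_upwards [eventually_ge_atTop k] with n hn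
  refine Finset.sum_subset (by simpa using hn) fun ν _ hν => ?_
  rw [hm ν (by simpa using hν), mul_zero]

lemma booleanField_single (ν : ℕ) (c : ℝ) (s : ℕ → ℝ) :
    booleanField (lp.single 2 ν c) s = s ν * c := by
  rw [booleanField_eq_of_support _ (ν + 1)]
  · rw [Finset.sum_eq_single ν]
    · simp
    · intro τ _ h; simp [lp.single_apply, h]
    · simp
  · intro τ h
    have : τ ≠ ν := by omega
    simp [lp.single_apply, this]

/-! ### Elementary facts on `tanh` and `log cosh` -/

lemma hasDerivAt_tanh (x : ℝ) : HasDerivAt Real.tanh (1 - Real.tanh x ^ 2) x := by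
  have h := (Real.hasDerivAt_sinh x).div (Real.hasDerivAt_cosh x) (Real.cosh_pos x).ne'
  have e : Real.tanh = fun x => Real.sinh x / Real.cosh x := funext Real.tanh_eq_sinh_div_cosh
  rw [e]
  refine h.congr_deriv ?_
  have := (Real.cosh_pos x).ne'
  field_simp

lemma hasDerivAt_log_cosh (x : ℝ) :
    HasDerivAt (fun x => Real.log (Real.cosh x)) (Real.tanh x) x := by
  have h := (Real.hasDerivAt_cosh x).log (Real.cosh_pos x).ne'
  rwa [← Real.tanh_eq_sinh_div_cosh] at h

lemma abs_tanh_le_one (x : ℝ) : |Real.tanh x| ≤ 1 := (Real.abs_tanh_lt_one x).le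

lemma tanh_sq_le_one (x : ℝ) : Real.tanh x ^ 2 ≤ 1 := (Real.tanh_sq_lt_one x).le

lemma abs_image_sub_le {f f' : ℝ → ℝ} (hf : ∀ x, HasDerivAt f (f' x) x) (hb : ∀ x, |f' x| ≤ 1)
    (x y : ℝ) : |f x - f y| ≤ |x - y| := by
  have := Convex.norm_image_sub_le_of_norm_hasDerivWithin_le (f := f) (f' := f') (C := 1)
    (s := Set.univ) (x := y) (y := x)
    (fun x _ => (hf x).hasDerivWithinAt) (fun x _ => hb x) convex_univ trivial trivial
  simpa using this

lemma abs_tanh_sub_le (x y : ℝ) : |Real.tanh x - Real.tanh y| ≤ |x - y| := by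
  refine abs_image_sub_le hasDerivAt_tanh (fun x => ?_) x y
  rw [abs_le]
  constructor <;> nlinarith [tanh_sq_le_one x, sq_nonneg (Real.tanh x)]

lemma abs_log_cosh_sub_le (x y : ℝ) :
    |Real.log (Real.cosh x) - Real.log (Real.cosh y)| ≤ |x - y| :=
  abs_image_sub_le hasDerivAt_log_cosh abs_tanh_le_one x y

lemma abs_log_cosh_le (x : ℝ) : |Real.log (Real.cosh x)| ≤ |x| := by
  simpa using abs_log_cosh_sub_le x 0

/-- The function log cosh t - t tanh x has derivative tanh t - tanh x, which is at most |u| in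
absolute value within distance |u| of x. The mean value inequality gives u², which is enough here
although u²/2 is true. -/
lemma abs_log_cosh_taylor (x u : ℝ) :
    |Real.log (Real.cosh (x + u)) - Real.log (Real.cosh x) - u * Real.tanh x| ≤ u ^ 2 := by
  have := Convex.norm_image_sub_le_of_norm_hasDerivWithin_le
    (f := fun t => Real.log (Real.cosh t) - t * Real.tanh x)
    (f' := fun t => Real.tanh t - Real.tanh x) (C := |u|)
    (s := Set.Icc (x - |u|) (x + |u|)) (x := x) (y := x + u)
    (fun t _ => ((hasDerivAt_log_cosh t).sub
      (by simpa using (hasDerivAt_id t).mul_const (Real.tanh x))).hasDerivWithinAt)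
    (fun t ht => (abs_tanh_sub_le t x).trans (by
      rw [abs_le]; constructor <;> linarith [ht.1, ht.2]))
    (convex_Icc _ _) ⟨by linarith [abs_nonneg u], by linarith [abs_nonneg u]⟩
    ⟨by linarith [neg_abs_le u], by linarith [le_abs_self u]⟩
  simp only [Real.norm_eq_abs, add_sub_cancel_left] at this
  rw [← sq, sq_abs] at this
  refine le_trans (le_of_eq ?_) this
  congr 1; ring

lemma continuous_tanh : Continuous Real.tanh :=
  continuous_iff_continuousAt.2 fun x => (hasDerivAt_tanh x).continuousAt

lemma continuous_log_cosh : Continuous fun x => Real.log (Real.cosh x) :=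
  continuous_iff_continuousAt.2 fun x => (hasDerivAt_log_cosh x).continuousAt

/-- The variance of |f| is nonnegative. -/
lemma sq_integral_abs_le {Ω : Type*} [MeasurableSpace Ω] {P : Measure Ω} [IsProbabilityMeasure P]
    {f : Ω → ℝ} (hf : MemLp f 2 P) : (∫ ω, |f ω| ∂P) ^ 2 ≤ ∫ ω, f ω ^ 2 ∂P := by
  have h1 : Integrable (fun ω => |f ω|) P := (hf.integrable (by norm_num)).abs
  have h2 : Integrable (fun ω => f ω ^ 2) P := hf.integrable_sq
  set c := ∫ ω, |f ω| ∂P with hc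
  have h3 : 0 ≤ ∫ ω, (f ω ^ 2 - 2 * c * |f ω| + c ^ 2) ∂P := integral_nonneg fun ω => by
    simp only [Pi.zero_apply]
    nlinarith [sq_nonneg (|f ω| - c), sq_abs (f ω)]
  have h4 : Integrable (fun ω => f ω ^ 2 - 2 * c * |f ω|) P := h2.sub (h1.const_mul _)
  rw [integral_add h4 (integrable_const _), integral_sub h2 (h1.const_mul _), integral_const_mul, integral_const] at h3
  simp only [probReal_univ, smul_eq_mul, one_mul] at h3
  nlinarith

/-! ### Gaussian integration by parts -/

lemma hasDerivAt_gaussianPDFReal (x : ℝ) :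
    HasDerivAt (gaussianPDFReal 0 1) (-x * gaussianPDFReal 0 1 x) x := by
  have e : gaussianPDFReal 0 1 = fun x => (√(2 * Real.pi * 1))⁻¹ * Real.exp (-x ^ 2 / 2) := by
    ext x; simp [gaussianPDFReal]
  rw [e]
  have h := (((hasDerivAt_pow 2 x).neg.div_const 2).exp).const_mul (√(2 * Real.pi * 1))⁻¹
  refine h.congr_deriv ?_
  simp; ring

lemma integrable_gauss_iff (f : ℝ → ℝ) :
    Integrable f gauss ↔ Integrable (fun x => gaussianPDFReal 0 1 x * f x) volume := by
  rw [gauss, gaussianReal_of_var_ne_zero _ (by norm_num)]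
  rw [integrable_withDensity_iff_integrable_smul' (measurable_gaussianPDF _ _)
    (ae_of_all _ fun x => gaussianPDF_lt_top)]
  simp [toReal_gaussianPDF]

/-- The Gaussian density g satisfies g' = -x g, so this is integration by parts on the line.
Integrability of the three products makes the boundary terms vanish. -/
theorem gauss_integration_by_parts {f f' : ℝ → ℝ} (hf : ∀ x, HasDerivAt f (f' x) x)
    (h0 : Integrable f gauss) (h1 : Integrable (fun x => x * f x) gauss)
    (h2 : Integrable f' gauss) : ∫ x, x * f x ∂gauss = ∫ x, f' x ∂gauss := by
  rw [integrable_gauss_iff] at h0 h1 h2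
  rw [integral_gaussianReal_eq_integral_smul (by norm_num),
    integral_gaussianReal_eq_integral_smul (by norm_num)]
  have := integral_mul_deriv_eq_deriv_mul_of_integrable (u := gaussianPDFReal 0 1) (v := f)
    (u' := fun x => -x * gaussianPDFReal 0 1 x) (v' := f')
    (fun x _ => hasDerivAt_gaussianPDFReal x) (fun x _ => hf x) h2
    (by
      refine h1.neg.congr (ae_of_all _ fun x => ?_)
      simp; ring) h0
  simp only [smul_eq_mul]
  rw [this, ← integral_neg]
  refine integral_congr_ae (ae_of_all _ fun x => ?_)
  simp; ring

lemma memLp_gauss (p : NNReal) : MemLp (fun x : ℝ => x) p gauss := memLp_id_gaussianReal p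

lemma integrable_gauss_id : Integrable (fun x : ℝ => x) gauss :=
  (memLp_gauss 1).integrable (by norm_num)

lemma integral_gauss_sq : ∫ x, x ^ 2 ∂gauss = 1 := by
  have h := gauss_integration_by_parts (f := fun x => x) (f' := fun _ => 1)
    (fun x => hasDerivAt_id x) integrable_gauss_id
    (by simpa only [← sq] using (memLp_gauss 2).integrable_sq) (integrable_const _)
  simpa [← sq] using h

lemma integral_gauss_abs_le : ∫ x, |x| ∂gauss ≤ 1 := by
  have := sq_integral_abs_le (memLp_gauss 2)
  rw [integral_gauss_sq] at this
  exact (abs_le_one_iff_mul_self_le_one.2 (by nlinarith)) |> le_of_abs_le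

/-! ### The effective single-site field -/

lemma integral_comp_measurePreserving {Ω Ω' : Type*} [MeasurableSpace Ω] [MeasurableSpace Ω']
    {μ : Measure Ω} {ν : Measure Ω'} {g : Ω → Ω'} (hg : MeasurePreserving g μ ν) {f : Ω' → ℝ}
    (hf : AEStronglyMeasurable f ν) : ∫ x, f (g x) ∂μ = ∫ y, f y ∂ν := by
  have h := integral_map (f := f) hg.measurable.aemeasurable (by rwa [hg.map_eq])
  rw [hg.map_eq] at h
  exact h.symm

lemma abs_integral_le {Ω : Type*} [MeasurableSpace Ω] {P : Measure Ω} {f g : Ω → ℝ}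
    (hg : Integrable g P) (h : ∀ᵐ ω ∂P, |f ω| ≤ g ω) : |∫ ω, f ω ∂P| ≤ ∫ ω, g ω ∂P :=
  norm_integral_le_of_norm_le (f := f) hg h

instance : IsProbabilityMeasure siteLaw := by unfold siteLaw; infer_instance

/-- The local field, with the variance of its Gaussian part as a parameter. -/
noncomputable def effField (β : ℝ) (m : Magnetizations) (a : ℝ) (s : (ℕ → ℝ) × ℝ) : ℝ :=
  β * booleanField m s.1 + √a * s.2

lemma measurable_effField (β : ℝ) (m : Magnetizations) (a : ℝ) : Measurable (effField β m a) := by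
  have : Measurable fun s : (ℕ → ℝ) × ℝ => booleanField m s.1 :=
    (measurable_booleanField m).comp measurable_fst
  unfold effField
  exact (this.const_mul β).add (measurable_snd.const_mul _)

lemma memLp_booleanField_fst (m : Magnetizations) :
    MemLp (fun s : (ℕ → ℝ) × ℝ => booleanField m s.1) 2 siteLaw :=
  (memLp_booleanField m).comp_measurePreserving measurePreserving_fst

lemma memLp_snd_siteLaw : MemLp (fun s : (ℕ → ℝ) × ℝ => s.2) 2 siteLaw :=
  (memLp_gauss 2).comp_measurePreserving (measurePreserving_snd (μ := signLaw))

lemma memLp_effField (β : ℝ) (m : Magnetizations) (a : ℝ) : MemLp (effField β m a) 2 siteLaw :=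
  ((memLp_booleanField_fst m).const_mul β).add (memLp_snd_siteLaw.const_mul _)

lemma integrable_effField (β : ℝ) (m : Magnetizations) (a : ℝ) :
    Integrable (effField β m a) siteLaw := (memLp_effField β m a).integrable (by norm_num)

lemma integral_fst_siteLaw (f : (ℕ → ℝ) → ℝ) (hf : AEStronglyMeasurable f signLaw) :
    ∫ s, f s.1 ∂siteLaw = ∫ s, f s ∂signLaw :=
  integral_comp_measurePreserving (measurePreserving_fst (μ := signLaw) (ν := gauss)) hf

lemma integral_booleanField_fst_sq_le (m : Magnetizations) :
    ∫ s, booleanField m s.1 ^ 2 ∂siteLaw ≤ ‖m‖ ^ 2 := by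
  rw [integral_fst_siteLaw (fun s => booleanField m s ^ 2)
    ((measurable_booleanField m).pow_const 2).aestronglyMeasurable]
  exact integral_booleanField_sq_le m

lemma integral_abs_booleanField_le (m : Magnetizations) :
    ∫ s, |booleanField m s| ∂signLaw ≤ ‖m‖ := by
  have := (sq_integral_abs_le (memLp_booleanField m)).trans (integral_booleanField_sq_le m)
  exact abs_le_of_sq_le_sq' this (norm_nonneg _) |>.2

lemma integral_abs_booleanField_fst_le (m : Magnetizations) :
    ∫ s, |booleanField m s.1| ∂siteLaw ≤ ‖m‖ := by
  rw [integral_fst_siteLaw (fun s => |booleanField m s|)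
    (measurable_booleanField m).abs.aestronglyMeasurable]
  exact integral_abs_booleanField_le m

lemma integral_abs_booleanField_mul_abs_le (m : Magnetizations) :
    ∫ s, |booleanField m s.1| * |s.2| ∂siteLaw ≤ ‖m‖ := by
  rw [siteLaw, integral_prod_mul (fun s => |booleanField m s|) (fun y : ℝ => |y|)]
  have h1 := integral_abs_booleanField_le m
  have h2 := integral_gauss_abs_le
  have h3 : 0 ≤ ∫ s, |booleanField m s| ∂signLaw := integral_nonneg fun _ => abs_nonneg _
  have h4 : 0 ≤ ∫ x, |x| ∂gauss := integral_nonneg fun _ => abs_nonneg _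
  nlinarith

lemma ae_siteLaw_of_signLaw {p : (ℕ → ℝ) → Prop} (h : ∀ᵐ s ∂signLaw, p s) :
    ∀ᵐ s ∂siteLaw, p s.1 :=
  (measurePreserving_fst (μ := signLaw) (ν := gauss)).quasiMeasurePreserving.ae h

lemma effField_add (β : ℝ) (m h : Magnetizations) (a : ℝ) :
    ∀ᵐ s ∂siteLaw, effField β (m + h) a s = effField β m a s + β * booleanField h s.1 := by
  filter_upwards [ae_siteLaw_of_signLaw (booleanField_add m h)] with s hs
  rw [effField, effField, hs]; ring

/-- The mean of `log cosh` of the local field. -/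
noncomputable def logCoshMean (β : ℝ) (m : Magnetizations) (a : ℝ) : ℝ :=
  ∫ s, Real.log (Real.cosh (effField β m a s)) ∂siteLaw

lemma integrable_of_abs_le {Ω : Type*} [MeasurableSpace Ω] {P : Measure Ω} {f g : Ω → ℝ}
    (hg : Integrable g P) (hf : AEStronglyMeasurable f P) (h : ∀ ω, |f ω| ≤ g ω) :
    Integrable f P :=
  hg.mono' hf (ae_of_all _ h)

lemma integrable_log_cosh_effField (β : ℝ) (m : Magnetizations) (a : ℝ) :
    Integrable (fun s => Real.log (Real.cosh (effField β m a s))) siteLaw :=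
  integrable_of_abs_le (integrable_effField β m a).abs
    (continuous_log_cosh.measurable.comp (measurable_effField β m a)).aestronglyMeasurable
    fun _ => abs_log_cosh_le _

lemma measurable_tanh_effField (β : ℝ) (m : Magnetizations) (a : ℝ) :
    Measurable fun s => Real.tanh (effField β m a s) :=
  continuous_tanh.measurable.comp (measurable_effField β m a)

lemma integrable_mul_tanh {f : (ℕ → ℝ) × ℝ → ℝ} (hf : Integrable f siteLaw)
    (β : ℝ) (m : Magnetizations) (a : ℝ) :
    Integrable (fun s => f s * Real.tanh (effField β m a s)) siteLaw :=
  hf.mul_bdd (c := 1) (measurable_tanh_effField β m a).aestronglyMeasurable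
    (ae_of_all _ fun _ => abs_tanh_le_one _)

lemma integrable_tanh_sq (β : ℝ) (m : Magnetizations) (a : ℝ) :
    Integrable (fun s => Real.tanh (effField β m a s) ^ 2) siteLaw :=
  integrable_of_abs_le (integrable_const 1)
    ((measurable_tanh_effField β m a).pow_const 2).aestronglyMeasurable
    fun s => by rw [abs_of_nonneg (sq_nonneg _)]; exact tanh_sq_le_one _

/-- The linear functional `h ↦ 𝐄[(∑ ξ̃^ν h_ν) tanh(local field)]`. -/
noncomputable def tanhFunctional (β : ℝ) (m : Magnetizations) (a : ℝ) : Magnetizations →L[ℝ] ℝ :=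
  LinearMap.mkContinuous
    { toFun := fun h => ∫ s, booleanField h s.1 * Real.tanh (effField β m a s) ∂siteLaw
      map_add' := fun h h' => by
        rw [← integral_add (integrable_mul_tanh ((memLp_booleanField_fst h).integrable
          (by norm_num)) β m a) (integrable_mul_tanh ((memLp_booleanField_fst h').integrable
          (by norm_num)) β m a)]
        refine integral_congr_ae ?_
        filter_upwards [ae_siteLaw_of_signLaw (booleanField_add h h')] with s hs
        rw [hs]; ring
      map_smul' := fun c h => by
        rw [RingHom.id_apply, smul_eq_mul, ← integral_const_mul]
        refine integral_congr_ae ?_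
        filter_upwards [ae_siteLaw_of_signLaw (booleanField_smul c h)] with s hs
        rw [hs]; ring } 1 (fun h => by
    rw [one_mul]
    refine (abs_integral_le ((memLp_booleanField_fst h).integrable (by norm_num)).abs
      (ae_of_all _ fun s => ?_)).trans (integral_abs_booleanField_fst_le h)
    rw [abs_mul]
    exact mul_le_of_le_one_right (abs_nonneg _) (abs_tanh_le_one _))

lemma tanhFunctional_apply (β : ℝ) (m : Magnetizations) (a : ℝ) (h : Magnetizations) :
    tanhFunctional β m a h = ∫ s, booleanField h s.1 * Real.tanh (effField β m a s) ∂siteLaw :=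
  rfl

lemma tanhFunctional_single (β : ℝ) (m : Magnetizations) (a : ℝ) (ν : ℕ) :
    tanhFunctional β m a (lp.single 2 ν 1) =
      ∫ s, s.1 ν * Real.tanh (effField β m a s) ∂siteLaw := by
  simp [tanhFunctional_apply, booleanField_single]

lemma abs_effField_sub (β : ℝ) (m : Magnetizations) (a b : ℝ) (s : (ℕ → ℝ) × ℝ) :
    |effField β m a s - effField β m b s| = |√a - √b| * |s.2| := by
  rw [← abs_mul]; congr 1; unfold effField; ring

/-- The increment in m is taken at variance b but compared with the derivative at variance a, so
that joint differentiability at (m, a) follows at once. The first error term is the Taylor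
remainder, with E(∑ ξ̃ h)² ≤ ‖h‖². The second comes from the Lipschitz bound on tanh and the
independence of the signs and η. -/
lemma abs_logCoshMean_remainder_le (β : ℝ) (m h : Magnetizations) (a b : ℝ) :
    |logCoshMean β (m + h) b - logCoshMean β m b - β * tanhFunctional β m a h| ≤
      β ^ 2 * ‖h‖ ^ 2 + |β| * |√b - √a| * ‖h‖ := by
  have hφ := (memLp_booleanField_fst h).integrable (by norm_num)
  have hφ2 := (memLp_booleanField_fst h).integrable_sq
  have hφη : Integrable (fun s : (ℕ → ℝ) × ℝ => |booleanField h s.1| * |s.2|) siteLaw :=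
    (memLp_booleanField_fst h).abs.integrable_mul memLp_snd_siteLaw.abs
  have hd : Integrable (fun s => Real.log (Real.cosh (effField β (m + h) b s)) -
      Real.log (Real.cosh (effField β m b s))) siteLaw :=
    (integrable_log_cosh_effField _ _ _).sub (integrable_log_cosh_effField _ _ _)
  rw [logCoshMean, logCoshMean, tanhFunctional_apply, ← integral_const_mul,
    ← integral_sub (integrable_log_cosh_effField _ _ _) (integrable_log_cosh_effField _ _ _),
    ← integral_sub hd ((integrable_mul_tanh hφ _ _ _).const_mul _)]
  have hb : ∫ s, (β ^ 2 * booleanField h s.1 ^ 2 +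
      |β| * |√b - √a| * (|booleanField h s.1| * |s.2|)) ∂siteLaw ≤
      β ^ 2 * ‖h‖ ^ 2 + |β| * |√b - √a| * ‖h‖ := by
    rw [integral_add (hφ2.const_mul _) (hφη.const_mul _), integral_const_mul, integral_const_mul]
    gcongr
    · exact integral_booleanField_fst_sq_le h
    · exact integral_abs_booleanField_mul_abs_le h
  refine (abs_integral_le ((hφ2.const_mul _).add (hφη.const_mul _)) ?_).trans hb
  filter_upwards [effField_add β m h b] with s hs
  rw [hs, Pi.add_apply]
  have h1 := abs_log_cosh_taylor (effField β m b s) (β * booleanField h s.1)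
  have h2 : |β * booleanField h s.1 * (Real.tanh (effField β m b s) -
      Real.tanh (effField β m a s))| ≤ |β| * |booleanField h s.1| * (|√b - √a| * |s.2|) := by
    rw [abs_mul, abs_mul, ← abs_effField_sub]
    exact mul_le_mul_of_nonneg_left (abs_tanh_sub_le _ _) (by positivity)
  calc _ = |(Real.log (Real.cosh (effField β m b s + β * booleanField h s.1)) -
        Real.log (Real.cosh (effField β m b s)) -
        β * booleanField h s.1 * Real.tanh (effField β m b s)) +
        β * booleanField h s.1 * (Real.tanh (effField β m b s) -
          Real.tanh (effField β m a s))| := by congr 1; ring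
    _ ≤ _ := (abs_add_le _ _).trans (add_le_add h1 h2)
    _ = _ := by ring

/-- Subtracting the value at m with the same variance isolates the increment in m. The remainder
then needs only continuity of the square root, which is not differentiable at 0. The dependence on
the variance is treated separately. -/
lemma hasFDerivWithinAt_logCoshMean_sub (β : ℝ) (m : Magnetizations) (a : ℝ) :
    HasFDerivWithinAt (fun y : Magnetizations × ℝ => logCoshMean β y.1 y.2 - logCoshMean β m y.2)
      ((β • tanhFunctional β m a).comp (ContinuousLinearMap.fst ℝ _ _)) {y | 0 ≤ y.2} (m, a) := by
  rw [hasFDerivWithinAt_iff_isLittleO]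
  have hlim : Tendsto (fun y : Magnetizations × ℝ => β ^ 2 * ‖y.1 - m‖ + |β| * |√y.2 - √a|)
      (𝓝[{y | 0 ≤ y.2}] (m, a)) (𝓝 0) := by
    refine tendsto_nhdsWithin_of_tendsto_nhds ?_
    have : Continuous fun y : Magnetizations × ℝ => β ^ 2 * ‖y.1 - m‖ + |β| * |√y.2 - √a| := by
      fun_prop
    simpa using this.tendsto (m, a)
  refine (Asymptotics.isLittleO_iff.2 fun ε hε => ?_)
  filter_upwards [hlim.eventually (gt_mem_nhds hε)] with y hy
  have h := abs_logCoshMean_remainder_le β m (y.1 - m) a y.2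
  simp only [add_sub_cancel] at h
  have h1 : ‖y.1 - m‖ ≤ ‖y - (m, a)‖ := norm_fst_le (y - (m, a))
  simp only [sub_self, sub_zero, ContinuousLinearMap.coe_comp, Function.comp_apply,
    ContinuousLinearMap.coe_fst', Prod.fst_sub, smul_apply, smul_eq_mul,
    Real.norm_eq_abs]
  refine h.trans ?_
  calc _ = (β ^ 2 * ‖y.1 - m‖ + |β| * |√y.2 - √a|) * ‖y.1 - m‖ := by ring
    _ ≤ ε * ‖y - (m, a)‖ := by gcongr

/-! ### Derivative in the variance of the Gaussian part -/

lemma abs_logCoshMean_sub_le (β : ℝ) (m : Magnetizations) (a b : ℝ) :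
    |logCoshMean β m a - logCoshMean β m b| ≤ |√a - √b| := by
  rw [logCoshMean, logCoshMean,
    ← integral_sub (integrable_log_cosh_effField _ _ _) (integrable_log_cosh_effField _ _ _)]
  have hη : Integrable (fun s : (ℕ → ℝ) × ℝ => |s.2|) siteLaw :=
    (memLp_snd_siteLaw.integrable (by norm_num)).abs
  refine (abs_integral_le (hη.const_mul |√a - √b|) (ae_of_all _ fun s => ?_)).trans ?_
  · rw [← abs_effField_sub β m]
    exact abs_log_cosh_sub_le _ _
  · rw [integral_const_mul]
    have h : ∫ s : (ℕ → ℝ) × ℝ, |s.2| ∂siteLaw = ∫ x, |x| ∂gauss :=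
      integral_comp_measurePreserving (f := fun x => |x|)
        (measurePreserving_snd (μ := signLaw) (ν := gauss)) (by fun_prop)
    rw [h]
    exact mul_le_of_le_one_right (abs_nonneg _) integral_gauss_abs_le

/-- Integration by parts in η at fixed signs. The factor √a it produces cancels the 1/√a coming from
differentiating √a, which keeps the derivative in a bounded near 0. -/
lemma integral_snd_mul_tanh (β : ℝ) (m : Magnetizations) (a : ℝ) :
    ∫ s, s.2 * Real.tanh (effField β m a s) ∂siteLaw =
      √a * ∫ s, (1 - Real.tanh (effField β m a s) ^ 2) ∂siteLaw := by
  have h1 : Integrable (fun s : (ℕ → ℝ) × ℝ => s.2 * Real.tanh (effField β m a s)) siteLaw :=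
    integrable_mul_tanh (memLp_snd_siteLaw.integrable (by norm_num)) β m a
  have h2 : Integrable (fun s => 1 - Real.tanh (effField β m a s) ^ 2) siteLaw :=
    (integrable_const _).sub (integrable_tanh_sq β m a)
  rw [siteLaw] at h1 h2 ⊢
  rw [integral_prod _ h1, integral_prod _ h2, ← integral_const_mul]
  refine integral_congr_ae (ae_of_all _ fun t => ?_)
  simp only [effField]
  rw [← integral_const_mul]
  have hm : Measurable fun x : ℝ => Real.tanh (β * booleanField m t + √a * x) :=
    continuous_tanh.measurable.comp (by fun_prop)
  refine gauss_integration_by_parts (f := fun x => Real.tanh (β * booleanField m t + √a * x))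
    (fun x => ?_) ?_ ?_ ?_
  · have := (hasDerivAt_tanh (β * booleanField m t + √a * x)).comp x
      (((hasDerivAt_id x).const_mul (√a)).const_add (β * booleanField m t))
    refine this.congr_deriv ?_
    simp; ring
  · exact integrable_of_abs_le (integrable_const 1) hm.aestronglyMeasurable
      fun _ => abs_tanh_le_one _
  · exact integrable_gauss_id.mul_bdd (c := 1) hm.aestronglyMeasurable
      (ae_of_all _ fun _ => abs_tanh_le_one _)
  · refine ((integrable_const 1).sub (integrable_of_abs_le (integrable_const 1)
      (hm.pow_const 2).aestronglyMeasurable fun x => ?_)).const_mul _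
    rw [abs_of_nonneg (sq_nonneg _)]; exact tanh_sq_le_one _

/-- The mean of `sech²` of the local field. -/
noncomputable def sechSqMean (β : ℝ) (m : Magnetizations) (a : ℝ) : ℝ :=
  ∫ s, (1 - Real.tanh (effField β m a s) ^ 2) ∂siteLaw

lemma hasDerivAt_logCoshMean (β : ℝ) (m : Magnetizations) {a : ℝ} (ha : 0 < a) :
    HasDerivAt (fun a => logCoshMean β m a) (sechSqMean β m a / 2) a := by
  -- Staying above a/2 keeps 1/√b bounded, which supplies the dominating function.
  have hs : Set.Ioi (a / 2) ∈ 𝓝 a := Ioi_mem_nhds (by linarith)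
  have hη : Integrable (fun s : (ℕ → ℝ) × ℝ => |s.2| * (1 / (2 * √(a / 2)))) siteLaw :=
    (memLp_snd_siteLaw.integrable (by norm_num)).abs.mul_const _
  have h := (hasDerivAt_integral_of_dominated_loc_of_deriv_le (μ := siteLaw) (x₀ := a)
    (F := fun a s => Real.log (Real.cosh (effField β m a s)))
    (F' := fun a s => Real.tanh (effField β m a s) * (1 / (2 * √a) * s.2)) hs
    (Eventually.of_forall fun b => (integrable_log_cosh_effField β m b).aestronglyMeasurable)
    (integrable_log_cosh_effField β m a)
    ((measurable_tanh_effField β m a).mul (measurable_snd.const_mul _)).aestronglyMeasurable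
    (ae_of_all _ fun s b hb => by
      simp only [norm_mul, Real.norm_eq_abs]
      have hb' : a / 2 < b := hb
      have h1 : |1 / (2 * √b)| ≤ 1 / (2 * √(a / 2)) := by
        rw [abs_of_nonneg (by positivity)]
        gcongr
      calc _ ≤ 1 * (1 / (2 * √(a / 2)) * |s.2|) := by
            gcongr
            exact abs_tanh_le_one _
        _ = _ := by ring) hη
    (ae_of_all _ fun s b hb => by
      have hb' : a / 2 < b := hb
      exact (hasDerivAt_log_cosh _).comp b
        (((Real.hasDerivAt_sqrt (by linarith)).mul_const s.2).const_add _))).2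
  refine h.congr_deriv ?_
  have : ∀ s : (ℕ → ℝ) × ℝ, Real.tanh (effField β m a s) * (1 / (2 * √a) * s.2) =
      1 / (2 * √a) * (s.2 * Real.tanh (effField β m a s)) := fun s => by ring
  simp_rw [this]
  rw [integral_const_mul, integral_snd_mul_tanh, sechSqMean]
  have := (Real.sqrt_pos.2 ha).ne'
  field_simp

lemma continuous_sechSqMean (β : ℝ) (m : Magnetizations) : Continuous (sechSqMean β m) := by
  refine continuous_of_dominated (bound := fun _ => 1) (fun a => ?_) (fun a => ?_)
    (integrable_const _) (ae_of_all _ fun s => ?_)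
  · exact ((integrable_const (1 : ℝ)).sub (integrable_tanh_sq β m a)).aestronglyMeasurable
  · refine ae_of_all _ fun s => ?_
    rw [Real.norm_eq_abs, abs_le]
    constructor <;> nlinarith [tanh_sq_le_one (effField β m a s),
      sq_nonneg (Real.tanh (effField β m a s))]
  · unfold effField
    exact continuous_const.sub ((continuous_tanh.comp (by fun_prop)).pow 2)

/-- At a = 0 differentiation under the integral fails. The function is however continuous and its
derivatives at b > 0 converge as b → 0, so their limit is the right derivative. -/
lemma hasDerivWithinAt_logCoshMean (β : ℝ) (m : Magnetizations) {a : ℝ} (ha : 0 ≤ a) :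
    HasDerivWithinAt (fun a => logCoshMean β m a) (sechSqMean β m a / 2) (Set.Ici 0) a := by
  rcases ha.eq_or_lt with rfl | ha
  · refine hasDerivWithinAt_Ici_of_tendsto_deriv (s := Set.Ioi 0)
      (fun b hb => (hasDerivAt_logCoshMean β m hb).differentiableAt.differentiableWithinAt) ?_
      self_mem_nhdsWithin ?_
    · refine Continuous.continuousWithinAt ?_
      refine continuous_iff_continuousAt.2 fun b => ?_
      refine tendsto_iff_dist_tendsto_zero.2 (squeeze_zero (fun _ => dist_nonneg)
        (fun c => abs_logCoshMean_sub_le β m c b) ?_)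
      have : Continuous fun c => |√c - √b| := by fun_prop
      simpa using this.tendsto b
    · refine Tendsto.congr' (f₁ := fun b => sechSqMean β m b / 2) ?_ ?_
      · filter_upwards [self_mem_nhdsWithin] with b hb
        exact (hasDerivAt_logCoshMean β m hb).deriv.symm
      · exact tendsto_nhdsWithin_of_tendsto_nhds
          (((continuous_sechSqMean β m).div_const 2).tendsto 0)
  · exact (hasDerivAt_logCoshMean β m ha).hasDerivWithinAt

lemma hasFDerivWithinAt_logCoshMean (β : ℝ) (m : Magnetizations) {a : ℝ} (ha : 0 ≤ a) :
    HasFDerivWithinAt (fun y : Magnetizations × ℝ => logCoshMean β y.1 y.2)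
      ((β • tanhFunctional β m a).comp (ContinuousLinearMap.fst ℝ _ _) +
        (sechSqMean β m a / 2) • ContinuousLinearMap.snd ℝ _ _) {y | 0 ≤ y.2} (m, a) := by
  have h1 := hasFDerivWithinAt_logCoshMean_sub β m a
  have h0 : HasFDerivWithinAt (Prod.snd : Magnetizations × ℝ → ℝ)
      (ContinuousLinearMap.snd ℝ Magnetizations ℝ) {y | 0 ≤ y.2} (m, a) := hasFDerivWithinAt_snd
  have h2 := (hasDerivWithinAt_logCoshMean β m ha).comp_hasFDerivWithinAt
    ((m, a) : Magnetizations × ℝ) h0 (fun y hy => hy)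
  refine (h1.add h2).congr_of_eventuallyEq ?_ ?_
  · exact Eventually.of_forall fun y => by simp
  · simp

/-! ### Stationary points of the trial free energy -/

lemma localField_eq (α β : ℝ) (m : Magnetizations) (p : ℝ) (s : (ℕ → ℝ) × ℝ) :
    localField α β m p s = effField β m (α * β * p) s := rfl

lemma sechSqMean_eq (β : ℝ) (m : Magnetizations) (a : ℝ) :
    sechSqMean β m a = 1 - ∫ s, Real.tanh (effField β m a s) ^ 2 ∂siteLaw := by
  rw [sechSqMean, integral_sub (integrable_const _) (integrable_tanh_sq β m a)]
  simp

lemma trialFreeEnergy_eq (α β : ℝ) (m : Magnetizations) (q p : ℝ) :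
    trialFreeEnergy α β m q p = -(α * β / 2) - α / 2 * Real.log (1 - β * (1 - q))
      + α * β * q / (2 * (1 - β * (1 - q))) - β / 2 * ‖m‖ ^ 2 + Real.log 2
      + logCoshMean β m (α * β * p) - α * β / 2 * p * (1 - q) := by
  rw [trialFreeEnergy, norm_sq_eq]; rfl

/-- The derivative of the trial free energy. -/
noncomputable def trialDerivative (α β : ℝ) (m : Magnetizations) (q p : ℝ) :
    Magnetizations × ℝ × ℝ →L[ℝ] ℝ :=
  (β • (tanhFunctional β m (α * β * p) - innerSL ℝ m)).comp (ContinuousLinearMap.fst ℝ _ _) +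
  ((α * β / 2 * (p - β * q / (1 - β * (1 - q)) ^ 2)) • (ContinuousLinearMap.fst ℝ ℝ ℝ) +
    (α * β / 2 * (q - ∫ s, Real.tanh (effField β m (α * β * p) s) ^ 2 ∂siteLaw)) •
      (ContinuousLinearMap.snd ℝ ℝ ℝ)).comp (ContinuousLinearMap.snd ℝ _ _)

lemma trialDerivative_apply (α β : ℝ) (m : Magnetizations) (q p : ℝ) (h : Magnetizations)
    (x y : ℝ) : trialDerivative α β m q p (h, x, y) =
      β * (tanhFunctional β m (α * β * p) h - inner ℝ m h) +
      (α * β / 2 * (p - β * q / (1 - β * (1 - q)) ^ 2) * x +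
        α * β / 2 * (q - ∫ s, Real.tanh (effField β m (α * β * p) s) ^ 2 ∂siteLaw) * y) := by
  simp [trialDerivative]

/-- Chain rule, with αβ ≥ 0 sending the half-space into the nonnegative variances where the
one-sided derivative is available. In the q-component, with D = 1 - β(1-q), the terms ∓αβ/(2D) from
the logarithm and from the quotient cancel, leaving only -αβ²q/(2D²). -/
theorem hasFDerivWithinAt_trialFreeEnergy {α β : ℝ} (hα : 0 ≤ α) (hβ : 0 < β) (m : Magnetizations)
    {q p : ℝ} (hq : β * (1 - q) < 1) (hp : 0 ≤ p) :
    HasFDerivWithinAt (fun y : Magnetizations × ℝ × ℝ => trialFreeEnergy α β y.1 y.2.1 y.2.2)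
      (trialDerivative α β m q p) {y | 0 ≤ y.2.2} (m, q, p) := by
  set S : Set (Magnetizations × ℝ × ℝ) := {y | 0 ≤ y.2.2}
  have hm : HasFDerivWithinAt (fun y : Magnetizations × ℝ × ℝ => y.1)
    (ContinuousLinearMap.fst ℝ _ _) S (m, q, p) := hasFDerivWithinAt_fst
  have hq' : HasFDerivWithinAt (fun y : Magnetizations × ℝ × ℝ => y.2.1)
    ((ContinuousLinearMap.fst ℝ ℝ ℝ).comp (ContinuousLinearMap.snd ℝ _ _)) S (m, q, p) :=
    (ContinuousLinearMap.hasFDerivAt ((ContinuousLinearMap.fst ℝ ℝ ℝ).comp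
      (ContinuousLinearMap.snd ℝ Magnetizations (ℝ × ℝ)))).hasFDerivWithinAt
  have hp' : HasFDerivWithinAt (fun y : Magnetizations × ℝ × ℝ => y.2.2)
    ((ContinuousLinearMap.snd ℝ ℝ ℝ).comp (ContinuousLinearMap.snd ℝ _ _)) S (m, q, p) :=
    (ContinuousLinearMap.hasFDerivAt ((ContinuousLinearMap.snd ℝ ℝ ℝ).comp
      (ContinuousLinearMap.snd ℝ Magnetizations (ℝ × ℝ)))).hasFDerivWithinAt
  have hnorm : HasFDerivWithinAt (fun y : Magnetizations × ℝ × ℝ => ‖y.1‖ ^ 2) _ S (m, q, p) :=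
    hm.norm_sq
  have hG := (hasFDerivWithinAt_logCoshMean β m (a := α * β * p) (by positivity)).comp
    ((m, q, p) : Magnetizations × ℝ × ℝ) (hm.prodMk (hp'.const_mul (α * β)))
    (fun y hy => by
      have : (0 : ℝ) ≤ y.2.2 := hy
      simp only [Set.mem_ofPred_eq]; positivity)
  have hD : 0 < 1 - β * (1 - q) := by linarith
  have hs : HasDerivAt (fun q => -(α * β / 2) - α / 2 * Real.log (1 - β * (1 - q))
      + α * β * q / (2 * (1 - β * (1 - q)))) (-(α * β / 2) * (β * q / (1 - β * (1 - q)) ^ 2)) q := by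
    have h1 : HasDerivAt (fun q => 1 - β * (1 - q)) β q := by
      have := (((hasDerivAt_id q).const_sub 1).const_mul β).const_sub 1
      simpa using this
    have h2 := ((h1.log hD.ne').const_mul (α / 2)).const_sub (-(α * β / 2))
    have h3 := ((hasDerivAt_id q).const_mul (α * β)).div (h1.const_mul 2) (by positivity)
    refine (h2.add h3).congr_deriv ?_
    simp only [id]
    field_simp
    ring
  have hs' := hs.comp_hasFDerivWithinAt ((m, q, p) : Magnetizations × ℝ × ℝ) hq'
  have hpq := (hp'.const_mul (α * β / 2)).mul (hq'.const_sub 1)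
  have htot := (((hs'.sub (hnorm.const_mul (β / 2))).add_const (Real.log 2)).add hG).sub hpq
  refine (htot.congr_fderiv ?_).congr_of_eventuallyEq (Eventually.of_forall fun y => ?_) ?_
  · ext y
    · simp [trialDerivative]
      ring
    · simp [trialDerivative]
      ring
    · simp [trialDerivative, sechSqMean_eq]
      ring
  · exact trialFreeEnergy_eq α β y.1 y.2.1 y.2.2
  · exact trialFreeEnergy_eq α β m q p

lemma inner_single_right (m : Magnetizations) (ν : ℕ) :
    inner ℝ m (lp.single 2 ν (1 : ℝ)) = m ν := by
  rw [lp.inner_single_right]; simp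

/-- Every ℓ² vector is the norm limit of finite combinations of coordinate vectors. It turns the
countably many equations for m_ν into the vanishing of a functional on ℓ². -/
lemma ext_single {f g : Magnetizations →L[ℝ] ℝ}
    (h : ∀ ν, f (lp.single 2 ν 1) = g (lp.single 2 ν 1)) : f = g := by
  ext v
  have hv := lp.hasSum_single (E := fun _ : ℕ => ℝ) (p := 2) (by norm_num) v
  refine (hv.mapL f).unique ?_
  convert hv.mapL g using 2 with ν
  have : lp.single 2 ν (v ν) = v ν • (lp.single 2 ν 1 : Magnetizations) := by
    rw [← lp.single_smul, smul_eq_mul, mul_one]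
  rw [this, map_smul, map_smul, h]

theorem trialDerivative_eq_zero_of_selfConsistent {α β : ℝ} {m : Magnetizations} {q p : ℝ}
    (h : SelfConsistent α β m q p) : trialDerivative α β m q p = 0 := by
  obtain ⟨h1, h2, h3⟩ := h
  have hT : tanhFunctional β m (α * β * p) = innerSL ℝ m := ext_single fun ν => by
    rw [tanhFunctional_single, innerSL_apply_apply, inner_single_right, h3 ν]
    rfl
  have h2' : q = ∫ s, Real.tanh (effField β m (α * β * p) s) ^ 2 ∂siteLaw := h2
  rw [trialDerivative, hT, ← h1, ← h2']
  simp

theorem selfConsistent_of_trialDerivative_eq_zero {α β : ℝ} (hα : 0 < α) (hβ : 0 < β)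
    {m : Magnetizations} {q p : ℝ} (h : trialDerivative α β m q p = 0) :
    SelfConsistent α β m q p := by
  have hab : α * β / 2 ≠ 0 := by positivity
  refine ⟨?_, ?_, fun ν => ?_⟩
  · have := trialDerivative_apply α β m q p 0 1 0
    rw [h] at this
    simp [hα.ne', hβ.ne'] at this
    linarith
  · have := trialDerivative_apply α β m q p 0 0 1
    rw [h] at this
    simp [hα.ne', hβ.ne'] at this
    exact sub_eq_zero.1 this
  · have := trialDerivative_apply α β m q p (lp.single 2 ν 1) 0 0
    rw [h, inner_single_right, tanhFunctional_single] at this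
    simp [hβ.ne'] at this
    exact (sub_eq_zero.1 this).symm

theorem isStationaryPoint_of_selfConsistent {α β : ℝ} (hα : 0 ≤ α) (hβ : 0 < β)
    {m : Magnetizations} {q p : ℝ} (hq : β * (1 - q) < 1) (hp : 0 ≤ p)
    (h : SelfConsistent α β m q p) : IsStationaryPoint α β m q p := by
  have := hasFDerivWithinAt_trialFreeEnergy hα hβ m hq hp
  rwa [trialDerivative_eq_zero_of_selfConsistent h] at this

/-- The half-space is convex with nonempty interior, so the derivative within it is unique even at
boundary points with p = 0. A vanishing derivative must therefore be the explicit one, and αβ ≠ 0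
allows division in the q- and p-components. -/
theorem isStationaryPoint_iff_selfConsistent {α β : ℝ} (hα : 0 < α) (hβ : 0 < β)
    {m : Magnetizations} {q p : ℝ} (hq : β * (1 - q) < 1) (hp : 0 ≤ p) :
    IsStationaryPoint α β m q p ↔ SelfConsistent α β m q p := by
  refine ⟨fun h => selfConsistent_of_trialDerivative_eq_zero hα hβ ?_,
    isStationaryPoint_of_selfConsistent hα.le hβ hq hp⟩
  have hu : UniqueDiffWithinAt ℝ {y : Magnetizations × ℝ × ℝ | 0 ≤ y.2.2} (m, q, p) := by
    refine uniqueDiffWithinAt_convex ?_ ?_ (subset_closure hp)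
    · exact convex_halfSpace_ge (f := fun y : Magnetizations × ℝ × ℝ => y.2.2)
        ⟨fun _ _ => rfl, fun _ _ => rfl⟩ 0
    · refine ⟨(0, 0, 1), mem_interior_iff_mem_nhds.2 ?_⟩
      have : Continuous fun y : Magnetizations × ℝ × ℝ => y.2.2 := by fun_prop
      filter_upwards [this.tendsto (0, 0, 1) |>.eventually (lt_mem_nhds (zero_lt_one' ℝ))]
        with y hy using hy.le
  exact hu.eq (hasFDerivWithinAt_trialFreeEnergy hα.le hβ m hq hp) h

/-! ### Gibbs averages over a finite set -/

section Gibbs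

variable {S T : Type*} [Fintype S] [Fintype T]

/-- The sum of the Boltzmann weights `e^{E s}`. -/
noncomputable def gibbsSum (E : S → ℝ) : ℝ := ∑ s, Real.exp (E s)

/-- The Gibbs average of `f` with Boltzmann weights `e^{E s}`. -/
noncomputable def gibbsAvg (E f : S → ℝ) : ℝ := (∑ s, Real.exp (E s) * f s) / gibbsSum E

/-- The logarithm of the sum of the Boltzmann weights `e^{E s}`. -/
noncomputable def logSumExp (E : S → ℝ) : ℝ := Real.log (gibbsSum E)

lemma gibbsSum_pos [Nonempty S] (E : S → ℝ) : 0 < gibbsSum E :=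
  Finset.sum_pos (fun _ _ => Real.exp_pos _) Finset.univ_nonempty

lemma gibbsAvg_add (E f g : S → ℝ) :
    gibbsAvg E (fun s => f s + g s) = gibbsAvg E f + gibbsAvg E g := by
  simp [gibbsAvg, mul_add, Finset.sum_add_distrib, add_div]

lemma gibbsAvg_const_mul (E f : S → ℝ) (c : ℝ) :
    gibbsAvg E (fun s => c * f s) = c * gibbsAvg E f := by
  simp only [gibbsAvg, mul_left_comm _ c, ← Finset.mul_sum, mul_div_assoc]

lemma gibbsAvg_sub (E f g : S → ℝ) :
    gibbsAvg E (fun s => f s - g s) = gibbsAvg E f - gibbsAvg E g := by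
  simp [gibbsAvg, mul_sub, Finset.sum_sub_distrib, sub_div]

lemma gibbsAvg_const [Nonempty S] (E : S → ℝ) (c : ℝ) : gibbsAvg E (fun _ => c) = c := by
  rw [gibbsAvg, ← Finset.sum_mul, ← gibbsSum, mul_div_assoc, mul_div_cancel₀]
  exact (gibbsSum_pos E).ne'

lemma gibbsAvg_sum {ι : Type*} (s : Finset ι) (E : S → ℝ) (f : ι → S → ℝ) :
    gibbsAvg E (fun x => ∑ i ∈ s, f i x) = ∑ i ∈ s, gibbsAvg E (f i) := by
  simp only [gibbsAvg, Finset.mul_sum, ← Finset.sum_div]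
  rw [Finset.sum_comm]

lemma gibbsAvg_mono [Nonempty S] (E : S → ℝ) {f g : S → ℝ} (h : ∀ s, f s ≤ g s) :
    gibbsAvg E f ≤ gibbsAvg E g := by
  have := (gibbsSum_pos E).le
  unfold gibbsAvg
  gcongr
  exact h _

lemma abs_gibbsAvg_le [Nonempty S] (E : S → ℝ) {f : S → ℝ} {c : ℝ} (h : ∀ s, |f s| ≤ c) :
    |gibbsAvg E f| ≤ c := by
  rw [abs_le]
  constructor
  · rw [← gibbsAvg_const E (-c)]
    exact gibbsAvg_mono E fun s => neg_le_of_abs_le (h s)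
  · rw [← gibbsAvg_const E c]
    exact gibbsAvg_mono E fun s => le_of_abs_le (h s)

lemma gibbsAvg_nonneg [Nonempty S] (E : S → ℝ) {f : S → ℝ} (h : ∀ s, 0 ≤ f s) :
    0 ≤ gibbsAvg E f := by
  rw [← gibbsAvg_const E 0]; exact gibbsAvg_mono E h

lemma gibbsAvg_sq_le [Nonempty S] (E f : S → ℝ) :
    gibbsAvg E f ^ 2 ≤ gibbsAvg E (fun s => f s ^ 2) := by
  have h := gibbsAvg_nonneg E (f := fun s => (f s - gibbsAvg E f) ^ 2) fun s => sq_nonneg _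
  have e : (fun s => (f s - gibbsAvg E f) ^ 2) = fun s =>
      (f s ^ 2 - 2 * gibbsAvg E f * f s) + gibbsAvg E f ^ 2 := by ext s; ring
  rw [e, gibbsAvg_add, gibbsAvg_sub, gibbsAvg_const_mul, gibbsAvg_const] at h
  nlinarith

lemma gibbsSum_add_const (E : S → ℝ) (c : ℝ) :
    gibbsSum (fun s => E s + c) = gibbsSum E * Real.exp c := by
  simp [gibbsSum, Real.exp_add, Finset.sum_mul]

lemma logSumExp_add_const [Nonempty S] (E : S → ℝ) (c : ℝ) :
    logSumExp (fun s => E s + c) = logSumExp E + c := by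
  rw [logSumExp, gibbsSum_add_const, Real.log_mul (gibbsSum_pos E).ne' (Real.exp_pos c).ne',
    Real.log_exp, logSumExp]

lemma gibbsSum_prod (E : S → ℝ) (E' : T → ℝ) :
    gibbsSum (fun s : S × T => E s.1 + E' s.2) = gibbsSum E * gibbsSum E' := by
  simp only [gibbsSum, Real.exp_add, Fintype.sum_prod_type, Finset.sum_mul_sum]

lemma gibbsAvg_prod (E f : S → ℝ) (E' g : T → ℝ) :
    gibbsAvg (fun s : S × T => E s.1 + E' s.2) (fun s => f s.1 * g s.2) =
      gibbsAvg E f * gibbsAvg E' g := by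
  rw [gibbsAvg, gibbsSum_prod, gibbsAvg, gibbsAvg, div_mul_div_comm, Finset.sum_mul_sum,
    Fintype.sum_prod_type]
  simp only [Real.exp_add]
  congr 1
  exact Finset.sum_congr rfl fun _ _ => Finset.sum_congr rfl fun _ _ => by ring

lemma gibbsAvg_prod_fst [Nonempty T] (E f : S → ℝ) (E' : T → ℝ) :
    gibbsAvg (fun s : S × T => E s.1 + E' s.2) (fun s => f s.1) = gibbsAvg E f := by
  have := gibbsAvg_prod E f E' (fun _ => 1)
  simpa [gibbsAvg_const] using this

/-- The **Gibbs variational inequality**. -/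
lemma gibbsAvg_sub_le_logSumExp_sub [Nonempty S] (E E' : S → ℝ) :
    gibbsAvg E (fun s => E' s - E s) ≤ logSumExp E' - logSumExp E := by
  set c := gibbsAvg E (fun s => E' s - E s) with hc
  -- Jensen's inequality by the tangent line of exp: centring the exponent at its mean c gives 1 ≤
  -- (Z'/Z) e^{-c}.
  have h1 : gibbsAvg E (fun s => 1 + ((E' s - E s) - c)) ≤
      gibbsAvg E (fun s => Real.exp ((E' s - E s) - c)) :=
    gibbsAvg_mono E fun s => by linarith [Real.add_one_le_exp ((E' s - E s) - c)]
  rw [gibbsAvg_add, gibbsAvg_sub, gibbsAvg_const, gibbsAvg_const, ← hc, sub_self, add_zero] at h1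
  have h2 : gibbsAvg E (fun s => Real.exp ((E' s - E s) - c)) =
      gibbsSum E' / gibbsSum E * Real.exp (-c) := by
    rw [gibbsAvg, div_mul_eq_mul_div]
    congr 1
    rw [gibbsSum, Finset.sum_mul]
    refine Finset.sum_congr rfl fun s _ => ?_
    rw [← Real.exp_add, ← Real.exp_add]
    congr 1; ring
  have hp : 0 < gibbsSum E' / gibbsSum E := div_pos (gibbsSum_pos _) (gibbsSum_pos _)
  rw [h2, Real.exp_neg, ← div_eq_mul_inv, one_le_div (Real.exp_pos c)] at h1
  have h3 := Real.log_le_log (Real.exp_pos c) h1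
  rwa [Real.log_exp, Real.log_div (gibbsSum_pos _).ne' (gibbsSum_pos _).ne'] at h3

lemma logSumExp_mono [Nonempty S] {E E' : S → ℝ} (h : ∀ s, E s ≤ E' s) :
    logSumExp E ≤ logSumExp E' :=
  Real.log_le_log (gibbsSum_pos _) (Finset.sum_le_sum fun s _ => Real.exp_le_exp.2 (h s))

lemma le_logSumExp [Nonempty S] (E : S → ℝ) (s : S) : E s ≤ logSumExp E := by
  rw [logSumExp, Real.le_log_iff_exp_le (gibbsSum_pos _)]
  exact Finset.single_le_sum (f := fun s => Real.exp (E s)) (fun _ _ => (Real.exp_pos _).le)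
    (Finset.mem_univ s)

lemma abs_logSumExp_sub_le [Nonempty S] {E E' : S → ℝ} {c : ℝ} (h : ∀ s, |E' s - E s| ≤ c) :
    |logSumExp E' - logSumExp E| ≤ c := by
  rw [abs_le]
  constructor
  · have := gibbsAvg_sub_le_logSumExp_sub E E'
    linarith [neg_le_of_abs_le (abs_gibbsAvg_le E h)]
  · have h1 := gibbsAvg_sub_le_logSumExp_sub E' E
    have h2 : |gibbsAvg E' (fun s => E s - E' s)| ≤ c :=
      abs_gibbsAvg_le E' fun s => by rw [abs_sub_comm]; exact h s
    linarith [neg_le_of_abs_le h2]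

lemma logSumExp_zero : logSumExp (fun _ : S => (0 : ℝ)) = Real.log (Fintype.card S) := by
  simp [logSumExp, gibbsSum]

lemma abs_logSumExp_le [Nonempty S] {E : S → ℝ} {c : ℝ} (h : ∀ s, |E s| ≤ c) :
    |logSumExp E| ≤ c + Real.log (Fintype.card S) := by
  have h1 := abs_logSumExp_sub_le (E := fun _ : S => (0 : ℝ)) (E' := E) (c := c) (by simpa using h)
  rw [logSumExp_zero] at h1
  have h2 : 0 ≤ Real.log (Fintype.card S) := Real.log_natCast_nonneg _
  rw [abs_le] at h1 ⊢
  constructor <;> linarith [h1.1, h1.2]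

lemma hasDerivAt_gibbsNumerator {E f : ℝ → S → ℝ} {E' f' : S → ℝ} {y : ℝ}
    (hE : ∀ s, HasDerivAt (fun y => E y s) (E' s) y)
    (hf : ∀ s, HasDerivAt (fun y => f y s) (f' s) y) :
    HasDerivAt (fun y => ∑ s, Real.exp (E y s) * f y s)
      (∑ s, Real.exp (E y s) * (f' s + f y s * E' s)) y := by
  refine (HasDerivAt.fun_sum fun s _ => (hE s).exp.mul (hf s)).congr_deriv ?_
  exact Finset.sum_congr rfl fun s _ => by ring

lemma hasDerivAt_gibbsSum {E : ℝ → S → ℝ} {E' : S → ℝ} {y : ℝ}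
    (hE : ∀ s, HasDerivAt (fun y => E y s) (E' s) y) :
    HasDerivAt (fun y => gibbsSum (E y)) (∑ s, Real.exp (E y s) * E' s) y :=
  HasDerivAt.fun_sum fun s _ => (hE s).exp

lemma hasDerivAt_logSumExp [Nonempty S] {E : ℝ → S → ℝ} {E' : S → ℝ} {y : ℝ}
    (hE : ∀ s, HasDerivAt (fun y => E y s) (E' s) y) :
    HasDerivAt (fun y => logSumExp (E y)) (gibbsAvg (E y) E') y :=
  (hasDerivAt_gibbsSum hE).log (gibbsSum_pos _).ne'

lemma hasDerivAt_gibbsAvg [Nonempty S] {E f : ℝ → S → ℝ} {E' f' : S → ℝ} {y : ℝ}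
    (hE : ∀ s, HasDerivAt (fun y => E y s) (E' s) y)
    (hf : ∀ s, HasDerivAt (fun y => f y s) (f' s) y) :
    HasDerivAt (fun y => gibbsAvg (E y) (f y))
      (gibbsAvg (E y) f' + gibbsAvg (E y) (fun s => f y s * E' s) -
        gibbsAvg (E y) (f y) * gibbsAvg (E y) E') y := by
  have hp := (gibbsSum_pos (E y)).ne'
  refine ((hasDerivAt_gibbsNumerator hE hf).div (hasDerivAt_gibbsSum hE) hp).congr_deriv ?_
  rw [← gibbsAvg_add]
  simp only [gibbsAvg]
  field_simp

end Gibbs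

/-! ### Independent spins -/

section Spins

variable {N : ℕ}

lemma spin_eq_or (σ : Config N) (i : Fin N) : spin σ i = 1 ∨ spin σ i = -1 := by
  rcases Int.units_eq_one_or (σ i) with h | h <;> simp [spin, h]

@[simp] lemma spin_mul_self (σ : Config N) (i : Fin N) : spin σ i * spin σ i = 1 := by
  rcases spin_eq_or σ i with h | h <;> simp [h]

@[simp] lemma abs_spin (σ : Config N) (i : Fin N) : |spin σ i| = 1 := by
  rcases spin_eq_or σ i with h | h <;> simp [h]

lemma sum_exp_spin (h : Fin N → ℝ) :
    gibbsSum (fun σ : Config N => ∑ i, h i * spin σ i) = ∏ i, (2 * Real.cosh (h i)) := by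
  have e : ∀ i, 2 * Real.cosh (h i) = ∑ u : ℤˣ, Real.exp (h i * ((u : ℤ) : ℝ)) := by
    intro i
    rw [show (Finset.univ : Finset ℤˣ) = {1, -1} from rfl, Finset.sum_pair (by decide),
      Real.cosh_eq]
    simp
    ring
  simp_rw [e, gibbsSum, Real.exp_sum]
  exact (Fintype.prod_sum fun i (u : ℤˣ) => Real.exp (h i * ((u : ℤ) : ℝ))).symm

lemma logSumExp_spin (h : Fin N → ℝ) :
    logSumExp (fun σ : Config N => ∑ i, h i * spin σ i) =
      N * Real.log 2 + ∑ i, Real.log (Real.cosh (h i)) := by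
  rw [logSumExp, sum_exp_spin, Real.log_prod fun i _ => by
    have := Real.cosh_pos (h i); positivity]
  simp_rw [Real.log_mul two_ne_zero (Real.cosh_pos _).ne']
  simp [Finset.sum_add_distrib]

/-- The lower bound is monotonicity. The upper bound is the variational inequality for the passage
from E to the independent spins. The mean of V is thus taken under the perturbed measure itself,
which is the one replica symmetry controls. -/
lemma logSumExp_perturbed {h : Fin N → ℝ} {V E : Config N → ℝ} {c : ℝ} (hV : ∀ σ, 0 ≤ V σ)
    (hE : ∀ σ, E σ = ∑ i, h i * spin σ i + V σ + c) :
    0 ≤ logSumExp E - (N * Real.log 2 + ∑ i, Real.log (Real.cosh (h i)) + c) ∧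
    logSumExp E - (N * Real.log 2 + ∑ i, Real.log (Real.cosh (h i)) + c) ≤ gibbsAvg E V := by
  rw [← logSumExp_spin, ← logSumExp_add_const]
  constructor
  · rw [sub_nonneg]
    exact logSumExp_mono fun σ => by rw [hE]; linarith [hV σ]
  · have := gibbsAvg_sub_le_logSumExp_sub E fun σ => ∑ i, h i * spin σ i + c
    have e : (fun σ => ∑ i, h i * spin σ i + c - E σ) = fun σ => (-1) * V σ := by
      ext σ; rw [hE]; ring
    rw [e, gibbsAvg_const_mul] at this
    linarith

/-- A perturbation `V ≥ 0` of independent spins changes the local magnetizations by an amount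
controlled by the mean of `V`. -/
lemma sum_sq_magnetization_sub_tanh_le {h : Fin N → ℝ} {V E : Config N → ℝ} {c : ℝ}
    (hV : ∀ σ, 0 ≤ V σ) (hE : ∀ σ, E σ = ∑ i, h i * spin σ i + V σ + c) :
    ∑ i, (gibbsAvg E (fun σ => spin σ i) - Real.tanh (h i)) ^ 2 ≤ 4 * gibbsAvg E V := by
  -- The variational inequality is tested with independent spins in the fields h_i + d_i/2. The
  -- linear term gains d_i²/2 and the second-order bound on log cosh costs d_i²/4. The factor 1/2
  -- maximizes t - t², whence the constant 4.
  set d : Fin N → ℝ := fun i => gibbsAvg E (fun σ => spin σ i) - Real.tanh (h i) with hd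
  have h1 := gibbsAvg_sub_le_logSumExp_sub E fun σ => ∑ i, (h i + d i / 2) * spin σ i
  have h2 := (logSumExp_perturbed hV hE).1
  have e : (fun σ => ∑ i, (h i + d i / 2) * spin σ i - E σ) = fun σ =>
      (∑ i, d i / 2 * spin σ i - V σ) - c := by
    ext σ; rw [hE]; simp only [add_mul, Finset.sum_add_distrib]; ring
  rw [e, gibbsAvg_sub, gibbsAvg_sub, gibbsAvg_const, gibbsAvg_sum, logSumExp_spin] at h1
  simp_rw [gibbsAvg_const_mul] at h1
  have h3 : ∀ i, Real.log (Real.cosh (h i + d i / 2)) ≤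
      Real.log (Real.cosh (h i)) + d i / 2 * Real.tanh (h i) + (d i / 2) ^ 2 := fun i => by
    have := le_of_abs_le (abs_log_cosh_taylor (h i) (d i / 2)); linarith
  have h4 := Finset.sum_le_sum fun i (_ : i ∈ Finset.univ) => h3 i
  rw [Finset.sum_add_distrib, Finset.sum_add_distrib] at h4
  have h5 : ∑ i, d i / 2 * gibbsAvg E (fun σ => spin σ i) =
      ∑ i, d i / 2 * Real.tanh (h i) + ∑ i, d i ^ 2 / 2 := by
    rw [← Finset.sum_add_distrib]
    refine Finset.sum_congr rfl fun i _ => ?_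
    have : gibbsAvg E (fun σ => spin σ i) = d i + Real.tanh (h i) := by simp [hd]
    rw [this]; ring
  have h6 : ∑ i, d i ^ 2 / 2 = (∑ i, d i ^ 2) / 2 := by rw [Finset.sum_div]
  have h7 : ∑ i, (d i / 2) ^ 2 = (∑ i, d i ^ 2) / 4 := by
    rw [Finset.sum_div]; exact Finset.sum_congr rfl fun i _ => by ring
  linarith

end Spins

/-! ### Resampling a Gaussian coordinate -/

section Resampling

variable {Ω Ω' : Type*} [MeasurableSpace Ω] [MeasurableSpace Ω']

/-- Replacing a coordinate of `ω` by an independent standard Gaussian variable preserves `P`. -/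
def IsResampling (P : Measure Ω) (U : Ω → ℝ → Ω) : Prop :=
  MeasurePreserving (fun w : Ω × ℝ => U w.1 w.2) (P.prod gauss) P

lemma measurePreserving_update {ι : Type*} [Fintype ι] [DecidableEq ι] {X : ι → Type*}
    [∀ i, MeasurableSpace (X i)] (μ : ∀ i, Measure (X i)) [∀ i, IsProbabilityMeasure (μ i)]
    (i : ι) : MeasurePreserving (fun w : (∀ i, X i) × X i => Function.update w.1 i w.2)
      ((Measure.pi μ).prod (μ i)) (Measure.pi μ) := by
  have hm : Measurable fun w : (∀ i, X i) × X i => Function.update w.1 i w.2 := by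
    refine measurable_pi_iff.2 fun j => ?_
    by_cases h : j = i
    · subst h; simpa using measurable_snd
    · simpa [h, Function.comp_def] using (measurable_pi_apply j).comp measurable_fst
  refine ⟨hm, (Measure.pi_eq fun s hs => ?_).symm⟩
  rw [Measure.map_apply hm (MeasurableSet.univ_pi hs)]
  have e : (fun w : (∀ i, X i) × X i => Function.update w.1 i w.2) ⁻¹' (Set.univ.pi s) =
      (Set.univ.pi (Function.update s i Set.univ)) ×ˢ s i := by
    ext w
    simp only [Set.mem_preimage, Set.mem_pi, Set.mem_univ, true_implies, Set.mem_prod]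
    constructor
    · intro h
      refine ⟨fun j => ?_, by simpa using h i⟩
      by_cases hj : j = i
      · subst hj; simp
      · simpa [hj] using h j
    · rintro ⟨h1, h2⟩ j
      by_cases hj : j = i
      · subst hj; simpa using h2
      · simpa [hj] using h1 j
  rw [e, Measure.prod_prod, Measure.pi_pi, ← Finset.prod_erase_mul Finset.univ _ (Finset.mem_univ i),
    ← Finset.prod_erase_mul Finset.univ (fun j => μ j (s j)) (Finset.mem_univ i)]
  simp only [Function.update_self, measure_univ, mul_one]
  congr 1
  refine Finset.prod_congr rfl fun j hj => ?_
  rw [Function.update_of_ne (Finset.ne_of_mem_erase hj)]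

lemma isResampling_real : IsResampling gauss fun _ y => y :=
  measurePreserving_snd

/-- The block x i is not separated from the rest of x, so an independent copy of it is inserted
first, which does not change the law. Resampling inside that copy is then covered by the hypothesis
on the single block. -/
lemma IsResampling.pi {ι : Type*} [Fintype ι] [DecidableEq ι] {μ : ι → Measure Ω}
    [∀ i, IsProbabilityMeasure (μ i)] {i : ι} {U : Ω → ℝ → Ω} (hU : IsResampling (μ i) U) :
    IsResampling (Measure.pi μ) fun x y => Function.update x i (U (x i) y) := by
  have hV := measurePreserving_update μ i
  have h1 : MeasurePreserving (fun w : ((ι → Ω) × Ω) × ℝ => (Function.update w.1.1 i w.1.2, w.2))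
      (((Measure.pi μ).prod (μ i)).prod gauss) ((Measure.pi μ).prod gauss) :=
    hV.prod (MeasurePreserving.id gauss)
  have h2 : MeasurePreserving (fun w : ((ι → Ω) × Ω) × ℝ =>
      Function.update w.1.1 i (U w.1.2 w.2))
      (((Measure.pi μ).prod (μ i)).prod gauss) (Measure.pi μ) :=
    (hV.comp ((MeasurePreserving.id (Measure.pi μ)).prod hU)).comp
      (measurePreserving_prodAssoc (Measure.pi μ) (μ i) gauss)
  have hm : Measurable fun w : (ι → Ω) × ℝ => Function.update w.1 i (U (w.1 i) w.2) := by
    refine hV.measurable.comp (g := fun w : (ι → Ω) × Ω => Function.update w.1 i w.2)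
      (f := fun w : (ι → Ω) × ℝ => (w.1, U (w.1 i) w.2))
      (measurable_fst.prodMk (hU.measurable.comp (f := fun w : (ι → Ω) × ℝ => (w.1 i, w.2)) ?_))
    exact ((measurable_pi_apply i).comp measurable_fst).prodMk measurable_snd
  refine ⟨hm, ?_⟩
  rw [← h1.map_eq, Measure.map_map hm h1.measurable]
  refine Eq.trans ?_ h2.map_eq
  congr 1
  ext w
  simp

lemma IsResampling.prod_left {P : Measure Ω} {Q : Measure Ω'} [SFinite P] [SFinite Q]
    {U : Ω → ℝ → Ω} (hU : IsResampling P U) :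
    IsResampling (P.prod Q) fun ω y => (U ω.1 y, ω.2) := by
  have h1 : MeasurePreserving (Prod.map Prod.swap id : (Ω × Ω') × ℝ → _)
      ((P.prod Q).prod gauss) ((Q.prod P).prod gauss) :=
    Measure.measurePreserving_swap.prod (MeasurePreserving.id gauss)
  have h2 := measurePreserving_prodAssoc Q P gauss
  have h3 : MeasurePreserving Prod.swap (Q.prod (P.prod gauss)) ((P.prod gauss).prod Q) :=
    Measure.measurePreserving_swap
  exact (hU.prod (MeasurePreserving.id Q)).comp (h3.comp (h2.comp h1))

lemma IsResampling.prod_right {P : Measure Ω} {Q : Measure Ω'} [SFinite P] [SFinite Q]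
    {U : Ω' → ℝ → Ω'} (hU : IsResampling Q U) :
    IsResampling (P.prod Q) fun ω y => (ω.1, U ω.2 y) :=
  ((MeasurePreserving.id P).prod hU).comp (measurePreserving_prodAssoc P Q gauss)

/-- **Gaussian integration by parts** in one coordinate of a product space. -/
theorem IsResampling.integration_by_parts {P : Measure Ω} [SFinite P] {U : Ω → ℝ → Ω}
    (hU : IsResampling P U) {g F F' : Ω → ℝ} (hg : ∀ ω y, g (U ω y) = y)
    (hF : ∀ ω y, HasDerivAt (fun y => F (U ω y)) (F' (U ω y)) y)
    (h0 : Integrable F P) (h1 : Integrable (fun ω => g ω * F ω) P) (h2 : Integrable F' P) :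
    ∫ ω, g ω * F ω ∂P = ∫ ω, F' ω ∂P := by
  have i0 := hU.integrable_comp_of_integrable h0
  have i1 := hU.integrable_comp_of_integrable h1
  have i2 := hU.integrable_comp_of_integrable h2
  simp only [Function.comp_def] at i0 i1 i2
  -- Both sides are evaluated at the resampled point. By Fubini the claim reduces, for almost every
  -- ω, to the one-dimensional formula in the fresh variable.
  rw [← integral_comp_measurePreserving hU h1.aestronglyMeasurable,
    ← integral_comp_measurePreserving hU h2.aestronglyMeasurable,
    integral_prod _ i1, integral_prod _ i2]
  refine integral_congr_ae ?_
  filter_upwards [i0.prod_right_ae, i1.prod_right_ae, i2.prod_right_ae] with ω j0 j1 j2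
  simp only [hg] at j1 ⊢
  exact gauss_integration_by_parts (hF ω) j0 j1 j2

end Resampling

/-! ### Exponential moments of squares -/

lemma hasSubgaussianMGF_gauss : HasSubgaussianMGF (fun x : ℝ => x) 1 gauss where
  integrable_exp_mul t := integrable_exp_mul_gaussianReal t
  mgf_le t := by
    have := congrFun (mgf_fun_id_gaussianReal (μ := 0) (v := 1)) t
    rw [this]; simp

lemma hasSubgaussianMGF_booleanLaw : HasSubgaussianMGF (fun x : ℝ => x) 1 booleanLaw where
  integrable_exp_mul t := integrable_booleanLaw _
  mgf_le t := by
    rw [mgf, integral_booleanLaw]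
    have := Real.cosh_le_exp_half_sq t
    rw [Real.cosh_eq] at this
    simpa using this

lemma integral_exp_mul_gauss (t : ℝ) : ∫ z, Real.exp (t * z) ∂gauss = Real.exp (t ^ 2 / 2) := by
  have := congrFun (mgf_fun_id_gaussianReal (μ := 0) (v := 1)) t
  rw [mgf] at this
  simpa using this

lemma lintegral_exp_mul_gauss (t : ℝ) :
    ∫⁻ z, ENNReal.ofReal (Real.exp (t * z)) ∂gauss = ENNReal.ofReal (Real.exp (t ^ 2 / 2)) := by
  rw [← integral_exp_mul_gauss, ofReal_integral_eq_lintegral_ofReal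
    (integrable_exp_mul_gaussianReal t) (ae_of_all _ fun _ => (Real.exp_pos _).le)]

/-! ### Gaussian integrals with a quadratic weight -/

/-- Completing the square: the tilt produces a Gaussian of mean b/(1-c) and variance 1/(1-c). This
variance is the coefficient r of the squared hidden fields after integration, and c < 1 is where
β(1-q̄) < 1 is needed. -/
lemma exp_mul_gaussianPDFReal {c : ℝ} (hc : c < 1) (b z : ℝ) :
    gaussianPDFReal 0 1 z * Real.exp (b * z + c / 2 * z ^ 2) =
      √(1 / (1 - c)) * Real.exp (b ^ 2 / (2 * (1 - c))) *
        gaussianPDFReal (b / (1 - c)) (Real.toNNReal (1 / (1 - c))) z := by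
  have h : 0 < 1 - c := by linarith
  have h' : 0 < 1 / (1 - c) := by positivity
  simp only [gaussianPDFReal, NNReal.coe_one, Real.coe_toNNReal _ h'.le]
  rw [Real.sqrt_mul (by positivity) (1 / (1 - c)), Real.sqrt_mul (by positivity) 1]
  have hs := (Real.sqrt_pos.2 h').ne'
  have hs2 : √(2 * Real.pi) ≠ 0 := (Real.sqrt_pos.2 (by positivity)).ne'
  rw [Real.sqrt_one, mul_one, mul_assoc, ← Real.exp_add, mul_inv]
  have e : √(1 / (1 - c)) * Real.exp (b ^ 2 / (2 * (1 - c))) *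
      ((√(2 * Real.pi))⁻¹ * (√(1 / (1 - c)))⁻¹ *
        Real.exp (-(z - b / (1 - c)) ^ 2 / (2 * (1 / (1 - c))))) =
      (√(2 * Real.pi))⁻¹ * (Real.exp (b ^ 2 / (2 * (1 - c))) *
        Real.exp (-(z - b / (1 - c)) ^ 2 / (2 * (1 / (1 - c))))) := by
    field_simp
  rw [e, ← Real.exp_add]
  congr 2
  field_simp
  ring

lemma integral_tilted_gauss {c : ℝ} (hc : c < 1) (b : ℝ) (f : ℝ → ℝ) :
    ∫ z, f z * Real.exp (b * z + c / 2 * z ^ 2) ∂gauss =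
      √(1 / (1 - c)) * Real.exp (b ^ 2 / (2 * (1 - c))) *
        ∫ z, f z ∂gaussianReal (b / (1 - c)) (Real.toNNReal (1 / (1 - c))) := by
  have h : Real.toNNReal (1 / (1 - c)) ≠ 0 := by
    have : 0 < 1 / (1 - c) := by have : 0 < 1 - c := by linarith
                                 positivity
    simpa [Real.toNNReal_eq_zero] using hc
  rw [integral_gaussianReal_eq_integral_smul (by norm_num),
    integral_gaussianReal_eq_integral_smul h, ← integral_const_mul]
  refine integral_congr_ae (ae_of_all _ fun z => ?_)
  simp only [smul_eq_mul]
  rw [mul_left_comm, exp_mul_gaussianPDFReal hc]; ring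

lemma integrable_tilted_gauss {c : ℝ} (hc : c < 1) (b : ℝ) {f : ℝ → ℝ}
    (hf : Integrable f (gaussianReal (b / (1 - c)) (Real.toNNReal (1 / (1 - c))))) :
    Integrable (fun z => f z * Real.exp (b * z + c / 2 * z ^ 2)) gauss := by
  have h : Real.toNNReal (1 / (1 - c)) ≠ 0 := by simpa [Real.toNNReal_eq_zero] using hc
  rw [integrable_gauss_iff]
  rw [gaussianReal_of_var_ne_zero _ h, integrable_withDensity_iff_integrable_smul'
    (measurable_gaussianPDF _ _) (ae_of_all _ fun x => gaussianPDF_lt_top)] at hf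
  simp only [toReal_gaussianPDF, smul_eq_mul] at hf
  refine (hf.const_mul (√(1 / (1 - c)) * Real.exp (b ^ 2 / (2 * (1 - c))))).congr
    (ae_of_all _ fun z => ?_)
  simp only
  rw [mul_left_comm (gaussianPDFReal 0 1 z), exp_mul_gaussianPDFReal hc]; ring

/-- If `X` is sub-Gaussian with parameter `v`, then `𝔼 exp(X² / (4 v)) ≤ √2`. -/
lemma lintegral_exp_sq_le {Ω : Type*} [MeasurableSpace Ω] {P : Measure Ω} [IsProbabilityMeasure P]
    {X : Ω → ℝ} {v : NNReal} (hX : HasSubgaussianMGF X v P) (hm : Measurable X) (hv : 0 < v) :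
    ∫⁻ ω, ENNReal.ofReal (Real.exp (X ω ^ 2 / (4 * v))) ∂P ≤ ENNReal.ofReal √2 := by
  have hv' : (0 : ℝ) < v := hv
  -- With a² = 1/(2v), exp(X²/(4v)) is the mean of exp(aXz) over a standard Gaussian z. After
  -- exchanging the integrals the sub-Gaussian bound leaves exp(z²/4), whose Gaussian mean is √2.
  -- Lower integrals avoid presupposing integrability.
  set a : ℝ := √(1 / (2 * v)) with ha
  have ha2 : a ^ 2 = 1 / (2 * v) := Real.sq_sqrt (by positivity)
  have h1 : ∀ ω, ENNReal.ofReal (Real.exp (X ω ^ 2 / (4 * v))) =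
      ∫⁻ z, ENNReal.ofReal (Real.exp (a * X ω * z)) ∂gauss := fun ω => by
    rw [lintegral_exp_mul_gauss, mul_pow, ha2]
    congr 2
    field_simp
    norm_num
  simp_rw [h1]
  rw [lintegral_lintegral_swap (by fun_prop)]
  have h2 : ∀ z, ∫⁻ ω, ENNReal.ofReal (Real.exp (a * X ω * z)) ∂P ≤
      ENNReal.ofReal (1 * Real.exp (0 * z + (1 / 2) / 2 * z ^ 2)) := fun z => by
    have e : ∀ ω, a * X ω * z = a * z * X ω := fun ω => by ring
    simp_rw [e]
    rw [← ofReal_integral_eq_lintegral_ofReal (hX.integrable_exp_mul _)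
      (ae_of_all _ fun _ => (Real.exp_pos _).le)]
    refine ENNReal.ofReal_le_ofReal ((hX.mgf_le (a * z)).trans ?_)
    rw [one_mul, Real.exp_le_exp, mul_pow, ha2]
    refine le_of_eq ?_
    field_simp
    ring
  refine (lintegral_mono h2).trans ?_
  rw [← ofReal_integral_eq_lintegral_ofReal (integrable_tilted_gauss (by norm_num) 0
    (integrable_const 1)) (ae_of_all _ fun _ => by positivity),
    integral_tilted_gauss (by norm_num)]
  refine ENNReal.ofReal_le_ofReal (le_of_eq ?_)
  simp
  norm_num

/-! ### The space of the disorder -/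

/-- The disorder as a point of a product space. -/
abbrev DisorderSpace (N k p : ℕ) : Type :=
  ((Fin k → Fin N → ℝ) × (Fin p → Fin N → ℝ)) × ((Fin N → ℝ) × (Fin p → ℝ))

/-- The law of the disorder. -/
noncomputable def disorderLaw (N k p : ℕ) : Measure (DisorderSpace N k p) :=
  (patternLaw N k p).prod
    ((Measure.pi fun _ : Fin N => gauss).prod (Measure.pi fun _ : Fin p => gauss))

instance (N k p : ℕ) : IsProbabilityMeasure (patternLaw N k p) := by
  unfold patternLaw; infer_instance

instance (N k p : ℕ) : IsProbabilityMeasure (disorderLaw N k p) := by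
  unfold disorderLaw; infer_instance

/-- The disorder attached to a point of the product space. -/
def toDisorder {N k p : ℕ} (ω : DisorderSpace N k p) : Disorder N k p :=
  ⟨ω.1.1, ω.1.2, ω.2.1, ω.2.2⟩

section

variable {N k p : ℕ}

lemma quenched_eq (F : Disorder N k p → ℝ) :
    quenched F = ∫ ω, F (toDisorder ω) ∂(disorderLaw N k p) := rfl

lemma measurePreserving_ξt (ν : Fin k) (i : Fin N) :
    MeasurePreserving (fun ω : DisorderSpace N k p => ω.1.1 ν i) (disorderLaw N k p)
      booleanLaw :=
  (measurePreserving_eval (fun _ : Fin N => booleanLaw) i).comp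
    ((measurePreserving_eval (fun _ : Fin k => Measure.pi fun _ : Fin N => booleanLaw) ν).comp
      (measurePreserving_fst.comp measurePreserving_fst))

lemma measurePreserving_ξ (μ : Fin p) (i : Fin N) :
    MeasurePreserving (fun ω : DisorderSpace N k p => ω.1.2 μ i) (disorderLaw N k p) gauss :=
  (measurePreserving_eval (fun _ : Fin N => gauss) i).comp
    ((measurePreserving_eval (fun _ : Fin p => Measure.pi fun _ : Fin N => gauss) μ).comp
      (measurePreserving_snd.comp measurePreserving_fst))

lemma measurePreserving_η (i : Fin N) :
    MeasurePreserving (fun ω : DisorderSpace N k p => ω.2.1 i) (disorderLaw N k p) gauss :=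
  (measurePreserving_eval (fun _ : Fin N => gauss) i).comp
    (measurePreserving_fst.comp measurePreserving_snd)

lemma measurePreserving_θ (μ : Fin p) :
    MeasurePreserving (fun ω : DisorderSpace N k p => ω.2.2 μ) (disorderLaw N k p) gauss :=
  (measurePreserving_eval (fun _ : Fin p => gauss) μ).comp
    (measurePreserving_snd.comp measurePreserving_snd)

lemma isResampling_ξ (μ : Fin p) (i : Fin N) :
    IsResampling (disorderLaw N k p) fun ω y =>
      ((ω.1.1, Function.update ω.1.2 μ (Function.update (ω.1.2 μ) i y)), ω.2) :=
  ((isResampling_real.pi (μ := fun _ : Fin N => gauss) (i := i)).pi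
    (μ := fun _ : Fin p => Measure.pi fun _ : Fin N => gauss) (i := μ)).prod_right.prod_left

lemma isResampling_η (i : Fin N) :
    IsResampling (disorderLaw N k p) fun ω y => (ω.1, (Function.update ω.2.1 i y, ω.2.2)) :=
  (isResampling_real.pi (μ := fun _ : Fin N => gauss) (i := i)).prod_left.prod_right

lemma isResampling_θ (μ : Fin p) :
    IsResampling (disorderLaw N k p) fun ω y => (ω.1, (ω.2.1, Function.update ω.2.2 μ y)) :=
  (isResampling_real.pi (μ := fun _ : Fin p => gauss) (i := μ)).prod_right.prod_right

/-! ### Functions of the disorder of polynomial growth -/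

/-- The size of the disorder. -/
noncomputable def size (ω : DisorderSpace N k p) : ℝ :=
  1 + ((∑ ν, ∑ i, |ω.1.1 ν i|) + (∑ μ, ∑ i, |ω.1.2 μ i|) + (∑ i, |ω.2.1 i|) + ∑ μ, |ω.2.2 μ|)

lemma one_le_size (ω : DisorderSpace N k p) : 1 ≤ size ω := by
  have : 0 ≤ (∑ ν, ∑ i, |ω.1.1 ν i|) + (∑ μ, ∑ i, |ω.1.2 μ i|) + (∑ i, |ω.2.1 i|) +
    ∑ μ, |ω.2.2 μ| := by positivity
  unfold size; linarith

lemma abs_ξt_le_size (ω : DisorderSpace N k p) (ν : Fin k) (i : Fin N) :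
    |ω.1.1 ν i| ≤ size ω := by
  have h1 : |ω.1.1 ν i| ≤ ∑ i, |ω.1.1 ν i| :=
    Finset.single_le_sum (f := fun i => |ω.1.1 ν i|) (fun _ _ => abs_nonneg _) (Finset.mem_univ i)
  have h2 : ∑ i, |ω.1.1 ν i| ≤ ∑ ν, ∑ i, |ω.1.1 ν i| :=
    Finset.single_le_sum (f := fun ν => ∑ i, |ω.1.1 ν i|) (fun _ _ => by positivity)
      (Finset.mem_univ ν)
  have h3 : 0 ≤ (∑ μ, ∑ i, |ω.1.2 μ i|) + (∑ i, |ω.2.1 i|) + ∑ μ, |ω.2.2 μ| := by positivity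
  unfold size; linarith

lemma abs_ξ_le_size (ω : DisorderSpace N k p) (μ : Fin p) (i : Fin N) :
    |ω.1.2 μ i| ≤ size ω := by
  have h1 : |ω.1.2 μ i| ≤ ∑ i, |ω.1.2 μ i| :=
    Finset.single_le_sum (f := fun i => |ω.1.2 μ i|) (fun _ _ => abs_nonneg _) (Finset.mem_univ i)
  have h2 : ∑ i, |ω.1.2 μ i| ≤ ∑ μ, ∑ i, |ω.1.2 μ i| :=
    Finset.single_le_sum (f := fun μ => ∑ i, |ω.1.2 μ i|) (fun _ _ => by positivity)
      (Finset.mem_univ μ)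
  have h3 : 0 ≤ (∑ ν, ∑ i, |ω.1.1 ν i|) + (∑ i, |ω.2.1 i|) + ∑ μ, |ω.2.2 μ| := by positivity
  unfold size; linarith

lemma abs_η_le_size (ω : DisorderSpace N k p) (i : Fin N) : |ω.2.1 i| ≤ size ω := by
  have h1 : |ω.2.1 i| ≤ ∑ i, |ω.2.1 i| :=
    Finset.single_le_sum (f := fun i => |ω.2.1 i|) (fun _ _ => abs_nonneg _) (Finset.mem_univ i)
  have h3 : 0 ≤ (∑ ν, ∑ i, |ω.1.1 ν i|) + (∑ μ, ∑ i, |ω.1.2 μ i|) + ∑ μ, |ω.2.2 μ| := by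
    positivity
  unfold size; linarith

lemma abs_θ_le_size (ω : DisorderSpace N k p) (μ : Fin p) : |ω.2.2 μ| ≤ size ω := by
  have h1 : |ω.2.2 μ| ≤ ∑ μ, |ω.2.2 μ| :=
    Finset.single_le_sum (f := fun i => |ω.2.2 i|) (fun _ _ => abs_nonneg _) (Finset.mem_univ μ)
  have h3 : 0 ≤ (∑ ν, ∑ i, |ω.1.1 ν i|) + (∑ μ, ∑ i, |ω.1.2 μ i|) + ∑ i, |ω.2.1 i| := by
    positivity
  unfold size; linarith

lemma memLp_booleanLaw (r : ℝ≥0∞) : MemLp (fun x : ℝ => x) r booleanLaw :=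
  MemLp.of_bound aestronglyMeasurable_id 1
    (ae_booleanLaw (P := fun x => ‖x‖ ≤ 1) (by simp) (by simp))

/-- Fourth moments suffice: energies and hidden overlaps grow quadratically in the disorder, and the
proof uses nothing larger than squares of the overlaps. -/
lemma memLp_size : MemLp (size : DisorderSpace N k p → ℝ) 4 (disorderLaw N k p) := by
  have hg : MemLp (fun x : ℝ => x) 4 gauss := memLp_id_gaussianReal' 4 (by norm_num)
  have hξt : ∀ ν i, MemLp (fun ω : DisorderSpace N k p => |ω.1.1 ν i|) 4 (disorderLaw N k p) :=
    fun ν i => ((memLp_booleanLaw 4).comp_measurePreserving (measurePreserving_ξt ν i)).abs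
  have hξ : ∀ μ i, MemLp (fun ω : DisorderSpace N k p => |ω.1.2 μ i|) 4 (disorderLaw N k p) :=
    fun μ i => (hg.comp_measurePreserving (measurePreserving_ξ μ i)).abs
  have hη : ∀ i, MemLp (fun ω : DisorderSpace N k p => |ω.2.1 i|) 4 (disorderLaw N k p) :=
    fun i => (hg.comp_measurePreserving (measurePreserving_η i)).abs
  have hθ : ∀ μ, MemLp (fun ω : DisorderSpace N k p => |ω.2.2 μ|) 4 (disorderLaw N k p) :=
    fun μ => (hg.comp_measurePreserving (measurePreserving_θ μ)).abs
  have h1 := memLp_finsetSum Finset.univ fun ν _ => memLp_finsetSum Finset.univ fun i _ => hξt ν i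
  have h2 := memLp_finsetSum Finset.univ fun μ _ => memLp_finsetSum Finset.univ fun i _ => hξ μ i
  have h3 := memLp_finsetSum Finset.univ fun i _ => hη i
  have h4 := memLp_finsetSum Finset.univ fun μ _ => hθ μ
  refine MemLp.ae_eq (ae_of_all _ fun ω => ?_) ((memLp_const (1 : ℝ)).add (((h1.add h2).add h3).add h4))
  simp only [Pi.add_apply, size]

lemma integrable_size_pow : Integrable (fun ω : DisorderSpace N k p => size ω ^ 4)
    (disorderLaw N k p) := by
  have h := (memLp_size (N := N) (k := k) (p := p)).integrable_norm_pow (p := 4) (by norm_num)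
  refine h.congr (ae_of_all _ fun ω => ?_)
  simp only [Real.norm_eq_abs]
  rw [abs_of_nonneg (by linarith [one_le_size ω])]

/-- Measurable functions of the disorder of polynomial growth of order `n`. -/
def Tame (n : ℕ) (F : DisorderSpace N k p → ℝ) : Prop :=
  Measurable F ∧ ∃ K, 0 ≤ K ∧ ∀ ω, |F ω| ≤ K * size ω ^ n

variable {F G : DisorderSpace N k p → ℝ} {n l : ℕ}

lemma Tame.mono (hF : Tame n F) (h : n ≤ l) : Tame l F := by
  obtain ⟨hm, K, hK, hb⟩ := hF
  exact ⟨hm, K, hK, fun ω => (hb ω).trans (mul_le_mul_of_nonneg_left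
    (pow_le_pow_right₀ (one_le_size ω) h) hK)⟩

lemma Tame.add (hF : Tame n F) (hG : Tame n G) : Tame n fun ω => F ω + G ω := by
  obtain ⟨hm, K, hK, hb⟩ := hF
  obtain ⟨hm', K', hK', hb'⟩ := hG
  exact ⟨hm.add hm', K + K', by positivity, fun ω => (abs_add_le _ _).trans (by
    rw [add_mul]; exact add_le_add (hb ω) (hb' ω))⟩

lemma Tame.mul (hF : Tame n F) (hG : Tame l G) : Tame (n + l) fun ω => F ω * G ω := by
  obtain ⟨hm, K, hK, hb⟩ := hF
  obtain ⟨hm', K', hK', hb'⟩ := hG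
  refine ⟨hm.mul hm', K * K', by positivity, fun ω => ?_⟩
  rw [abs_mul, pow_add, mul_mul_mul_comm]
  exact mul_le_mul (hb ω) (hb' ω) (abs_nonneg _) ((abs_nonneg _).trans (hb ω))

lemma Tame.const (c : ℝ) : Tame n fun _ : DisorderSpace N k p => c :=
  Tame.mono (n := 0) ⟨measurable_const, |c|, abs_nonneg _, fun ω => by simp⟩ (Nat.zero_le _)

lemma Tame.const_mul (hF : Tame n F) (c : ℝ) : Tame n fun ω => c * F ω := by
  simpa using (Tame.const (n := 0) c).mul hF

lemma Tame.mul_const (hF : Tame n F) (c : ℝ) : Tame n fun ω => F ω * c := by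
  simpa using hF.mul (Tame.const (n := 0) c)

lemma Tame.sub (hF : Tame n F) (hG : Tame n G) : Tame n fun ω => F ω - G ω := by
  simpa [sub_eq_add_neg] using hF.add (hG.const_mul (-1))

lemma Tame.pow_two (hF : Tame n F) : Tame (n + n) fun ω => F ω ^ 2 := by
  simpa [sq] using hF.mul hF

lemma Tame.abs (hF : Tame n F) : Tame n fun ω => |F ω| := by
  obtain ⟨hm, K, hK, hb⟩ := hF
  exact ⟨hm.abs, K, hK, fun ω => by rw [abs_abs]; exact hb ω⟩

lemma Tame.sum {ι : Type*} (s : Finset ι) {F : ι → DisorderSpace N k p → ℝ}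
    (hF : ∀ i, Tame n (F i)) : Tame n fun ω => ∑ i ∈ s, F i ω := by
  classical
  induction s using Finset.induction_on with
  | empty => simpa using Tame.const (n := n) (0 : ℝ)
  | insert a s ha ih => simpa [Finset.sum_insert ha] using (hF a).add ih

lemma Tame.ξt (ν : Fin k) (i : Fin N) : Tame 1 fun ω : DisorderSpace N k p => ω.1.1 ν i :=
  ⟨(measurePreserving_ξt ν i).measurable, 1, zero_le_one, fun ω => by
    simpa using abs_ξt_le_size ω ν i⟩

lemma Tame.ξ (μ : Fin p) (i : Fin N) : Tame 1 fun ω : DisorderSpace N k p => ω.1.2 μ i :=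
  ⟨(measurePreserving_ξ μ i).measurable, 1, zero_le_one, fun ω => by
    simpa using abs_ξ_le_size ω μ i⟩

lemma Tame.η (i : Fin N) : Tame 1 fun ω : DisorderSpace N k p => ω.2.1 i :=
  ⟨(measurePreserving_η i).measurable, 1, zero_le_one, fun ω => by
    simpa using abs_η_le_size ω i⟩

lemma Tame.θ (μ : Fin p) : Tame 1 fun ω : DisorderSpace N k p => ω.2.2 μ :=
  ⟨(measurePreserving_θ μ).measurable, 1, zero_le_one, fun ω => by
    simpa using abs_θ_le_size ω μ⟩

lemma Tame.integrable (hF : Tame n F) (hn : n ≤ 4) : Integrable F (disorderLaw N k p) := by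
  obtain ⟨hm, K, hK, hb⟩ := hF.mono hn
  exact integrable_of_abs_le (integrable_size_pow.const_mul K) hm.aestronglyMeasurable hb

section

variable {S : Type*} [Fintype S]

lemma measurable_gibbsAvg {Ω : Type*} [MeasurableSpace Ω] {E f : Ω → S → ℝ}
    (hE : ∀ s, Measurable fun ω => E ω s) (hf : ∀ s, Measurable fun ω => f ω s) :
    Measurable fun ω => gibbsAvg (E ω) (f ω) := by
  unfold gibbsAvg gibbsSum
  refine Measurable.div (Finset.measurable_fun_sum _ fun s _ => ?_)
    (Finset.measurable_fun_sum _ fun s _ => ?_)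
  · exact (hE s).exp.mul (hf s)
  · exact (hE s).exp

/-- A Gibbs average is a convex combination, so the weights do not enter the growth bound and
measurability of the energy is enough. -/
lemma Tame.gibbsAvg [Nonempty S] {E f : DisorderSpace N k p → S → ℝ}
    (hE : ∀ s, Measurable fun ω => E ω s) (hf : ∀ s, Tame n fun ω => f ω s) :
    Tame n fun ω => gibbsAvg (E ω) (f ω) := by
  refine ⟨measurable_gibbsAvg hE fun s => (hf s).1, ?_⟩
  choose K hK hb using fun s => (hf s).2
  refine ⟨∑ s, K s, Finset.sum_nonneg fun s _ => hK s, fun ω => abs_gibbsAvg_le _ fun s => ?_⟩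
  have := one_le_size ω
  refine (hb s ω).trans (mul_le_mul_of_nonneg_right ?_ (by positivity))
  exact Finset.single_le_sum (f := K) (fun s _ => hK s) (Finset.mem_univ s)

lemma Tame.logSumExp [Nonempty S] {E : DisorderSpace N k p → S → ℝ}
    (hE : ∀ s, Tame n fun ω => E ω s) : Tame n fun ω => logSumExp (E ω) := by
  refine ⟨?_, ?_⟩
  · unfold MixedHebbian.logSumExp gibbsSum
    exact (Finset.measurable_fun_sum _ fun s _ => (hE s).1.exp).log
  choose K hK hb using fun s => (hE s).2
  have hc : 0 ≤ Real.log (Fintype.card S) := Real.log_natCast_nonneg _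
  refine ⟨∑ s, K s + Real.log (Fintype.card S),
    add_nonneg (Finset.sum_nonneg fun s _ => hK s) hc, fun ω => ?_⟩
  have h1 := one_le_size ω
  have h2 : (1 : ℝ) ≤ size ω ^ n := one_le_pow₀ h1
  refine (abs_logSumExp_le (c := (∑ s, K s) * size ω ^ n) fun s => ?_).trans ?_
  · refine (hb s ω).trans (mul_le_mul_of_nonneg_right ?_ (by positivity))
    exact Finset.single_le_sum (f := K) (fun s _ => hK s) (Finset.mem_univ s)
  · rw [add_mul]
    gcongr
    exact le_mul_of_one_le_right hc h2

end

/-! ### The energy after integration of the hidden units -/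

/-- The unnormalized overlap of a pattern with a configuration. -/
noncomputable def alignment (ξ : Fin N → ℝ) (σ : Config N) : ℝ := ∑ i, ξ i * spin σ i

/-- The part of the energy coming from the Boolean patterns. -/
noncomputable def booleanEnergy (β : ℝ) (x : Fin k → ℝ) (d : Disorder N k p) (σ : Config N) : ℝ :=
  β / (2 * N) * ∑ ν, alignment (d.ξt ν) σ ^ 2 + ∑ ν, x ν * alignment (d.ξt ν) σ

/-- The local field acting on a hidden unit. -/
noncomputable def hiddenField (s b : ℝ) (d : Disorder N k p) (μ : Fin p) (σ : Config N) : ℝ :=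
  s * alignment (d.ξ μ) σ + b * d.θ μ

/-- The effective energy of the neurons. -/
noncomputable def energy (β : ℝ) (x : Fin k → ℝ) (s a b r : ℝ) (d : Disorder N k p)
    (σ : Config N) : ℝ :=
  booleanEnergy β x d σ + a * alignment d.η σ + r / 2 * ∑ μ, hiddenField s b d μ σ ^ 2

lemma Tame.spinMul {ω' : Fin N → DisorderSpace N k p → ℝ} (h : ∀ i, Tame 1 (ω' i))
    (σ : Config N) : Tame 1 fun ω => alignment (fun i => ω' i ω) σ :=
  Tame.sum _ fun i => (h i).mul_const _

lemma Tame.booleanEnergy (β : ℝ) (x : Fin k → ℝ) (σ : Config N) :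
    Tame 2 fun ω : DisorderSpace N k p => booleanEnergy β x (toDisorder ω) σ := by
  have h : ∀ ν, Tame 1 fun ω : DisorderSpace N k p => alignment ((toDisorder ω).ξt ν) σ :=
    fun ν => Tame.spinMul (Tame.ξt ν) σ
  exact ((Tame.sum _ fun ν => (h ν).pow_two).const_mul _).add
    ((Tame.sum _ fun ν => (h ν).const_mul (x ν)).mono (by norm_num))

lemma Tame.hiddenField (s b : ℝ) (μ : Fin p) (σ : Config N) :
    Tame 1 fun ω : DisorderSpace N k p => hiddenField s b (toDisorder ω) μ σ :=
  ((Tame.spinMul (Tame.ξ μ) σ).const_mul s).add ((Tame.θ μ).const_mul b)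

lemma Tame.energy (β : ℝ) (x : Fin k → ℝ) (s a b r : ℝ) (σ : Config N) :
    Tame 2 fun ω : DisorderSpace N k p => energy β x s a b r (toDisorder ω) σ :=
  ((Tame.booleanEnergy β x σ).add (((Tame.spinMul Tame.η σ).const_mul a).mono
    (by norm_num))).add ((Tame.sum _ fun μ => (Tame.hiddenField s b μ σ).pow_two).const_mul _)

end

/-! ### Differentiation of the mean free energy along a path of energies -/

section

variable {N k p : ℕ}

/-- For a finite combination of tame functions with C¹ coefficients, the derivative of the energy is
dominated, uniformly near u and over configurations, by one integrable tame function.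
Differentiation under the expectation follows. -/
theorem hasDerivAt_integral_logSumExp {J S : Type*} [Fintype J] [Fintype S] [Nonempty S]
    {c : J → ℝ → ℝ} {T : J → DisorderSpace N k p → S → ℝ} {n : ℕ} (hn : n ≤ 4)
    (hc : ∀ j, ContDiff ℝ 1 (c j)) (hT : ∀ j s, Tame n fun ω => T j ω s) (u : ℝ) :
    HasDerivAt (fun u => ∫ ω, logSumExp (fun s => ∑ j, c j u * T j ω s) ∂(disorderLaw N k p))
      (∫ ω, gibbsAvg (fun s => ∑ j, c j u * T j ω s)
        (fun s => ∑ j, deriv (c j) u * T j ω s) ∂(disorderLaw N k p)) u := by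
  have hE : ∀ u s, Tame n fun ω => ∑ j, c j u * T j ω s := fun u s =>
    Tame.sum _ fun j => (hT j s).const_mul _
  have hE' : ∀ u s, Tame n fun ω => ∑ j, deriv (c j) u * T j ω s := fun u s =>
    Tame.sum _ fun j => (hT j s).const_mul _
  have hcd : ∀ j, ∃ M, ∀ v ∈ Metric.closedBall u 1, ‖deriv (c j) v‖ ≤ M := fun j =>
    (isCompact_closedBall u 1).exists_bound_of_continuousOn
      ((hc j).continuous_deriv le_rfl).continuousOn
  choose M hM using hcd
  have hbt : Tame n fun ω => ∑ s, ∑ j, M j * |T j ω s| :=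
    Tame.sum _ fun s => Tame.sum _ fun j => (hT j s).abs.const_mul _
  refine (hasDerivAt_integral_of_dominated_loc_of_deriv_le (μ := disorderLaw N k p) (x₀ := u)
    (F := fun u ω => logSumExp fun s => ∑ j, c j u * T j ω s)
    (F' := fun u ω => gibbsAvg (fun s => ∑ j, c j u * T j ω s)
      fun s => ∑ j, deriv (c j) u * T j ω s)
    (bound := fun ω => ∑ s, ∑ j, M j * |T j ω s|)
    (Metric.closedBall_mem_nhds u one_pos)
    (Eventually.of_forall fun v => (Tame.logSumExp (hE v)).1.aestronglyMeasurable)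
    ((Tame.logSumExp (hE u)).integrable hn)
    (Tame.gibbsAvg (fun s => (hE u s).1) (hE' u)).1.aestronglyMeasurable
    (ae_of_all _ fun ω v hv => ?_) (hbt.integrable hn)
    (ae_of_all _ fun ω v hv => ?_)).2
  · refine abs_gibbsAvg_le _ fun s => ?_
    have hnn : ∀ s j, 0 ≤ M j * |T j ω s| := fun s j =>
      mul_nonneg ((norm_nonneg _).trans (hM j v hv)) (abs_nonneg _)
    calc |∑ j, deriv (c j) v * T j ω s| ≤ ∑ j, |deriv (c j) v * T j ω s| :=
          Finset.abs_sum_le_sum_abs _ _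
      _ ≤ ∑ j, M j * |T j ω s| := Finset.sum_le_sum fun j _ => by
          rw [abs_mul]
          exact mul_le_mul_of_nonneg_right (hM j v hv) (abs_nonneg _)
      _ ≤ _ := Finset.single_le_sum (f := fun s => ∑ j, M j * |T j ω s|)
          (fun s _ => Finset.sum_nonneg fun j _ => hnn s j) (Finset.mem_univ s)
  · refine hasDerivAt_logSumExp fun s => HasDerivAt.fun_sum fun j _ => ?_
    exact (((hc j).differentiable one_ne_zero) v).hasDerivAt.mul_const _

/-- The derivative of the energy along a path of couplings. -/
noncomputable def energyRate (s b r s' a' b' r' : ℝ) (d : Disorder N k p) (σ : Config N) : ℝ :=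
  a' * alignment d.η σ + (r' / 2 * ∑ μ, hiddenField s b d μ σ ^ 2 +
    r * ∑ μ, hiddenField s b d μ σ * hiddenField s' b' d μ σ)

lemma hasDerivAt_energy {s a b r : ℝ → ℝ} {s' a' b' r' u : ℝ} (hs : HasDerivAt s s' u)
    (ha : HasDerivAt a a' u) (hb : HasDerivAt b b' u) (hr : HasDerivAt r r' u) (β : ℝ)
    (x : Fin k → ℝ) (d : Disorder N k p) (σ : Config N) :
    HasDerivAt (fun u => energy β x (s u) (a u) (b u) (r u) d σ)
      (energyRate (s u) (b u) (r u) s' a' b' r' d σ) u := by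
  have hf : ∀ μ, HasDerivAt (fun u => hiddenField (s u) (b u) d μ σ)
      (hiddenField s' b' d μ σ) u := fun μ => (hs.mul_const _).add (hb.mul_const _)
  have h := ((ha.mul_const (alignment d.η σ)).const_add (booleanEnergy β x d σ)).add
    ((hr.div_const 2).mul (HasDerivAt.fun_sum (u := Finset.univ) fun μ _ => (hf μ).pow 2))
  refine h.congr_deriv ?_
  rw [energyRate, Finset.mul_sum, Finset.mul_sum, Finset.mul_sum, Finset.mul_sum]
  congr 2
  refine Finset.sum_congr rfl fun μ _ => ?_
  simp; ring

/-- Expanding the squares separates the coefficients that move along the path from the quantities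
depending on disorder and spins, as the differentiation theorem requires. -/
lemma energy_eq_sum (β : ℝ) (x : Fin k → ℝ) (s a b r : ℝ) (d : Disorder N k p) (σ : Config N) :
    energy β x s a b r d σ = ∑ j, (![1, a, r / 2 * s ^ 2, r * s * b, r / 2 * b ^ 2] j) *
      (![booleanEnergy β x d σ, alignment d.η σ, ∑ μ, alignment (d.ξ μ) σ ^ 2,
        ∑ μ, alignment (d.ξ μ) σ * d.θ μ, ∑ μ, d.θ μ ^ 2] j) := by
  simp only [Fin.sum_univ_five, energy, hiddenField]
  simp [Finset.mul_sum]
  rw [add_assoc, add_assoc, add_assoc, add_assoc, ← Finset.sum_add_distrib,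
    ← Finset.sum_add_distrib]
  congr 2
  exact Finset.sum_congr rfl fun _ _ => by ring

theorem hasDerivAt_integral_logSumExp_energy {s a b r : ℝ → ℝ} (hs : ContDiff ℝ 1 s)
    (ha : ContDiff ℝ 1 a) (hb : ContDiff ℝ 1 b) (hr : ContDiff ℝ 1 r) (β : ℝ) (x : Fin k → ℝ)
    {s' a' b' r' u : ℝ} (hs' : HasDerivAt s s' u) (ha' : HasDerivAt a a' u)
    (hb' : HasDerivAt b b' u) (hr' : HasDerivAt r r' u) :
    HasDerivAt (fun u => ∫ ω, logSumExp (energy β x (s u) (a u) (b u) (r u) (toDisorder ω))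
        ∂(disorderLaw N k p))
      (∫ ω, gibbsAvg (energy β x (s u) (a u) (b u) (r u) (toDisorder ω))
        (energyRate (s u) (b u) (r u) s' a' b' r' (toDisorder ω)) ∂(disorderLaw N k p)) u := by
  set c : Fin 5 → ℝ → ℝ := ![fun _ => 1, a, fun u => r u / 2 * s u ^ 2, fun u => r u * s u * b u,
    fun u => r u / 2 * b u ^ 2] with hc
  set T : Fin 5 → DisorderSpace N k p → Config N → ℝ := fun j ω σ =>
    ![booleanEnergy β x (toDisorder ω) σ, alignment (toDisorder ω).η σ,
      ∑ μ, alignment ((toDisorder ω).ξ μ) σ ^ 2,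
      ∑ μ, alignment ((toDisorder ω).ξ μ) σ * (toDisorder ω).θ μ,
      ∑ μ, (toDisorder ω).θ μ ^ 2] j with hT
  have hcd : ∀ j, ContDiff ℝ 1 (c j) := by
    intro j
    fin_cases j
    · exact contDiff_const
    · exact ha
    · exact (hr.div_const 2).mul (hs.pow 2)
    · exact (hr.mul hs).mul hb
    · exact (hr.div_const 2).mul (hb.pow 2)
  have hX : ∀ μ σ, Tame 1 fun ω : DisorderSpace N k p => alignment ((toDisorder ω).ξ μ) σ :=
    fun μ σ => Tame.spinMul (Tame.ξ μ) σ
  have hTt : ∀ j σ, Tame 2 fun ω => T j ω σ := by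
    intro j σ
    fin_cases j
    · exact Tame.booleanEnergy β x σ
    · exact (Tame.spinMul Tame.η σ).mono (by norm_num)
    · exact Tame.sum Finset.univ fun μ => (hX μ σ).pow_two
    · exact Tame.sum Finset.univ fun μ => (hX μ σ).mul (Tame.θ μ)
    · exact Tame.sum Finset.univ fun μ => (Tame.θ μ).pow_two
  have hE : ∀ u ω, energy β x (s u) (a u) (b u) (r u) (toDisorder ω) =
      fun σ => ∑ j, c j u * T j ω σ := by
    intro u ω
    ext σ
    rw [energy_eq_sum]
    refine Finset.sum_congr rfl fun j _ => ?_
    fin_cases j <;> rfl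
  have h := hasDerivAt_integral_logSumExp (by norm_num) hcd hTt u
  have hd : ∀ ω, energyRate (s u) (b u) (r u) s' a' b' r' (toDisorder ω) =
      fun σ => ∑ j, deriv (c j) u * T j ω σ := by
    intro ω
    ext σ
    -- The factored and the expanded forms of the rate are both derivatives of the same energy, so
    -- they agree without comparing coefficients.
    refine (hasDerivAt_energy hs' ha' hb' hr' β x (toDisorder ω) σ).unique ?_
    simp_rw [fun v => congrFun (hE v ω) σ]
    exact HasDerivAt.fun_sum fun j _ =>
      (((hcd j).differentiable one_ne_zero) u).hasDerivAt.mul_const _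
  simp_rw [hE, hd]
  exact h

/-! ### Integration by parts for the Gibbs averages -/

lemma alignment_update (ξ : Fin N → ℝ) (i : Fin N) (y : ℝ) (σ : Config N) :
    alignment (Function.update ξ i y) σ = alignment ξ σ + (y - ξ i) * spin σ i := by
  rw [alignment, alignment, ← sub_eq_iff_eq_add', ← Finset.sum_sub_distrib,
    Finset.sum_eq_single i]
  · simp; ring
  · intro j _ h; simp [h]
  · simp

lemma hasDerivAt_alignment_update (ξ : Fin N → ℝ) (i : Fin N) (y : ℝ) (σ : Config N) :
    HasDerivAt (fun y => alignment (Function.update ξ i y) σ) (spin σ i) y := by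
  simp_rw [alignment_update]
  simpa using (((hasDerivAt_id y).sub_const (ξ i)).mul_const (spin σ i)).const_add (alignment ξ σ)

variable (β : ℝ) (x : Fin k → ℝ) (s a b r : ℝ)

lemma measurable_energy (σ : Config N) :
    Measurable fun ω : DisorderSpace N k p => energy β x s a b r (toDisorder ω) σ :=
  (Tame.energy β x s a b r σ).1

lemma tame_gibbsAvg_energy {n : ℕ} {f : DisorderSpace N k p → Config N → ℝ}
    (hf : ∀ σ, Tame n fun ω => f ω σ) :
    Tame n fun ω => gibbsAvg (energy β x s a b r (toDisorder ω)) (f ω) :=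
  Tame.gibbsAvg (measurable_energy β x s a b r) hf

/-- The derivative of ⟨σ_i⟩ in η_i is a times the variance of σ_i, that is a(1 - ⟨σ_i⟩²), because
σ_i² = 1. -/
theorem integral_η_mul_gibbsAvg (i : Fin N) :
    ∫ ω, ω.2.1 i * gibbsAvg (energy β x s a b r (toDisorder ω)) (fun σ => spin σ i)
      ∂(disorderLaw N k p) =
    a * ∫ ω, (1 - gibbsAvg (energy β x s a b r (toDisorder ω)) (fun σ => spin σ i) ^ 2)
      ∂(disorderLaw N k p) := by
  have hA : Tame 0 fun ω : DisorderSpace N k p =>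
      gibbsAvg (energy β x s a b r (toDisorder ω)) (fun σ => spin σ i) :=
    tame_gibbsAvg_energy β x s a b r fun σ => Tame.const _
  rw [← integral_const_mul]
  refine (isResampling_η i).integration_by_parts (g := fun ω => ω.2.1 i) (fun ω y => by simp)
    (fun ω y => ?_) (hA.integrable (by norm_num)) (((Tame.η i).mul hA).integrable (by norm_num))
    ((((Tame.const 1).sub hA.pow_two).const_mul a).integrable (by norm_num))
  refine (hasDerivAt_gibbsAvg (E' := fun σ => a * spin σ i) (f' := fun _ => 0)
    (f := fun _ σ => spin σ i) (fun σ => ?_) fun σ => hasDerivAt_const _ _).congr_deriv ?_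
  · exact (((hasDerivAt_alignment_update ω.2.1 i y σ).const_mul a).const_add
      (booleanEnergy β x (toDisorder ω) σ)).add_const
      (r / 2 * ∑ μ, hiddenField s b (toDisorder ω) μ σ ^ 2)
  · have e : (fun σ : Config N => spin σ i * (a * spin σ i)) = fun σ => a := by
      ext σ; rw [mul_left_comm, spin_mul_self, mul_one]
    rw [e, gibbsAvg_const, gibbsAvg_const, gibbsAvg_const_mul]
    ring

theorem integral_θ_mul_gibbsAvg (μ : Fin p) :
    ∫ ω, ω.2.2 μ * gibbsAvg (energy β x s a b r (toDisorder ω))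
      (fun σ => hiddenField s b (toDisorder ω) μ σ) ∂(disorderLaw N k p) =
    b * ∫ ω, (1 + r * gibbsAvg (energy β x s a b r (toDisorder ω))
        (fun σ => hiddenField s b (toDisorder ω) μ σ ^ 2) -
      r * gibbsAvg (energy β x s a b r (toDisorder ω))
        (fun σ => hiddenField s b (toDisorder ω) μ σ) ^ 2) ∂(disorderLaw N k p) := by
  have hA : Tame 1 fun ω : DisorderSpace N k p => gibbsAvg (energy β x s a b r (toDisorder ω))
      (fun σ => hiddenField s b (toDisorder ω) μ σ) :=
    tame_gibbsAvg_energy β x s a b r fun σ => Tame.hiddenField s b μ σ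
  have hB : Tame 2 fun ω : DisorderSpace N k p => gibbsAvg (energy β x s a b r (toDisorder ω))
      (fun σ => hiddenField s b (toDisorder ω) μ σ ^ 2) :=
    tame_gibbsAvg_energy β x s a b r fun σ => (Tame.hiddenField s b μ σ).pow_two
  rw [← integral_const_mul]
  refine (isResampling_θ μ).integration_by_parts (g := fun ω => ω.2.2 μ) (fun ω y => by simp)
    (fun ω y => ?_) (hA.integrable (by norm_num)) (((Tame.θ μ).mul hA).integrable (by norm_num))
    (((((Tame.const 1).add (hB.const_mul r)).sub (hA.pow_two.const_mul r)).const_mul b).integrable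
      (by norm_num))
  set ω' : DisorderSpace N k p := (ω.1, (ω.2.1, Function.update ω.2.2 μ y)) with hω'
  have hθ : ∀ μ', HasDerivAt (fun y => Function.update ω.2.2 μ y μ') (if μ' = μ then 1 else 0) y :=
    fun μ' => by
      by_cases h : μ' = μ
      · subst h; simpa using hasDerivAt_id' y
      · simpa [h] using hasDerivAt_const y (ω.2.2 μ')
  have hf : ∀ μ' σ, HasDerivAt (fun y => hiddenField s b
      (toDisorder (ω.1, (ω.2.1, Function.update ω.2.2 μ y)) : Disorder N k p) μ' σ)
      (if μ' = μ then b else 0) y := fun μ' σ => by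
    refine ((((hθ μ').const_mul b).const_add (s * alignment (ω.1.2 μ') σ)).congr_deriv ?_ :)
    split_ifs <;> simp
  refine (hasDerivAt_gibbsAvg
    (E' := fun σ => r * (b * hiddenField s b (toDisorder ω') μ σ)) (f' := fun _ => b)
    (fun σ => ?_) fun σ => ?_).congr_deriv ?_
  · refine ((((HasDerivAt.fun_sum (u := Finset.univ) fun μ' _ =>
      (hf μ' σ).fun_pow 2).const_mul (r / 2)).const_add
      (booleanEnergy β x (toDisorder ω) σ + a * alignment ω.2.1 σ)).congr_deriv ?_ :)
    rw [Finset.sum_eq_single μ]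
    · simp; ring
    · intro μ' _ h; simp [h]
    · simp
  · simpa using hf μ σ
  · have e : (fun σ : Config N => hiddenField s b (toDisorder ω') μ σ *
        (r * (b * hiddenField s b (toDisorder ω') μ σ))) =
        fun σ => r * b * hiddenField s b (toDisorder ω') μ σ ^ 2 := by ext σ; ring
    rw [e, gibbsAvg_const, gibbsAvg_const_mul, gibbsAvg_const_mul, gibbsAvg_const_mul]
    ring

/-- The energy has derivative r s h_μ σ_i in ξ_i^μ, and h_μ σ_i itself has derivative s. Since σ_i²
= 1, the second moment of h_μ σ_i is the same self-overlap ⟨h_μ²⟩ as in the formula for θ, which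
permits their later cancellation. -/
theorem integral_ξ_mul_gibbsAvg (μ : Fin p) (i : Fin N) :
    ∫ ω, ω.1.2 μ i * gibbsAvg (energy β x s a b r (toDisorder ω))
      (fun σ => hiddenField s b (toDisorder ω) μ σ * spin σ i) ∂(disorderLaw N k p) =
    s * ∫ ω, (1 + r * gibbsAvg (energy β x s a b r (toDisorder ω))
        (fun σ => hiddenField s b (toDisorder ω) μ σ ^ 2) -
      r * gibbsAvg (energy β x s a b r (toDisorder ω))
        (fun σ => hiddenField s b (toDisorder ω) μ σ * spin σ i) ^ 2) ∂(disorderLaw N k p) := by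
  have hA : Tame 1 fun ω : DisorderSpace N k p => gibbsAvg (energy β x s a b r (toDisorder ω))
      (fun σ => hiddenField s b (toDisorder ω) μ σ * spin σ i) :=
    tame_gibbsAvg_energy β x s a b r fun σ => (Tame.hiddenField s b μ σ).mul_const _
  have hB : Tame 2 fun ω : DisorderSpace N k p => gibbsAvg (energy β x s a b r (toDisorder ω))
      (fun σ => hiddenField s b (toDisorder ω) μ σ ^ 2) :=
    tame_gibbsAvg_energy β x s a b r fun σ => (Tame.hiddenField s b μ σ).pow_two
  rw [← integral_const_mul]
  refine (isResampling_ξ μ i).integration_by_parts (g := fun ω => ω.1.2 μ i)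
    (fun ω y => by simp) (fun ω y => ?_) (hA.integrable (by norm_num))
    (((Tame.ξ μ i).mul hA).integrable (by norm_num))
    (((((Tame.const 1).add (hB.const_mul r)).sub (hA.pow_two.const_mul r)).const_mul s).integrable
      (by norm_num))
  set U : ℝ → DisorderSpace N k p := fun y =>
    ((ω.1.1, Function.update ω.1.2 μ (Function.update (ω.1.2 μ) i y)), ω.2) with hU
  have hX : ∀ μ' σ, HasDerivAt (fun y => alignment ((toDisorder (U y)).ξ μ') σ)
      (if μ' = μ then spin σ i else 0) y := fun μ' σ => by
    by_cases h : μ' = μ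
    · subst h
      simpa [hU, toDisorder] using hasDerivAt_alignment_update (ω.1.2 μ') i y σ
    · simpa [hU, toDisorder, h] using hasDerivAt_const y (alignment (ω.1.2 μ') σ)
  have hf : ∀ μ' σ, HasDerivAt (fun y => hiddenField s b (toDisorder (U y)) μ' σ)
      (if μ' = μ then s * spin σ i else 0) y := fun μ' σ => by
    refine ((((hX μ' σ).const_mul s).add_const (b * ω.2.2 μ')).congr_deriv ?_ :)
    split_ifs <;> simp
  refine (hasDerivAt_gibbsAvg
    (E' := fun σ => r * (s * (hiddenField s b (toDisorder (U y)) μ σ * spin σ i)))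
    (f' := fun _ => s)
    (fun σ => ?_) fun σ => ?_).congr_deriv ?_
  · refine ((((HasDerivAt.fun_sum (u := Finset.univ) fun μ' _ =>
      (hf μ' σ).fun_pow 2).const_mul (r / 2)).const_add
      (booleanEnergy β x (toDisorder ω) σ + a * alignment ω.2.1 σ)).congr_deriv ?_ :)
    rw [Finset.sum_eq_single μ]
    · simp; ring
    · intro μ' _ h; simp [h]
    · simp
  · refine ((hf μ σ).mul_const (spin σ i)).congr_deriv ?_
    rw [if_pos rfl, mul_assoc, spin_mul_self, mul_one]
  · have e : (fun σ : Config N => hiddenField s b (toDisorder (U y)) μ σ * spin σ i *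
        (r * (s * (hiddenField s b (toDisorder (U y)) μ σ * spin σ i)))) =
        fun σ => r * s * hiddenField s b (toDisorder (U y)) μ σ ^ 2 := by
      ext σ
      linear_combination (r * s * hiddenField s b (toDisorder (U y)) μ σ ^ 2) * spin_mul_self σ i
    rw [e, gibbsAvg_const, gibbsAvg_const_mul, gibbsAvg_const_mul, gibbsAvg_const_mul]
    ring

end

/-! ### Two-replica averages -/

/-- The average of a function of two independent replicas. -/
noncomputable def replicaAvg {S : Type*} [Fintype S] (E : S → ℝ) (f : S → S → ℝ) : ℝ :=
  gibbsAvg (fun w : S × S => E w.1 + E w.2) fun w => f w.1 w.2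

section

variable {N k p : ℕ}

/-- The mean of the overlap of the hidden units given the neurons. -/
noncomputable def hiddenOverlap (s b r : ℝ) (d : Disorder N k p) (σ τ : Config N) : ℝ :=
  r ^ 2 / p * ∑ μ, hiddenField s b d μ σ * hiddenField s b d μ τ

/-- A squared one-replica average is an average over two independent replicas. This and its two
analogues below convert the output of the integrations by parts into overlaps. -/
lemma mul_replicaAvg_overlapVisible (hN : 0 < N) (E : Config N → ℝ) :
    N * replicaAvg E overlapVisible = ∑ i, gibbsAvg E (fun σ => spin σ i) ^ 2 := by
  have hN' : (N : ℝ) ≠ 0 := by positivity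
  simp only [replicaAvg, overlapVisible]
  rw [gibbsAvg_const_mul, gibbsAvg_sum, ← mul_assoc, mul_one_div_cancel hN', one_mul]
  refine Finset.sum_congr rfl fun i _ => ?_
  rw [gibbsAvg_prod E (fun σ => spin σ i) E (fun σ => spin σ i), sq]

lemma mul_replicaAvg_hiddenOverlap (hp : 0 < p) (s b r : ℝ) (d : Disorder N k p)
    (E : Config N → ℝ) : p * replicaAvg E (hiddenOverlap s b r d) =
      r ^ 2 * ∑ μ, gibbsAvg E (fun σ => hiddenField s b d μ σ) ^ 2 := by
  have hp' : (p : ℝ) ≠ 0 := by positivity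
  simp only [replicaAvg, hiddenOverlap]
  rw [gibbsAvg_const_mul, gibbsAvg_sum, ← mul_assoc, mul_div_cancel₀ _ hp']
  congr 1
  refine Finset.sum_congr rfl fun μ _ => ?_
  rw [gibbsAvg_prod E (fun σ => hiddenField s b d μ σ) E (fun σ => hiddenField s b d μ σ), sq]

lemma mul_replicaAvg_overlap_mul_overlap (hN : 0 < N) (hp : 0 < p) (s b r : ℝ)
    (d : Disorder N k p) (E : Config N → ℝ) :
    N * p * replicaAvg E (fun σ τ => overlapVisible σ τ * hiddenOverlap s b r d σ τ) =
      r ^ 2 * ∑ μ, ∑ i, gibbsAvg E (fun σ => hiddenField s b d μ σ * spin σ i) ^ 2 := by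
  have hN' : (N : ℝ) ≠ 0 := by positivity
  have hp' : (p : ℝ) ≠ 0 := by positivity
  have e : ∀ σ τ, overlapVisible σ τ * hiddenOverlap s b r d σ τ = r ^ 2 / (N * p) *
      ∑ μ, ∑ i, (hiddenField s b d μ σ * spin σ i) * (hiddenField s b d μ τ * spin τ i) := by
    intro σ τ
    rw [overlapVisible, hiddenOverlap, mul_mul_mul_comm, mul_comm (∑ i, _), Finset.sum_mul_sum]
    congr 1
    · field_simp
    · exact Finset.sum_congr rfl fun _ _ => Finset.sum_congr rfl fun _ _ => by ring
  simp only [replicaAvg, e]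
  rw [gibbsAvg_const_mul, gibbsAvg_sum, ← mul_assoc, mul_div_cancel₀ _ (by positivity)]
  congr 1
  refine Finset.sum_congr rfl fun μ _ => ?_
  rw [gibbsAvg_sum]
  refine Finset.sum_congr rfl fun i _ => ?_
  rw [gibbsAvg_prod E (fun σ => hiddenField s b d μ σ * spin σ i) E
    (fun σ => hiddenField s b d μ σ * spin σ i), sq]

lemma tame_replicaAvg {n : ℕ} (β : ℝ) (x : Fin k → ℝ) (s a b r : ℝ)
    {f : DisorderSpace N k p → Config N → Config N → ℝ} (hf : ∀ σ τ, Tame n fun ω => f ω σ τ) :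
    Tame n fun ω => replicaAvg (energy β x s a b r (toDisorder ω)) (f ω) :=
  Tame.gibbsAvg (fun w => (measurable_energy β x s a b r w.1).add
    (measurable_energy β x s a b r w.2)) fun w => hf w.1 w.2

lemma Tame.hiddenOverlap (s b r : ℝ) (σ τ : Config N) :
    Tame 2 fun ω : DisorderSpace N k p => hiddenOverlap s b r (toDisorder ω) σ τ :=
  (Tame.sum Finset.univ fun μ => (Tame.hiddenField s b μ σ).mul
    (Tame.hiddenField s b μ τ)).const_mul _

/-! ### The derivative of the interpolating free energy -/

variable (β : ℝ) (x : Fin k → ℝ) (s a b r : ℝ)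

/-- Everything linear in the derivatives of the fields is brought to the shape Gaussian variable
times Gibbs average, to which integration by parts applies. -/
lemma gibbsAvg_energyRate (E : Config N → ℝ) (s' a' b' r' : ℝ) (d : Disorder N k p) :
    gibbsAvg E (energyRate s b r s' a' b' r' d) =
      a' * ∑ i, d.η i * gibbsAvg E (fun σ => spin σ i) +
      (r' / 2 * ∑ μ, gibbsAvg E (fun σ => hiddenField s b d μ σ ^ 2) +
        (r * s' * ∑ μ, ∑ i, d.ξ μ i * gibbsAvg E (fun σ => hiddenField s b d μ σ * spin σ i) +
        r * b' * ∑ μ, d.θ μ * gibbsAvg E (fun σ => hiddenField s b d μ σ))) := by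
  have e : energyRate s b r s' a' b' r' d = fun σ => a' * ∑ i, d.η i * spin σ i +
      (r' / 2 * ∑ μ, hiddenField s b d μ σ ^ 2 +
        (r * s' * ∑ μ, ∑ i, d.ξ μ i * (hiddenField s b d μ σ * spin σ i) +
        r * b' * ∑ μ, d.θ μ * hiddenField s b d μ σ)) := by
    ext σ
    rw [energyRate, alignment]
    congr 2
    rw [Finset.mul_sum, Finset.mul_sum, Finset.mul_sum, ← Finset.sum_add_distrib]
    refine Finset.sum_congr rfl fun μ _ => ?_
    have h : ∑ i, d.ξ μ i * (hiddenField s b d μ σ * spin σ i) =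
        hiddenField s b d μ σ * alignment (d.ξ μ) σ := by
      rw [alignment, Finset.mul_sum]
      exact Finset.sum_congr rfl fun _ _ => by ring
    have h' : hiddenField s' b' d μ σ = s' * alignment (d.ξ μ) σ + b' * d.θ μ := rfl
    rw [h, h']
    ring
  rw [e, gibbsAvg_add, gibbsAvg_add, gibbsAvg_add, gibbsAvg_const_mul, gibbsAvg_const_mul,
    gibbsAvg_const_mul, gibbsAvg_const_mul, gibbsAvg_sum, gibbsAvg_sum, gibbsAvg_sum, gibbsAvg_sum]
  simp_rw [gibbsAvg_sum, gibbsAvg_const_mul]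

/-- All self-overlaps are collected under the single coefficient r'/2 + r²(s's N + b'b), which
vanishes along the interpolating path. The other terms are two-replica averages and explicit
constants. -/
theorem integral_gibbsAvg_energyRate (hN : 0 < N) (hp : 0 < p) (s' a' b' r' : ℝ) :
    ∫ ω, gibbsAvg (energy β x s a b r (toDisorder ω))
      (energyRate s b r s' a' b' r' (toDisorder ω)) ∂(disorderLaw N k p) =
    a' * a * (N * (1 - ∫ ω, replicaAvg (energy β x s a b r (toDisorder ω)) overlapVisible
      ∂(disorderLaw N k p))) +
    ((r' / 2 + r ^ 2 * (s' * s * N + b' * b)) * (∑ μ : Fin p, ∫ ω, gibbsAvg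
      (energy β x s a b r (toDisorder ω)) (fun σ => hiddenField s b (toDisorder ω) μ σ ^ 2)
      ∂(disorderLaw N k p)) +
    (s' * s * N * (r * p - p * ∫ ω, replicaAvg (energy β x s a b r (toDisorder ω))
      (fun σ τ => overlapVisible σ τ * hiddenOverlap s b r (toDisorder ω) σ τ)
      ∂(disorderLaw N k p)) +
    b' * b * (r * p - p * ∫ ω, replicaAvg (energy β x s a b r (toDisorder ω))
      (hiddenOverlap s b r (toDisorder ω)) ∂(disorderLaw N k p)))) := by
  have hA : ∀ i, Tame 0 fun ω : DisorderSpace N k p =>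
      gibbsAvg (energy β x s a b r (toDisorder ω)) (fun σ => spin σ i) := fun i =>
    tame_gibbsAvg_energy β x s a b r fun σ => Tame.const _
  have hB : ∀ μ : Fin p, Tame 1 fun ω : DisorderSpace N k p =>
      gibbsAvg (energy β x s a b r (toDisorder ω))
      (fun σ => hiddenField s b (toDisorder ω) μ σ) := fun μ =>
    tame_gibbsAvg_energy β x s a b r fun σ => Tame.hiddenField s b μ σ
  have hC : ∀ μ : Fin p, Tame 2 fun ω : DisorderSpace N k p =>
      gibbsAvg (energy β x s a b r (toDisorder ω))
      (fun σ => hiddenField s b (toDisorder ω) μ σ ^ 2) := fun μ =>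
    tame_gibbsAvg_energy β x s a b r fun σ => (Tame.hiddenField s b μ σ).pow_two
  have hD : ∀ (μ : Fin p) i, Tame 1 fun ω : DisorderSpace N k p =>
      gibbsAvg (energy β x s a b r (toDisorder ω))
      (fun σ => hiddenField s b (toDisorder ω) μ σ * spin σ i) := fun μ i =>
    tame_gibbsAvg_energy β x s a b r fun σ => (Tame.hiddenField s b μ σ).mul_const _
  have h1 : Tame 2 fun ω : DisorderSpace N k p => a' * ∑ i, ω.2.1 i *
      gibbsAvg (energy β x s a b r (toDisorder ω)) (fun σ => spin σ i) :=
    (Tame.sum Finset.univ fun i => ((Tame.η i).mul (hA i)).mono (by norm_num)).const_mul _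
  have h2 : Tame 2 fun ω : DisorderSpace N k p => r' / 2 * ∑ μ,
      gibbsAvg (energy β x s a b r (toDisorder ω))
        (fun σ => hiddenField s b (toDisorder ω) μ σ ^ 2) :=
    (Tame.sum Finset.univ hC).const_mul _
  have h3 : Tame 2 fun ω : DisorderSpace N k p => r * s' * ∑ μ, ∑ i, ω.1.2 μ i *
      gibbsAvg (energy β x s a b r (toDisorder ω))
        (fun σ => hiddenField s b (toDisorder ω) μ σ * spin σ i) :=
    (Tame.sum Finset.univ fun μ => Tame.sum Finset.univ fun i =>
      (Tame.ξ μ i).mul (hD μ i)).const_mul _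
  have h4 : Tame 2 fun ω : DisorderSpace N k p => r * b' * ∑ μ, ω.2.2 μ *
      gibbsAvg (energy β x s a b r (toDisorder ω))
        (fun σ => hiddenField s b (toDisorder ω) μ σ) :=
    (Tame.sum Finset.univ fun μ => (Tame.θ μ).mul (hB μ)).const_mul _
  have e1 : ∑ i, ∫ ω, (1 - gibbsAvg (energy β x s a b r (toDisorder ω)) (fun σ => spin σ i) ^ 2)
      ∂(disorderLaw N k p) = N * (1 - ∫ ω, replicaAvg (energy β x s a b r (toDisorder ω))
        overlapVisible ∂(disorderLaw N k p)) := by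
    have : ∀ ω : DisorderSpace N k p,
        ∑ i, gibbsAvg (energy β x s a b r (toDisorder ω)) (fun σ => spin σ i) ^ 2 =
        N * replicaAvg (energy β x s a b r (toDisorder ω)) overlapVisible := fun ω =>
      (mul_replicaAvg_overlapVisible hN _).symm
    simp_rw [integral_sub (integrable_const _) ((hA _).pow_two.integrable (by norm_num))]
    rw [Finset.sum_sub_distrib, ← integral_finsetSum _ fun i _ =>
      (hA i).pow_two.integrable (by norm_num)]
    simp_rw [this]
    rw [integral_const_mul]
    simp; ring
  have e2 : ∑ μ : Fin p, ∫ ω, (1 + r * gibbsAvg (energy β x s a b r (toDisorder ω))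
        (fun σ => hiddenField s b (toDisorder ω) μ σ ^ 2) -
      r * gibbsAvg (energy β x s a b r (toDisorder ω))
        (fun σ => hiddenField s b (toDisorder ω) μ σ) ^ 2) ∂(disorderLaw N k p) =
      p + r * (∑ μ : Fin p, ∫ ω, gibbsAvg (energy β x s a b r (toDisorder ω))
        (fun σ => hiddenField s b (toDisorder ω) μ σ ^ 2) ∂(disorderLaw N k p)) -
      r * ∑ μ : Fin p, ∫ ω, gibbsAvg (energy β x s a b r (toDisorder ω))
        (fun σ => hiddenField s b (toDisorder ω) μ σ) ^ 2 ∂(disorderLaw N k p) := by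
    have i1 := fun μ => (hC μ).integrable (by norm_num)
    have i2 := fun μ => (hB μ).pow_two.integrable (by norm_num)
    have : ∀ μ : Fin p, ∫ ω, (1 + r * gibbsAvg (energy β x s a b r (toDisorder ω))
        (fun σ => hiddenField s b (toDisorder ω) μ σ ^ 2) -
      r * gibbsAvg (energy β x s a b r (toDisorder ω))
        (fun σ => hiddenField s b (toDisorder ω) μ σ) ^ 2) ∂(disorderLaw N k p) =
      1 + r * (∫ ω, gibbsAvg (energy β x s a b r (toDisorder ω))
        (fun σ => hiddenField s b (toDisorder ω) μ σ ^ 2) ∂(disorderLaw N k p)) -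
      r * ∫ ω, gibbsAvg (energy β x s a b r (toDisorder ω))
        (fun σ => hiddenField s b (toDisorder ω) μ σ) ^ 2 ∂(disorderLaw N k p) := fun μ => by
      have i3 : Integrable (fun ω => 1 + r * gibbsAvg (energy β x s a b r (toDisorder ω))
        (fun σ => hiddenField s b (toDisorder ω) μ σ ^ 2)) (disorderLaw N k p) :=
        (integrable_const _).add ((i1 μ).const_mul r)
      rw [integral_sub i3 ((i2 μ).const_mul r), integral_add (integrable_const _)
        ((i1 μ).const_mul r), integral_const_mul, integral_const_mul]
      simp
    simp_rw [this]
    rw [Finset.sum_sub_distrib, Finset.sum_add_distrib, Finset.mul_sum, Finset.mul_sum]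
    simp
  have e3 : ∑ μ : Fin p, ∑ i, ∫ ω, (1 + r * gibbsAvg (energy β x s a b r (toDisorder ω))
        (fun σ => hiddenField s b (toDisorder ω) μ σ ^ 2) -
      r * gibbsAvg (energy β x s a b r (toDisorder ω))
        (fun σ => hiddenField s b (toDisorder ω) μ σ * spin σ i) ^ 2) ∂(disorderLaw N k p) =
      N * p + N * r * (∑ μ : Fin p, ∫ ω, gibbsAvg (energy β x s a b r (toDisorder ω))
        (fun σ => hiddenField s b (toDisorder ω) μ σ ^ 2) ∂(disorderLaw N k p)) -
      r * ∑ μ : Fin p, ∑ i, ∫ ω, gibbsAvg (energy β x s a b r (toDisorder ω))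
        (fun σ => hiddenField s b (toDisorder ω) μ σ * spin σ i) ^ 2 ∂(disorderLaw N k p) := by
    have i1 := fun μ => (hC μ).integrable (by norm_num)
    have i2 := fun μ i => (hD μ i).pow_two.integrable (by norm_num)
    have : ∀ (μ : Fin p) i, ∫ ω, (1 + r * gibbsAvg (energy β x s a b r (toDisorder ω))
        (fun σ => hiddenField s b (toDisorder ω) μ σ ^ 2) -
      r * gibbsAvg (energy β x s a b r (toDisorder ω))
        (fun σ => hiddenField s b (toDisorder ω) μ σ * spin σ i) ^ 2) ∂(disorderLaw N k p) =
      1 + r * (∫ ω, gibbsAvg (energy β x s a b r (toDisorder ω))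
        (fun σ => hiddenField s b (toDisorder ω) μ σ ^ 2) ∂(disorderLaw N k p)) -
      r * ∫ ω, gibbsAvg (energy β x s a b r (toDisorder ω))
        (fun σ => hiddenField s b (toDisorder ω) μ σ * spin σ i) ^ 2 ∂(disorderLaw N k p) :=
      fun μ i => by
      have i3 : Integrable (fun ω => 1 + r * gibbsAvg (energy β x s a b r (toDisorder ω))
        (fun σ => hiddenField s b (toDisorder ω) μ σ ^ 2)) (disorderLaw N k p) :=
        (integrable_const _).add ((i1 μ).const_mul r)
      rw [integral_sub i3 ((i2 μ i).const_mul r), integral_add (integrable_const _)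
        ((i1 μ).const_mul r), integral_const_mul, integral_const_mul]
      simp
    simp_rw [this, Finset.sum_sub_distrib, Finset.sum_add_distrib, Finset.mul_sum]
    simp only [Finset.sum_const, Finset.card_univ, Fintype.card_fin, nsmul_eq_mul, mul_one]
    rw [mul_comm (p : ℝ)]
    congr 2
    exact Finset.sum_congr rfl fun _ _ => by ring
  have e4 : p * ∫ ω, replicaAvg (energy β x s a b r (toDisorder ω))
      (hiddenOverlap s b r (toDisorder ω)) ∂(disorderLaw N k p) =
      r ^ 2 * ∑ μ : Fin p, ∫ ω, gibbsAvg (energy β x s a b r (toDisorder ω))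
        (fun σ => hiddenField s b (toDisorder ω) μ σ) ^ 2 ∂(disorderLaw N k p) := by
    rw [← integral_const_mul, ← integral_finsetSum _ fun μ _ =>
      (hB μ).pow_two.integrable (by norm_num), ← integral_const_mul]
    exact integral_congr_ae (ae_of_all _ fun ω => mul_replicaAvg_hiddenOverlap hp _ _ _ _ _)
  have e5 : N * p * ∫ ω, replicaAvg (energy β x s a b r (toDisorder ω))
      (fun σ τ => overlapVisible σ τ * hiddenOverlap s b r (toDisorder ω) σ τ)
      ∂(disorderLaw N k p) =
      r ^ 2 * ∑ μ : Fin p, ∑ i, ∫ ω, gibbsAvg (energy β x s a b r (toDisorder ω))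
        (fun σ => hiddenField s b (toDisorder ω) μ σ * spin σ i) ^ 2 ∂(disorderLaw N k p) := by
    have : ∀ μ : Fin p, ∑ i, ∫ ω, gibbsAvg (energy β x s a b r (toDisorder ω))
        (fun σ => hiddenField s b (toDisorder ω) μ σ * spin σ i) ^ 2 ∂(disorderLaw N k p) =
        ∫ ω, ∑ i, gibbsAvg (energy β x s a b r (toDisorder ω))
        (fun σ => hiddenField s b (toDisorder ω) μ σ * spin σ i) ^ 2 ∂(disorderLaw N k p) :=
      fun μ => (integral_finsetSum _ fun i _ => (hD μ i).pow_two.integrable (by norm_num)).symm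
    simp_rw [this]
    rw [← integral_const_mul, ← integral_finsetSum _ fun μ _ =>
      (Tame.sum Finset.univ fun i => (hD μ i).pow_two).integrable (by norm_num),
      ← integral_const_mul]
    exact integral_congr_ae (ae_of_all _ fun ω =>
      mul_replicaAvg_overlap_mul_overlap hN hp _ _ _ _ _)
  simp_rw [gibbsAvg_energyRate]
  have t34 : Tame 2 _ := h3.add h4
  have t234 : Tame 2 _ := h2.add t34
  refine (integral_add (h1.integrable (by norm_num)) (t234.integrable (by norm_num))).trans ?_
  rw [integral_add (h2.integrable (by norm_num)) (t34.integrable (by norm_num)),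
    integral_add (h3.integrable (by norm_num)) (h4.integrable (by norm_num)),
    integral_const_mul, integral_const_mul, integral_const_mul, integral_const_mul,
    integral_finsetSum _ fun i _ => ((Tame.η i).mul (hA i)).integrable (by norm_num),
    integral_finsetSum _ fun μ _ => (hC μ).integrable (by norm_num),
    integral_finsetSum _ fun μ _ => ((Tame.θ μ).mul (hB μ)).integrable (by norm_num),
    integral_finsetSum _ fun μ _ => (Tame.sum Finset.univ fun i =>
      (Tame.ξ μ i).mul (hD μ i)).integrable (by norm_num)]
  simp_rw [integral_finsetSum _ fun i _ => ((Tame.ξ _ i).mul (hD _ i)).integrable (by norm_num),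
    integral_η_mul_gibbsAvg, integral_ξ_mul_gibbsAvg, integral_θ_mul_gibbsAvg, ← Finset.mul_sum]
  rw [e1, e2, e3]
  linear_combination (s' * s) * e5 + b' * b * e4

end

/-! ### Integration of the hidden units -/

section

variable {N k p : ℕ}

/-- The mass of the tilted Gaussian measure `e^{b z + c z² / 2} γ(dz)`. -/
noncomputable def tiltMass (c b : ℝ) : ℝ := √(1 / (1 - c)) * Real.exp (b ^ 2 / (2 * (1 - c)))

lemma integral_pi_tilted {c : ℝ} (hc : c < 1) (h : Fin p → ℝ) (f : Fin p → ℝ → ℝ) :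
    ∫ z, (∏ μ, f μ (z μ)) * ∏ μ, Real.exp (h μ * z μ + c / 2 * z μ ^ 2)
      ∂(Measure.pi fun _ : Fin p => gauss) = (∏ μ, tiltMass c (h μ)) *
      ∏ μ, ∫ y, f μ y ∂gaussianReal (h μ / (1 - c)) (Real.toNNReal (1 / (1 - c))) := by
  simp_rw [← Finset.prod_mul_distrib]
  rw [integral_fintype_prod_eq_prod
    (fun μ y => f μ y * Real.exp (h μ * y + c / 2 * y ^ 2))]
  exact Finset.prod_congr rfl fun μ _ => integral_tilted_gauss hc _ _

lemma integrable_pi_tilted {c : ℝ} (hc : c < 1) (h : Fin p → ℝ) {f : Fin p → ℝ → ℝ}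
    (hf : ∀ μ, Integrable (f μ) (gaussianReal (h μ / (1 - c)) (Real.toNNReal (1 / (1 - c))))) :
    Integrable (fun z : Fin p → ℝ => (∏ μ, f μ (z μ)) *
      ∏ μ, Real.exp (h μ * z μ + c / 2 * z μ ^ 2)) (Measure.pi fun _ : Fin p => gauss) := by
  simp_rw [← Finset.prod_mul_distrib]
  exact Integrable.fintype_prod (f := fun μ y => f μ y * Real.exp (h μ * y + c / 2 * y ^ 2))
    fun μ => integrable_tilted_gauss hc _ (hf μ)

lemma integral_gaussianReal_sq (m : ℝ) (v : NNReal) :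
    ∫ y, y * y ∂gaussianReal m v = m ^ 2 + v := by
  have h := variance_eq_sub (memLp_id_gaussianReal (μ := m) (v := v) 2)
  rw [variance_id_gaussianReal] at h
  simp only [Pi.pow_apply, id, integral_id_gaussianReal] at h
  simp_rw [← sq]
  linarith

lemma integrable_gaussianReal_id (m : ℝ) (v : NNReal) :
    Integrable (fun y => y) (gaussianReal m v) :=
  (memLp_id_gaussianReal (μ := m) (v := v) 1).integrable (by norm_num)

lemma integrable_gaussianReal_sq (m : ℝ) (v : NNReal) :
    Integrable (fun y => y * y) (gaussianReal m v) := by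
  simpa only [← sq, id] using (memLp_id_gaussianReal (μ := m) (v := v) 2).integrable_sq

/-- The weight of the hidden units in a field `h`. -/
noncomputable def hiddenWeight (c : ℝ) (h z : Fin p → ℝ) : ℝ :=
  ∏ μ, Real.exp (h μ * z μ + c / 2 * z μ ^ 2)

lemma integral_hiddenWeight {c : ℝ} (hc : c < 1) (h : Fin p → ℝ) :
    ∫ z, hiddenWeight c h z ∂(Measure.pi fun _ : Fin p => gauss) = ∏ μ, tiltMass c (h μ) := by
  simpa [hiddenWeight] using integral_pi_tilted hc h fun _ _ => 1

lemma integrable_hiddenWeight {c : ℝ} (hc : c < 1) (h : Fin p → ℝ) :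
    Integrable (fun z => hiddenWeight c h z) (Measure.pi fun _ : Fin p => gauss) := by
  simpa [hiddenWeight] using integrable_pi_tilted hc h (f := fun _ _ => 1)
    fun _ => integrable_const _

lemma integral_mul_hiddenWeight {c : ℝ} (hc : c < 1) (h : Fin p → ℝ) (μ : Fin p) :
    ∫ z, z μ * hiddenWeight c h z ∂(Measure.pi fun _ : Fin p => gauss) =
      (∏ μ, tiltMass c (h μ)) * (h μ / (1 - c)) := by
  have e := integral_pi_tilted hc h fun κ y => if κ = μ then y else 1
  have e2 : ∀ κ, ∫ y, (if κ = μ then y else 1)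
      ∂gaussianReal (h κ / (1 - c)) (Real.toNNReal (1 / (1 - c))) =
      if κ = μ then h κ / (1 - c) else 1 := fun κ => by split_ifs <;> simp
  simp only [e2, Finset.prod_ite_eq', Finset.mem_univ, if_true] at e
  exact e

lemma integrable_mul_hiddenWeight {c : ℝ} (hc : c < 1) (h : Fin p → ℝ) (μ : Fin p) :
    Integrable (fun z => z μ * hiddenWeight c h z) (Measure.pi fun _ : Fin p => gauss) := by
  have e := integrable_pi_tilted hc h (f := fun κ y => if κ = μ then y else 1) fun κ => by
    split_ifs
    · exact integrable_gaussianReal_id _ _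
    · exact integrable_const _
  simp only [Finset.prod_ite_eq', Finset.mem_univ, if_true] at e
  exact e

lemma integral_mul_mul_hiddenWeight {c : ℝ} (hc : c < 1) (h : Fin p → ℝ) (μ ν : Fin p) :
    ∫ z, z μ * z ν * hiddenWeight c h z ∂(Measure.pi fun _ : Fin p => gauss) =
      (∏ μ, tiltMass c (h μ)) * (h μ / (1 - c) * (h ν / (1 - c)) +
        if μ = ν then 1 / (1 - c) else 0) := by
  have e := integral_pi_tilted hc h fun κ y =>
    (if κ = μ then y else 1) * (if κ = ν then y else 1)
  simp only [Finset.prod_mul_distrib, Finset.prod_ite_eq', Finset.mem_univ, if_true] at e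
  refine Eq.trans e ?_
  congr 1
  have h0 : 0 ≤ 1 / (1 - c) := by have : 0 < 1 - c := by linarith
                                  positivity
  by_cases hμν : μ = ν
  · subst hμν
    rw [if_pos rfl, Finset.prod_eq_single μ]
    · simp only [if_true]
      rw [integral_gaussianReal_sq, Real.coe_toNNReal _ h0]; ring
    · intro κ _ hκ; simp [hκ]
    · simp
  · have e2 : ∀ κ, ∫ y, (if κ = μ then y else 1) * (if κ = ν then y else 1)
        ∂gaussianReal (h κ / (1 - c)) (Real.toNNReal (1 / (1 - c))) =
        (if κ = μ then h κ / (1 - c) else 1) * (if κ = ν then h κ / (1 - c) else 1) := fun κ => by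
      by_cases h1 : κ = μ
      · have h2 : κ ≠ ν := fun h => hμν (h1 ▸ h)
        simp [h1, hμν]
      · by_cases h2 : κ = ν
        · subst h2; simp [h1]
        · simp [h1, h2]
    simp only [e2, Finset.prod_mul_distrib, Finset.prod_ite_eq', Finset.mem_univ, if_true, hμν,
      if_false, add_zero]

lemma integrable_mul_mul_hiddenWeight {c : ℝ} (hc : c < 1) (h : Fin p → ℝ) (μ ν : Fin p) :
    Integrable (fun z => z μ * z ν * hiddenWeight c h z)
      (Measure.pi fun _ : Fin p => gauss) := by
  have e := integrable_pi_tilted hc h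
    (f := fun κ y => (if κ = μ then y else 1) * (if κ = ν then y else 1)) fun κ => by
    split_ifs
    · exact integrable_gaussianReal_sq _ _
    · simpa using integrable_gaussianReal_id _ _
    · simpa using integrable_gaussianReal_id _ _
    · exact integrable_const _
  simp only [Finset.prod_mul_distrib, Finset.prod_ite_eq', Finset.mem_univ, if_true] at e
  exact e

/-- The second moment of the overlap of two independent families of hidden units. -/
lemma integral_overlapHidden_sub_sq {c : ℝ} (hc : c < 1) (h h' : Fin p → ℝ) (q : ℝ) :
    ∫ z : (Fin p → ℝ) × (Fin p → ℝ), (overlapHidden z.1 z.2 - q) ^ 2 *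
      (hiddenWeight c h z.1 * hiddenWeight c h' z.2)
      ∂((Measure.pi fun _ : Fin p => gauss).prod (Measure.pi fun _ : Fin p => gauss)) =
    (∏ μ, tiltMass c (h μ)) * (∏ μ, tiltMass c (h' μ)) *
      (((1 / (1 - c)) ^ 2 / p * ∑ μ, h μ * h' μ - q) ^ 2 + (1 / (1 - c)) ^ 2 / p ^ 2 *
        ∑ μ, (1 / (1 - c) * h μ ^ 2 + 1 / (1 - c) * h' μ ^ 2 + 1)) := by
  set r := 1 / (1 - c) with hr
  have hdiv : ∀ y, y / (1 - c) = r * y := fun y => by rw [hr]; ring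
  have e : ∀ z : (Fin p → ℝ) × (Fin p → ℝ), (overlapHidden z.1 z.2 - q) ^ 2 *
      (hiddenWeight c h z.1 * hiddenWeight c h' z.2) =
      (1 / p) ^ 2 * (∑ μ, ∑ ν, (z.1 μ * z.1 ν * hiddenWeight c h z.1) *
        (z.2 μ * z.2 ν * hiddenWeight c h' z.2)) +
      ((-(2 * q / p)) * (∑ μ, (z.1 μ * hiddenWeight c h z.1) * (z.2 μ * hiddenWeight c h' z.2)) +
      q ^ 2 * (hiddenWeight c h z.1 * hiddenWeight c h' z.2)) := by
    intro z
    have e1 : ∑ μ, ∑ ν, (z.1 μ * z.1 ν * hiddenWeight c h z.1) *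
        (z.2 μ * z.2 ν * hiddenWeight c h' z.2) =
        (∑ μ, z.1 μ * z.2 μ) ^ 2 * (hiddenWeight c h z.1 * hiddenWeight c h' z.2) := by
      rw [sq, Finset.sum_mul_sum, Finset.sum_mul]
      refine Finset.sum_congr rfl fun μ _ => ?_
      rw [Finset.sum_mul]
      exact Finset.sum_congr rfl fun ν _ => by ring
    have e2 : ∑ μ, (z.1 μ * hiddenWeight c h z.1) * (z.2 μ * hiddenWeight c h' z.2) =
        (∑ μ, z.1 μ * z.2 μ) * (hiddenWeight c h z.1 * hiddenWeight c h' z.2) := by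
      rw [Finset.sum_mul]
      exact Finset.sum_congr rfl fun ν _ => by ring
    rw [e1, e2, overlapHidden]
    ring
  have i1 : ∀ μ ν, Integrable (fun z : (Fin p → ℝ) × (Fin p → ℝ) =>
      (z.1 μ * z.1 ν * hiddenWeight c h z.1) * (z.2 μ * z.2 ν * hiddenWeight c h' z.2))
      ((Measure.pi fun _ : Fin p => gauss).prod (Measure.pi fun _ : Fin p => gauss)) :=
    fun μ ν => (integrable_mul_mul_hiddenWeight hc h μ ν).mul_prod
      (integrable_mul_mul_hiddenWeight hc h' μ ν)
  have i2 : ∀ μ, Integrable (fun z : (Fin p → ℝ) × (Fin p → ℝ) =>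
      (z.1 μ * hiddenWeight c h z.1) * (z.2 μ * hiddenWeight c h' z.2))
      ((Measure.pi fun _ : Fin p => gauss).prod (Measure.pi fun _ : Fin p => gauss)) :=
    fun μ => (integrable_mul_hiddenWeight hc h μ).mul_prod (integrable_mul_hiddenWeight hc h' μ)
  have i3 : Integrable (fun z : (Fin p → ℝ) × (Fin p → ℝ) =>
      hiddenWeight c h z.1 * hiddenWeight c h' z.2)
      ((Measure.pi fun _ : Fin p => gauss).prod (Measure.pi fun _ : Fin p => gauss)) :=
    (integrable_hiddenWeight hc h).mul_prod (integrable_hiddenWeight hc h')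
  have j1 := integrable_finsetSum Finset.univ fun μ _ =>
    integrable_finsetSum Finset.univ fun ν _ => i1 μ ν
  have j2 := integrable_finsetSum Finset.univ fun μ _ => i2 μ
  have j23 := (j2.const_mul (-(2 * q / p))).add (i3.const_mul (q ^ 2))
  simp_rw [e]
  refine (integral_add (j1.const_mul ((1 / (p : ℝ)) ^ 2)) j23).trans ?_
  refine (congrArg₂ _ rfl (integral_add (j2.const_mul (-(2 * q / p)))
    (i3.const_mul (q ^ 2)))).trans ?_
  rw [integral_const_mul, integral_const_mul, integral_const_mul,
    integral_finsetSum _ fun μ _ => integrable_finsetSum Finset.univ fun ν _ => i1 μ ν,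
    integral_finsetSum _ fun μ _ => i2 μ]
  simp_rw [integral_finsetSum _ fun ν _ => i1 _ ν]
  -- Under the tilted measures the units are independent with means r h_μ and r h'_μ and variance r.
  -- Hence only the diagonal μ = ν adds anything to the square of the mean overlap.
  have k1 : ∀ μ ν, ∫ z : (Fin p → ℝ) × (Fin p → ℝ),
      (z.1 μ * z.1 ν * hiddenWeight c h z.1) * (z.2 μ * z.2 ν * hiddenWeight c h' z.2)
      ∂((Measure.pi fun _ : Fin p => gauss).prod (Measure.pi fun _ : Fin p => gauss)) =
      (∏ μ, tiltMass c (h μ)) * (∏ μ, tiltMass c (h' μ)) *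
      ((r ^ 2 * (h μ * h' μ)) * (r ^ 2 * (h ν * h' ν)) +
        if μ = ν then r ^ 3 * h μ ^ 2 + r ^ 3 * h' μ ^ 2 + r ^ 2 else 0) := fun μ ν => by
    rw [integral_prod_mul (fun z : Fin p → ℝ => z μ * z ν * hiddenWeight c h z)
      (fun z : Fin p → ℝ => z μ * z ν * hiddenWeight c h' z), integral_mul_mul_hiddenWeight hc,
      integral_mul_mul_hiddenWeight hc]
    simp only [hdiv, mul_one]
    split_ifs with hμν
    · subst hμν; ring
    · ring
  have k2 : ∀ μ, ∫ z : (Fin p → ℝ) × (Fin p → ℝ),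
      (z.1 μ * hiddenWeight c h z.1) * (z.2 μ * hiddenWeight c h' z.2)
      ∂((Measure.pi fun _ : Fin p => gauss).prod (Measure.pi fun _ : Fin p => gauss)) =
      (∏ μ, tiltMass c (h μ)) * (∏ μ, tiltMass c (h' μ)) * (r ^ 2 * (h μ * h' μ)) := fun μ => by
    rw [integral_prod_mul (fun z : Fin p → ℝ => z μ * hiddenWeight c h z)
      (fun z : Fin p → ℝ => z μ * hiddenWeight c h' z), integral_mul_hiddenWeight hc,
      integral_mul_hiddenWeight hc, hdiv, hdiv]
    ring
  rw [integral_prod_mul (fun z : Fin p → ℝ => hiddenWeight c h z)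
      (fun z : Fin p → ℝ => hiddenWeight c h' z), integral_hiddenWeight hc,
      integral_hiddenWeight hc]
  simp_rw [k1, k2, ← Finset.mul_sum, Finset.sum_add_distrib, ← Finset.mul_sum, ← Finset.sum_mul,
    ← Finset.mul_sum, Finset.sum_ite_eq, Finset.mem_univ, if_true, Finset.sum_add_distrib,
    ← Finset.mul_sum]
  simp only [Finset.sum_const, Finset.card_univ, Fintype.card_fin, nsmul_eq_mul]
  ring

/-! ### Gibbs averages of the generalized network -/

/-- The factor of the Boltzmann weight which does not depend on the neurons. -/
noncomputable def prefactor (β : ℝ) (d : Disorder N k p) : ℝ :=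
  Real.exp (-(β * k / 2) - β / (2 * N) * ∑ i, ∑ μ, d.ξ μ i ^ 2)

/-- Given the neurons the weight is a product over the hidden units, each with a linear field and
the quadratic tilt c = C(1-ψ). -/
lemma boltzmann_eq (β : ℝ) (P : Parameters k) (d : Disorder N k p) (σ : Config N)
    (z : Fin p → ℝ) : boltzmann β P d σ z = prefactor β d *
      Real.exp (booleanEnergy P.t P.x d σ + P.A * √(1 - P.ψ) * alignment d.η σ) *
      hiddenWeight (P.C * (1 - P.ψ))
        (fun μ => hiddenField (√P.ψ * √(β / N)) (P.B * √(1 - P.ψ)) d μ σ) z := by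
  rw [boltzmann, hiddenWeight, ← Real.exp_sum, prefactor]
  simp only [← Real.exp_add]
  congr 1
  have e1 : ∑ i, ∑ j, ∑ ν, d.ξt ν i * d.ξt ν j * spin σ i * spin σ j =
      ∑ ν, alignment (d.ξt ν) σ ^ 2 := by
    simp_rw [alignment, sq, Finset.sum_mul_sum]
    rw [Finset.sum_comm' (t' := Finset.univ) (s' := fun _ => Finset.univ) (by simp)]
    rw [Finset.sum_congr rfl fun i _ => Finset.sum_comm, Finset.sum_comm]
    refine Finset.sum_congr rfl fun ν _ => ?_
    rw [Finset.sum_comm]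
    exact Finset.sum_congr rfl fun i _ => Finset.sum_congr rfl fun j _ => by ring
  have e2 : ∑ μ, ∑ i, d.ξ μ i * spin σ i * z μ = ∑ μ, alignment (d.ξ μ) σ * z μ := by
    simp_rw [alignment, Finset.sum_mul]
  rw [e1, e2, booleanEnergy]
  simp only [hiddenField, alignment, add_mul, Finset.sum_add_distrib, Finset.mul_sum]
  have e4 : ∀ μ, P.C * (1 - P.ψ) / 2 * z μ ^ 2 = P.C * ((1 - P.ψ) / 2) * z μ ^ 2 := fun μ => by
    ring
  have e5 : ∀ μ, P.B * √(1 - P.ψ) * d.θ μ * z μ = P.B * √(1 - P.ψ) * (d.θ μ * z μ) := fun μ => by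
    ring
  simp_rw [e4, e5]
  simp only [Finset.mul_sum, Finset.sum_mul, mul_assoc]
  ring

lemma prod_tiltMass (c : ℝ) (h : Fin p → ℝ) : ∏ μ, tiltMass c (h μ) =
    √(1 / (1 - c)) ^ p * Real.exp (1 / (1 - c) / 2 * ∑ μ, h μ ^ 2) := by
  simp only [tiltMass, Finset.prod_mul_distrib, ← Real.exp_sum, Finset.prod_const,
    Finset.card_univ, Fintype.card_fin]
  congr 2
  rw [Finset.mul_sum]
  refine Finset.sum_congr rfl fun μ _ => ?_
  rw [div_mul_eq_mul_div, one_div, mul_comm 2, ← div_div]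
  ring

/-- The effective energy of the neurons of the generalized network. -/
noncomputable def paramEnergy (β : ℝ) (P : Parameters k) (d : Disorder N k p) (σ : Config N) : ℝ :=
  energy P.t P.x (√P.ψ * √(β / N)) (P.A * √(1 - P.ψ)) (P.B * √(1 - P.ψ))
    (1 / (1 - P.C * (1 - P.ψ))) d σ

lemma prefactor_pos (β : ℝ) (d : Disorder N k p) : 0 < prefactor β d := Real.exp_pos _

lemma integral_boltzmann {β : ℝ} {P : Parameters k} (hP : P.C * (1 - P.ψ) < 1)
    (d : Disorder N k p) (σ : Config N) :
    ∫ z, boltzmann β P d σ z ∂(Measure.pi fun _ : Fin p => gauss) =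
      prefactor β d * √(1 / (1 - P.C * (1 - P.ψ))) ^ p * Real.exp (paramEnergy β P d σ) := by
  simp_rw [boltzmann_eq]
  rw [integral_const_mul, integral_hiddenWeight hP, prod_tiltMass, paramEnergy, energy,
    Real.exp_add (_ + _)]
  ring

lemma generalizedPartition_eq {β : ℝ} {P : Parameters k} (hP : P.C * (1 - P.ψ) < 1)
    (d : Disorder N k p) : generalizedPartition β P d =
      prefactor β d * √(1 / (1 - P.C * (1 - P.ψ))) ^ p * gibbsSum (paramEnergy β P d) := by
  simp_rw [generalizedPartition, integral_boltzmann hP, ← Finset.mul_sum, gibbsSum]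

/-- G plays the part of the conditional expectation of F given both neuron configurations. The
prefactor and the Gaussian normalizations are the same for all configurations and cancel in the
quotient. -/
lemma replicaGibbs_eq {β : ℝ} {P : Parameters k} (hP : P.C * (1 - P.ψ) < 1)
    (d : Disorder N k p) {F : Config N → (Fin p → ℝ) → Config N → (Fin p → ℝ) → ℝ}
    {G : Config N → Config N → ℝ}
    (hF : ∀ σ τ, ∫ z : (Fin p → ℝ) × (Fin p → ℝ),
      F σ z.1 τ z.2 * (boltzmann β P d σ z.1 * boltzmann β P d τ z.2)
      ∂((Measure.pi fun _ : Fin p => gauss).prod (Measure.pi fun _ : Fin p => gauss)) =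
      (∫ z, boltzmann β P d σ z ∂(Measure.pi fun _ : Fin p => gauss)) *
      (∫ z, boltzmann β P d τ z ∂(Measure.pi fun _ : Fin p => gauss)) * G σ τ) :
    replicaGibbs β P d F = replicaAvg (paramEnergy β P d) G := by
  have h0 : 0 < 1 / (1 - P.C * (1 - P.ψ)) := by
    have : 0 < 1 - P.C * (1 - P.ψ) := by linarith
    positivity
  have hκ : prefactor β d * √(1 / (1 - P.C * (1 - P.ψ))) ^ p ≠ 0 :=
    mul_ne_zero (prefactor_pos β d).ne' (pow_ne_zero _ (Real.sqrt_pos.2 h0).ne')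
  simp_rw [replicaGibbs, hF, integral_boltzmann hP, generalizedPartition_eq hP]
  rw [replicaAvg, gibbsAvg, gibbsSum_prod, Fintype.sum_prod_type]
  rw [eq_comm, ← mul_div_mul_left _ _ (pow_ne_zero 2 hκ), eq_comm]
  congr 1
  · rw [Finset.mul_sum]
    refine Finset.sum_congr rfl fun σ _ => ?_
    rw [Finset.mul_sum]
    refine Finset.sum_congr rfl fun τ _ => ?_
    rw [Real.exp_add]
    ring
  · ring

lemma replicaGibbs_visible {β : ℝ} {P : Parameters k} (hP : P.C * (1 - P.ψ) < 1)
    (d : Disorder N k p) (G : Config N → Config N → ℝ) :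
    replicaGibbs β P d (fun σ _ τ _ => G σ τ) = replicaAvg (paramEnergy β P d) G := by
  refine replicaGibbs_eq hP d fun σ τ => ?_
  rw [integral_const_mul, integral_prod_mul (fun z => boltzmann β P d σ z)
    (fun z => boltzmann β P d τ z)]
  ring

lemma replicaGibbs_hidden {β : ℝ} {P : Parameters k} (hP : P.C * (1 - P.ψ) < 1)
    (d : Disorder N k p) (q : ℝ) {s b r : ℝ} (hs : √P.ψ * √(β / N) = s)
    (hb : P.B * √(1 - P.ψ) = b) (hr : 1 / (1 - P.C * (1 - P.ψ)) = r) :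
    replicaGibbs β P d (fun _ z _ w => (overlapHidden z w - q) ^ 2) =
      replicaAvg (paramEnergy β P d) fun σ τ => (hiddenOverlap s b r d σ τ - q) ^ 2 +
        r ^ 2 / p ^ 2 * ∑ μ, (r * hiddenField s b d μ σ ^ 2 + r * hiddenField s b d μ τ ^ 2 + 1) := by
  refine replicaGibbs_eq hP d fun σ τ => ?_
  simp_rw [boltzmann_eq, hs, hb]
  have e : ∀ a a' y y' w : ℝ,
      w * (a * y * (a' * y')) = (a * a') * (w * (y * y')) := fun a a' y y' w => by ring
  simp_rw [e]
  rw [integral_const_mul, integral_overlapHidden_sub_sq hP, integral_const_mul,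
    integral_const_mul, integral_hiddenWeight hP, integral_hiddenWeight hP, hr, hiddenOverlap]
  ring

end

/-! ### The maximal alignment of a configuration with many patterns -/

section

variable {N k p : ℕ}

lemma exp_mul_alignment (t : ℝ) (ξ : Fin N → ℝ) (σ : Config N) :
    Real.exp (t * alignment ξ σ) = ∏ i, Real.exp (t * spin σ i * ξ i) := by
  rw [alignment, Finset.mul_sum, Real.exp_sum]
  exact Finset.prod_congr rfl fun i _ => by ring_nf

lemma measurable_alignment (σ : Config N) : Measurable fun ξ : Fin N → ℝ => alignment ξ σ :=
  Finset.measurable_fun_sum _ fun i _ => (measurable_pi_apply i).mul_const _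

lemma spin_sq (σ : Config N) (i : Fin N) : spin σ i ^ 2 = 1 := by rw [sq, spin_mul_self]

/-- The sub-Gaussian parameters of independent entries add up, and multiplication by a sign does not
change them. Stated for a general law so that Gaussian and Boolean patterns are treated together. -/
lemma hasSubgaussianMGF_alignment {ρ : Measure ℝ} [IsProbabilityMeasure ρ]
    (hρ : HasSubgaussianMGF (fun x => x) 1 ρ) (σ : Config N) :
    HasSubgaussianMGF (fun ξ => alignment ξ σ) (N : NNReal) (Measure.pi fun _ : Fin N => ρ) where
  integrable_exp_mul t := by
    simp_rw [exp_mul_alignment]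
    exact Integrable.fintype_prod (f := fun i y => Real.exp (t * spin σ i * y))
      fun i => hρ.integrable_exp_mul _
  mgf_le t := by
    rw [mgf]
    simp_rw [exp_mul_alignment]
    rw [integral_fintype_prod_eq_prod (fun i y => Real.exp (t * spin σ i * y))]
    have h : ∀ i, ∫ y, Real.exp (t * spin σ i * y) ∂ρ ≤ Real.exp (t ^ 2 / 2) := fun i => by
      have := hρ.mgf_le (t * spin σ i)
      rw [mgf, mul_pow, spin_sq] at this
      simpa using this
    refine (Finset.prod_le_prod (fun i _ => integral_nonneg fun _ => (Real.exp_pos _).le)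
      fun i _ => h i).trans_eq ?_
    rw [Finset.prod_const, ← Real.exp_nat_mul]
    simp only [Finset.card_univ, Fintype.card_fin, NNReal.coe_natCast]
    ring_nf

lemma integrable_exp_alignment_sq {ρ : Measure ℝ} [IsProbabilityMeasure ρ]
    (hρ : HasSubgaussianMGF (fun x => x) 1 ρ) (hN : 0 < N) (σ : Config N) :
    Integrable (fun ξ => Real.exp (alignment ξ σ ^ 2 / (4 * N)))
      (Measure.pi fun _ : Fin N => ρ) := by
  have hm : Measurable fun ξ : Fin N → ℝ => Real.exp (alignment ξ σ ^ 2 / (4 * N)) :=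
    (((measurable_alignment σ).pow_const 2).div_const _).exp
  refine ⟨hm.aestronglyMeasurable, ?_⟩
  rw [hasFiniteIntegral_iff_ofReal (ae_of_all _ fun _ => (Real.exp_pos _).le)]
  exact (lintegral_exp_sq_le (hasSubgaussianMGF_alignment hρ σ) (measurable_alignment σ)
    (by exact_mod_cast hN)).trans_lt ENNReal.ofReal_lt_top

lemma integral_exp_alignment_sq_le {ρ : Measure ℝ} [IsProbabilityMeasure ρ]
    (hρ : HasSubgaussianMGF (fun x => x) 1 ρ) (hN : 0 < N) (σ : Config N) :
    ∫ ξ, Real.exp (alignment ξ σ ^ 2 / (4 * N)) ∂(Measure.pi fun _ : Fin N => ρ) ≤ √2 := by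
  have h := lintegral_exp_sq_le (hasSubgaussianMGF_alignment hρ σ) (measurable_alignment σ)
    (by exact_mod_cast hN)
  rw [integral_eq_lintegral_of_nonneg_ae (ae_of_all _ fun _ => (Real.exp_pos _).le)
    (integrable_exp_alignment_sq hρ hN σ).1]
  exact ENNReal.toReal_le_of_le_ofReal (Real.sqrt_nonneg 2) h

/-- A smooth upper bound of `max_σ ∑_μ (ξ^μ·σ)² / (4 N)`. -/
noncomputable def maxAlignment (ξ : Fin p → Fin N → ℝ) : ℝ :=
  logSumExp fun σ : Config N => ∑ μ, alignment (ξ μ) σ ^ 2 / (4 * N)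

lemma sum_alignment_sq_le (hN : 0 < N) (ξ : Fin p → Fin N → ℝ) (σ : Config N) :
    ∑ μ, alignment (ξ μ) σ ^ 2 ≤ 4 * N * maxAlignment ξ := by
  have h := le_logSumExp (fun σ : Config N => ∑ μ, alignment (ξ μ) σ ^ 2 / (4 * N)) σ
  have hN' : (0 : ℝ) < N := by exact_mod_cast hN
  rw [← Finset.sum_div, div_le_iff₀ (by positivity)] at h
  rw [maxAlignment]
  linarith

/-- Jensen's inequality: the mean of the exponential sum is at most a = 2^N √2^p, and log y ≤ y/a +
log a - 1 converts this into a bound on the mean logarithm. The result is linear in N + p, uniformly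
over configurations. -/
lemma integral_maxAlignment_le {ρ : Measure ℝ} [IsProbabilityMeasure ρ]
    (hρ : HasSubgaussianMGF (fun x => x) 1 ρ) (hN : 0 < N)
    (hi : Integrable (maxAlignment : (Fin p → Fin N → ℝ) → ℝ)
      (Measure.pi fun _ : Fin p => Measure.pi fun _ : Fin N => ρ)) :
    ∫ ξ, maxAlignment ξ ∂(Measure.pi fun _ : Fin p => Measure.pi fun _ : Fin N => ρ) ≤
      (N + p / 2) * Real.log 2 := by
  set Q := Measure.pi fun _ : Fin p => Measure.pi fun _ : Fin N => ρ
  have e : ∀ (ξ : Fin p → Fin N → ℝ) (σ : Config N),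
      Real.exp (∑ μ, alignment (ξ μ) σ ^ 2 / (4 * N)) =
        ∏ μ, Real.exp (alignment (ξ μ) σ ^ 2 / (4 * N)) := fun ξ σ => Real.exp_sum _ _
  have i1 : ∀ σ : Config N, Integrable (fun ξ : Fin p → Fin N → ℝ =>
      ∏ μ, Real.exp (alignment (ξ μ) σ ^ 2 / (4 * N))) Q := fun σ =>
    Integrable.fintype_prod (f := fun _ ζ => Real.exp (alignment ζ σ ^ 2 / (4 * N)))
      fun _ => integrable_exp_alignment_sq hρ hN σ
  have i2 := integrable_finsetSum Finset.univ fun σ _ => i1 σ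
  set a : ℝ := 2 ^ N * √2 ^ p with ha
  have ha0 : 0 < a := by positivity
  have hlog : Real.log a = (N + p / 2) * Real.log 2 := by
    rw [ha, Real.log_mul (by positivity) (by positivity), Real.log_pow, Real.log_pow,
      Real.log_sqrt (by norm_num)]
    ring
  have h1 : ∫ ξ, ∑ σ : Config N, ∏ μ, Real.exp (alignment (ξ μ) σ ^ 2 / (4 * N)) ∂Q ≤ a := by
    rw [integral_finsetSum _ fun σ _ => i1 σ]
    have h2 : ∀ σ : Config N, ∫ ξ, ∏ μ, Real.exp (alignment (ξ μ) σ ^ 2 / (4 * N)) ∂Q ≤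
        √2 ^ p := fun σ => by
      rw [integral_fintype_prod_eq_prod
        (fun (_ : Fin p) ζ => Real.exp (alignment ζ σ ^ 2 / (4 * N))), Finset.prod_const]
      simp only [Finset.card_univ, Fintype.card_fin]
      exact pow_le_pow_left₀ (integral_nonneg fun _ => (Real.exp_pos _).le)
        (integral_exp_alignment_sq_le hρ hN σ) p
    refine (Finset.sum_le_sum fun σ _ => h2 σ).trans_eq ?_
    simp [ha]
  have h3 : ∀ ξ : Fin p → Fin N → ℝ, maxAlignment ξ ≤
      (∑ σ : Config N, ∏ μ, Real.exp (alignment (ξ μ) σ ^ 2 / (4 * N))) / a +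
        (Real.log a - 1) := fun ξ => by
    have h0 := gibbsSum_pos fun σ : Config N => ∑ μ, alignment (ξ μ) σ ^ 2 / (4 * N)
    have h4 := Real.log_le_sub_one_of_pos (div_pos h0 ha0)
    rw [Real.log_div h0.ne' ha0.ne', gibbsSum] at h4
    simp_rw [e] at h4
    rw [maxAlignment, logSumExp, gibbsSum]
    simp_rw [e]
    linarith
  refine (integral_mono hi ((i2.div_const a).add (integrable_const _)) h3).trans ?_
  rw [integral_add' (i2.div_const a) (integrable_const _), integral_div, integral_const]
  have h5 : (∫ ξ, ∑ σ : Config N, ∏ μ, Real.exp (alignment (ξ μ) σ ^ 2 / (4 * N)) ∂Q) / a ≤ 1 :=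
    (div_le_one ha0).2 h1
  simp only [probReal_univ, one_smul]
  linarith

lemma Tame.maxAlignment_ξ :
    Tame 2 fun ω : DisorderSpace N k p => maxAlignment ω.1.2 :=
  Tame.logSumExp fun σ => Tame.sum _ fun μ => by
    simpa only [div_eq_mul_inv] using ((Tame.spinMul (Tame.ξ μ) σ).pow_two).mul_const _

lemma Tame.maxAlignment_ξt :
    Tame 2 fun ω : DisorderSpace N k p => maxAlignment ω.1.1 :=
  Tame.logSumExp fun σ => Tame.sum _ fun μ => by
    simpa only [div_eq_mul_inv] using ((Tame.spinMul (Tame.ξt μ) σ).pow_two).mul_const _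

lemma measurable_maxAlignment : Measurable (maxAlignment : (Fin p → Fin N → ℝ) → ℝ) := by
  unfold maxAlignment logSumExp gibbsSum
  refine (Finset.measurable_fun_sum _ fun σ _ => Measurable.exp <|
    Finset.measurable_fun_sum _ fun μ _ => ?_).log
  exact (((measurable_alignment σ).comp (measurable_pi_apply μ)).pow_const 2).div_const _

lemma integral_maxAlignment_ξ_le (hN : 0 < N) :
    ∫ ω, maxAlignment ω.1.2 ∂(disorderLaw N k p) ≤ (N + p / 2) * Real.log 2 := by
  have hp : MeasurePreserving (fun ω : DisorderSpace N k p => ω.1.2) (disorderLaw N k p)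
      (Measure.pi fun _ : Fin p => Measure.pi fun _ : Fin N => gauss) :=
    measurePreserving_snd.comp measurePreserving_fst
  have hi := (Tame.maxAlignment_ξ (N := N) (k := k) (p := p)).integrable (by norm_num)
  rw [integral_comp_measurePreserving hp measurable_maxAlignment.aestronglyMeasurable]
  exact integral_maxAlignment_le hasSubgaussianMGF_gauss hN
    ((hp.integrable_comp measurable_maxAlignment.aestronglyMeasurable).1 hi)

lemma integral_maxAlignment_ξt_le (hN : 0 < N) :
    ∫ ω, maxAlignment ω.1.1 ∂(disorderLaw N k p) ≤ (N + k / 2) * Real.log 2 := by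
  have hp : MeasurePreserving (fun ω : DisorderSpace N k p => ω.1.1) (disorderLaw N k p)
      (Measure.pi fun _ : Fin k => Measure.pi fun _ : Fin N => booleanLaw) :=
    measurePreserving_fst.comp measurePreserving_fst
  have hi := (Tame.maxAlignment_ξt (N := N) (k := k) (p := p)).integrable (by norm_num)
  rw [integral_comp_measurePreserving hp measurable_maxAlignment.aestronglyMeasurable]
  exact integral_maxAlignment_le hasSubgaussianMGF_booleanLaw hN
    ((hp.integrable_comp measurable_maxAlignment.aestronglyMeasurable).1 hi)

end

/-! ### The interpolating path -/

section

variable {N k p : ℕ}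

/-- The coefficient of the energy of the hidden units along the path `ψ = sin² u`. -/
noncomputable def pathVar (C u : ℝ) : ℝ := 1 / (1 - C * Real.cos u ^ 2)

/-- The energy along the path `ψ = sin² u`. -/
noncomputable def pathEnergy (β A B C : ℝ) (x : Fin k → ℝ) (u : ℝ) (d : Disorder N k p)
    (σ : Config N) : ℝ :=
  energy β x (√(β / N) * Real.sin u) (A * Real.cos u) (B * Real.cos u) (pathVar C u) d σ

/-- The overlap of the hidden units along the path `ψ = sin² u`. -/
noncomputable def pathOverlap (β B C u : ℝ) (d : Disorder N k p) (σ τ : Config N) : ℝ :=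
  hiddenOverlap (√(β / N) * Real.sin u) (B * Real.cos u) (pathVar C u) d σ τ

/-- The quenched average of a function of two replicas along the path `ψ = sin² u`. -/
noncomputable def pathAvg (β A B C : ℝ) (x : Fin k → ℝ) (u : ℝ)
    (f : Disorder N k p → Config N → Config N → ℝ) : ℝ :=
  ∫ ω, replicaAvg (pathEnergy β A B C x u (toDisorder ω)) (f (toDisorder ω)) ∂(disorderLaw N k p)

/-- The free energy along the path `ψ = sin² u`. -/
noncomputable def pathFree (N : ℕ) {k : ℕ} (p : ℕ) (β A B C : ℝ) (x : Fin k → ℝ) (u : ℝ) : ℝ :=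
  ∫ ω, logSumExp (pathEnergy β A B C x u (toDisorder ω)) ∂(disorderLaw N k p)

lemma path_denominator_pos {C : ℝ} (hC : C < 1) (u : ℝ) : 0 < 1 - C * Real.cos u ^ 2 := by
  have h1 := Real.cos_sq_le_one u
  have h2 := sq_nonneg (Real.cos u)
  rcases le_total C 0 with h | h <;> nlinarith

lemma hasDerivAt_pathVar {C : ℝ} (hC : C < 1) (u : ℝ) : HasDerivAt (pathVar C)
    (-(2 * C * (Real.sin u * Real.cos u) * pathVar C u ^ 2)) u := by
  have h := (path_denominator_pos hC u).ne'
  have h1 := ((((Real.hasDerivAt_cos u).pow 2).const_mul C).const_sub 1).fun_inv h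
  unfold pathVar
  simp_rw [one_div]
  refine h1.congr_deriv ?_
  simp only [Nat.cast_ofNat, Nat.add_one_sub_one, pow_one, Pi.pow_apply]
  field_simp

lemma contDiff_pathVar {C : ℝ} (hC : C < 1) : ContDiff ℝ 1 (pathVar C) :=
  contDiff_const.div (contDiff_const.sub (contDiff_const.mul (Real.contDiff_cos.pow 2)))
    fun u => (path_denominator_pos hC u).ne'

/-- The derivative of the interpolating free energy, up to the factor `sin u cos u`. -/
noncomputable def pathRate (N : ℕ) {k : ℕ} (p : ℕ) (β A B C : ℝ) (x : Fin k → ℝ) (u : ℝ) : ℝ :=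
  -(A ^ 2 * (N * (1 - pathAvg (N := N) (p := p) β A B C x u fun _ => overlapVisible))) -
    β * (p * pathAvg (N := N) (p := p) β A B C x u fun d σ τ =>
      overlapVisible σ τ * pathOverlap β B C u d σ τ) +
    B ^ 2 * (p * pathAvg (N := N) (p := p) β A B C x u fun d => pathOverlap β B C u d)

/-- Writing ψ = sin² u makes √ψ and √(1-ψ) smooth at both ends. The self-overlap coefficient is r²
sin u cos u (β - B² - C) = 0, and the explicit terms rp(β - B²) sin u cos u are cancelled by the
derivative of (p/2) log r. This is the reason for the choice of B and C. -/
theorem hasDerivAt_pathFree {β A B C : ℝ} (hβ : 0 < β) (hC : C < 1) (hBC : B ^ 2 + C = β)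
    (hN : 0 < N) (hp : 0 < p) (x : Fin k → ℝ) (u : ℝ) :
    HasDerivAt (fun u => pathFree N p β A B C x u + p / 2 * Real.log (pathVar C u))
      (Real.sin u * Real.cos u * pathRate N p β A B C x u) u := by
  have hN' : (0 : ℝ) < N := by exact_mod_cast hN
  have hr0 : 0 < pathVar C u := one_div_pos.2 (path_denominator_pos hC u)
  have hβN : √(β / N) ^ 2 * N = β := by
    rw [Real.sq_sqrt (by positivity), div_mul_cancel₀ _ hN'.ne']
  have h1 := hasDerivAt_integral_logSumExp_energy (N := N) (p := p)
    (s := fun u => √(β / N) * Real.sin u) (a := fun u => A * Real.cos u)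
    (b := fun u => B * Real.cos u) (contDiff_const.mul Real.contDiff_sin)
    (contDiff_const.mul Real.contDiff_cos) (contDiff_const.mul Real.contDiff_cos)
    (contDiff_pathVar hC) β x ((Real.hasDerivAt_sin u).const_mul _)
    ((Real.hasDerivAt_cos u).const_mul _) ((Real.hasDerivAt_cos u).const_mul _)
    (hasDerivAt_pathVar hC u)
  have h2 := ((hasDerivAt_pathVar hC u).log hr0.ne').const_mul (p / 2 : ℝ)
  refine (h1.add h2).congr_deriv ?_
  rw [integral_gibbsAvg_energyRate _ _ _ _ _ _ hN hp, pathRate, pathAvg, pathAvg, pathAvg]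
  unfold pathEnergy pathOverlap
  generalize ∑ μ : Fin p, ∫ ω, gibbsAvg _ (fun σ => hiddenField _ _ (toDisorder ω) μ σ ^ 2)
      ∂(disorderLaw N k p) = H
  generalize ∫ ω, replicaAvg _ overlapVisible ∂(disorderLaw N k p) = Q
  generalize ∫ ω, replicaAvg _ (fun σ τ => overlapVisible σ τ * _) ∂(disorderLaw N k p) = R
  generalize ∫ ω, replicaAvg _ (hiddenOverlap _ _ _ (toDisorder ω)) ∂(disorderLaw N k p) = P
  have e1 : √(β / N) * Real.cos u * (√(β / N) * Real.sin u) * N =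
      β * (Real.sin u * Real.cos u) := by linear_combination (Real.sin u * Real.cos u) * hβN
  have e2 : -(2 * C * (Real.sin u * Real.cos u) * pathVar C u ^ 2) / pathVar C u =
      -(2 * C * (Real.sin u * Real.cos u) * pathVar C u) := by field_simp
  rw [e1, e2, ← hBC]
  ring

lemma tame_pathEnergy (β A B C : ℝ) (x : Fin k → ℝ) (u : ℝ) (σ : Config N) :
    Tame 2 fun ω : DisorderSpace N k p => pathEnergy β A B C x u (toDisorder ω) σ :=
  Tame.energy _ _ _ _ _ _ σ

lemma tame_replicaAvg_pathEnergy {n : ℕ} (β A B C : ℝ) (x : Fin k → ℝ) (u : ℝ)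
    {f : Disorder N k p → Config N → Config N → ℝ}
    (hf : ∀ σ τ, Tame n fun ω => f (toDisorder ω) σ τ) :
    Tame n fun ω => replicaAvg (pathEnergy β A B C x u (toDisorder ω)) (f (toDisorder ω)) :=
  tame_replicaAvg (f := fun ω => f (toDisorder ω)) _ _ _ _ _ _ hf

lemma tame_pathOverlap (β B C u : ℝ) (σ τ : Config N) :
    Tame 2 fun ω : DisorderSpace N k p => pathOverlap β B C u (toDisorder ω) σ τ :=
  Tame.hiddenOverlap _ _ _ σ τ

lemma abs_overlapVisible_le (σ τ : Config N) : |overlapVisible σ τ| ≤ 1 := by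
  rw [overlapVisible, abs_mul]
  rcases Nat.eq_zero_or_pos N with rfl | hN
  · simp
  have h : |∑ i, spin σ i * spin τ i| ≤ N := (Finset.abs_sum_le_sum_abs _ _).trans
    (by simp [abs_mul])
  have hN' : (0 : ℝ) < N := by exact_mod_cast hN
  rw [abs_of_nonneg (by positivity), one_div, inv_mul_le_iff₀ hN', mul_one]
  exact h

lemma abs_replicaAvg_le {S : Type*} [Fintype S] [Nonempty S] (E : S → ℝ) {f : S → S → ℝ} {c : ℝ}
    (h : ∀ s t, |f s t| ≤ c) : |replicaAvg E f| ≤ c :=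
  abs_gibbsAvg_le _ fun w => h w.1 w.2

lemma abs_pathAvg_overlapVisible_le (β A B C : ℝ) (x : Fin k → ℝ) (u : ℝ) :
    |pathAvg (N := N) (p := p) β A B C x u fun _ => overlapVisible| ≤ 1 := by
  refine (abs_integral_le (integrable_const (1 : ℝ))
    (ae_of_all _ fun ω => abs_replicaAvg_le _ abs_overlapVisible_le)).trans ?_
  simp

/-- A bound of the overlap of the hidden units which is uniform in the configurations. -/
noncomputable def overlapBound (N p : ℕ) {k : ℕ} (β B C : ℝ) (ω : DisorderSpace N k p) : ℝ :=
  (1 / (1 - C)) ^ 2 * (8 * β * maxAlignment ω.1.2 + 2 * B ^ 2 * ∑ μ, ω.2.2 μ ^ 2)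

lemma sum_hiddenField_sq_le {β : ℝ} (hβ : 0 < β) (hN : 0 < N) (B u : ℝ) (ω : DisorderSpace N k p)
    (σ : Config N) :
    ∑ μ, hiddenField (√(β / N) * Real.sin u) (B * Real.cos u) (toDisorder ω) μ σ ^ 2 ≤
      8 * β * maxAlignment ω.1.2 + 2 * B ^ 2 * ∑ μ, ω.2.2 μ ^ 2 := by
  have hN' : (0 : ℝ) < N := by exact_mod_cast hN
  have h1 : ∀ μ, hiddenField (√(β / N) * Real.sin u) (B * Real.cos u) (toDisorder ω) μ σ ^ 2 ≤
      2 * (β / N) * alignment (ω.1.2 μ) σ ^ 2 + 2 * B ^ 2 * ω.2.2 μ ^ 2 := fun μ => by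
    have e1 : (√(β / N)) ^ 2 = β / N := Real.sq_sqrt (by positivity)
    set y := alignment (ω.1.2 μ) σ
    have e2 : hiddenField (√(β / N) * Real.sin u) (B * Real.cos u) (toDisorder ω) μ σ =
      √(β / N) * Real.sin u * y + B * Real.cos u * ω.2.2 μ := rfl
    rw [e2]
    refine (add_sq_le).trans ?_
    rw [mul_add, mul_pow, mul_pow, e1, mul_pow, mul_pow]
    have h2 : β / N * Real.sin u ^ 2 * y ^ 2 ≤ β / N * y ^ 2 := by
      have := Real.sin_sq_le_one u
      have h3 : 0 ≤ β / N := by positivity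
      exact mul_le_mul_of_nonneg_right (mul_le_of_le_one_right h3 this) (sq_nonneg _)
    have h4 : B ^ 2 * Real.cos u ^ 2 * ω.2.2 μ ^ 2 ≤ B ^ 2 * ω.2.2 μ ^ 2 :=
      mul_le_mul_of_nonneg_right (mul_le_of_le_one_right (sq_nonneg _) (Real.cos_sq_le_one u))
        (sq_nonneg _)
    linarith
  refine (Finset.sum_le_sum fun μ _ => h1 μ).trans ?_
  rw [Finset.sum_add_distrib, ← Finset.mul_sum, ← Finset.mul_sum]
  refine add_le_add ?_ le_rfl
  have h2 := sum_alignment_sq_le hN ω.1.2 σ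
  calc 2 * (β / N) * ∑ μ, alignment (ω.1.2 μ) σ ^ 2
      ≤ 2 * (β / N) * (4 * N * maxAlignment ω.1.2) := by gcongr
    _ = 8 * β * maxAlignment ω.1.2 := by field_simp; ring

lemma pathVar_le {C : ℝ} (hC0 : 0 ≤ C) (hC : C < 1) (u : ℝ) : pathVar C u ≤ 1 / (1 - C) :=
  one_div_le_one_div_of_le (by linarith) (by nlinarith [Real.cos_sq_le_one u])

lemma pathVar_pos {C : ℝ} (hC : C < 1) (u : ℝ) : 0 < pathVar C u :=
  one_div_pos.2 (path_denominator_pos hC u)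

lemma abs_pathOverlap_le {β B C : ℝ} (hβ : 0 < β) (hC0 : 0 ≤ C) (hC : C < 1) (hN : 0 < N)
    (hp : 0 < p) (u : ℝ) (ω : DisorderSpace N k p) (σ τ : Config N) :
    |p * pathOverlap β B C u (toDisorder ω) σ τ| ≤ overlapBound N p β B C ω := by
  have hp' : (p : ℝ) ≠ 0 := by positivity
  have h1 := sum_hiddenField_sq_le (B := B) hβ hN u ω σ
  have h2 := sum_hiddenField_sq_le (B := B) hβ hN u ω τ
  have hr := pathVar_pos hC u
  rw [pathOverlap, hiddenOverlap, ← mul_assoc, mul_div_cancel₀ _ hp', abs_mul,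
    abs_of_nonneg (sq_nonneg _), overlapBound]
  set f := fun μ => hiddenField (√(β / N) * Real.sin u) (B * Real.cos u) (toDisorder ω) μ
  have h3 : |∑ μ, f μ σ * f μ τ| ≤ ∑ μ, (f μ σ ^ 2 + f μ τ ^ 2) / 2 := by
    refine (Finset.abs_sum_le_sum_abs _ _).trans (Finset.sum_le_sum fun μ _ => ?_)
    rw [abs_le]
    constructor <;> nlinarith [sq_nonneg (f μ σ - f μ τ), sq_nonneg (f μ σ + f μ τ)]
  rw [← Finset.sum_div, Finset.sum_add_distrib] at h3
  have h4 : |∑ μ, f μ σ * f μ τ| ≤ 8 * β * maxAlignment ω.1.2 + 2 * B ^ 2 * ∑ μ, ω.2.2 μ ^ 2 := by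
    linarith
  exact mul_le_mul (pow_le_pow_left₀ hr.le (pathVar_le hC0 hC u) 2) h4 (abs_nonneg _)
    (sq_nonneg _)

lemma integral_sum_θ_sq : ∫ ω, ∑ μ, ω.2.2 μ ^ 2 ∂(disorderLaw N k p) = p := by
  rw [integral_finsetSum _ fun μ _ => ((Tame.θ μ).pow_two).integrable (by norm_num)]
  have h : ∀ μ : Fin p, ∫ ω, ω.2.2 μ ^ 2 ∂(disorderLaw N k p) = 1 := fun μ => by
    rw [integral_comp_measurePreserving (measurePreserving_θ μ) (f := fun y => y ^ 2)
      (by fun_prop), integral_gauss_sq]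
  simp [h]

lemma tame_overlapBound (β B C : ℝ) :
    Tame 2 (overlapBound N p (k := k) β B C) :=
  ((Tame.maxAlignment_ξ.const_mul _).add
    ((Tame.sum _ fun μ => (Tame.θ μ).pow_two).const_mul _)).const_mul _

lemma integral_overlapBound_le {β B C : ℝ} (hβ : 0 < β) (hN : 0 < N) :
    ∫ ω, overlapBound N p β B C ω ∂(disorderLaw N k p) ≤
      (1 / (1 - C)) ^ 2 * (8 * β * ((N + p / 2) * Real.log 2) + 2 * B ^ 2 * p) := by
  unfold overlapBound
  rw [integral_const_mul, integral_add
    ((Tame.maxAlignment_ξ.const_mul _).integrable (by norm_num))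
    (((Tame.sum _ fun μ => (Tame.θ μ).pow_two).const_mul _).integrable (by norm_num)),
    integral_const_mul, integral_const_mul, integral_sum_θ_sq]
  have := integral_maxAlignment_ξ_le (N := N) (k := k) (p := p) hN
  gcongr

lemma abs_mul_pathAvg_le {β A B C : ℝ} (hβ : 0 < β) (hC0 : 0 ≤ C) (hC : C < 1) (hN : 0 < N)
    (hp : 0 < p) (x : Fin k → ℝ) (u : ℝ) {f : Disorder N k p → Config N → Config N → ℝ}
    (h : ∀ d σ τ, |f d σ τ| ≤ |pathOverlap β B C u d σ τ|) :
    |p * pathAvg β A B C x u f| ≤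
      (1 / (1 - C)) ^ 2 * (8 * β * ((N + p / 2) * Real.log 2) + 2 * B ^ 2 * p) := by
  rw [pathAvg, ← integral_const_mul]
  refine (abs_integral_le ((tame_overlapBound β B C).integrable (by norm_num))
    (ae_of_all _ fun ω => ?_)).trans (integral_overlapBound_le hβ hN)
  rw [replicaAvg, ← gibbsAvg_const_mul]
  refine abs_gibbsAvg_le _ fun w => ?_
  refine le_trans ?_ (abs_pathOverlap_le hβ hC0 hC hN hp u ω w.1 w.2)
  rw [abs_mul, abs_mul]
  exact mul_le_mul_of_nonneg_left (h _ _ _) (abs_nonneg _)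

/-- The bound does not depend on u and is O(N) when p/N is bounded, so it dominates the integrand in
the passage to the limit. -/
lemma abs_pathRate_le {β A B C : ℝ} (hβ : 0 < β) (hC0 : 0 ≤ C) (hC : C < 1) (hN : 0 < N)
    (hp : 0 < p) (x : Fin k → ℝ) (u : ℝ) :
    |pathRate N p β A B C x u| ≤ 2 * A ^ 2 * N + (β + B ^ 2) *
      ((1 / (1 - C)) ^ 2 * (8 * β * ((N + p / 2) * Real.log 2) + 2 * B ^ 2 * p)) := by
  have h1 := abs_pathAvg_overlapVisible_le (N := N) (p := p) β A B C x u
  have h2 := abs_mul_pathAvg_le (A := A) (B := B) hβ hC0 hC hN hp x u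
    (f := fun d σ τ => overlapVisible σ τ * pathOverlap β B C u d σ τ) fun d σ τ => by
      rw [abs_mul]
      exact mul_le_of_le_one_left (abs_nonneg _) (abs_overlapVisible_le σ τ)
  have h3 := abs_mul_pathAvg_le (A := A) (B := B) hβ hC0 hC hN hp x u
    (f := fun d => pathOverlap β B C u d) fun d σ τ => le_rfl
  rw [pathRate]
  set M := (1 / (1 - C)) ^ 2 * (8 * β * ((N + p / 2) * Real.log 2) + 2 * B ^ 2 * p)
  set Q := pathAvg (N := N) (p := p) β A B C x u fun _ => overlapVisible
  have h4 : |A ^ 2 * (N * (1 - Q))| ≤ 2 * A ^ 2 * N := by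
    have : |1 - Q| ≤ 2 := by rw [abs_le] at h1 ⊢; constructor <;> linarith [h1.1, h1.2]
    rw [abs_mul, abs_mul, abs_of_nonneg (sq_nonneg A), Nat.abs_cast]
    calc A ^ 2 * (N * |1 - Q|) ≤ A ^ 2 * (N * 2) := by gcongr
      _ = 2 * A ^ 2 * N := by ring
  have h5 := mul_le_mul_of_nonneg_left h2 hβ.le
  have h6 := mul_le_mul_of_nonneg_left h3 (sq_nonneg B)
  rw [← abs_of_nonneg hβ.le, ← abs_mul, abs_of_nonneg hβ.le] at h5
  rw [← abs_of_nonneg (sq_nonneg B), ← abs_mul, abs_of_nonneg (sq_nonneg B)] at h6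
  refine (abs_add_le _ _).trans ?_
  refine (add_le_add ((abs_sub _ _).trans (add_le_add (abs_neg _).le le_rfl)) le_rfl).trans ?_
  linarith

theorem pathFree_sub {β A B C : ℝ} (hβ : 0 < β) (hC0 : 0 ≤ C) (hC : C < 1)
    (hBC : B ^ 2 + C = β) (hN : 0 < N) (hp : 0 < p) (x : Fin k → ℝ) :
    pathFree N p β A B C x (Real.pi / 2) - pathFree N p β A B C x 0 =
      -(p / 2 * Real.log (1 - C)) + ∫ u in (0 : ℝ)..(Real.pi / 2),
        Real.sin u * Real.cos u * pathRate N p β A B C x u := by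
  have hd := fun u => hasDerivAt_pathFree (A := A) hβ hC hBC hN hp x u
  have hi : IntervalIntegrable (fun u => Real.sin u * Real.cos u * pathRate N p β A B C x u)
      volume 0 (Real.pi / 2) := by
    have hm : Measurable fun u => Real.sin u * Real.cos u * pathRate N p β A B C x u := by
      -- Measurability of the integrand in u is obtained for free, since it is the derivative of a
      -- function.
      have := measurable_deriv fun u => pathFree N p β A B C x u + p / 2 * Real.log (pathVar C u)
      rwa [funext fun u => (hd u).deriv] at this
    refine (intervalIntegrable_const (c := 2 * A ^ 2 * N + (β + B ^ 2) *
      ((1 / (1 - C)) ^ 2 * (8 * β * ((N + p / 2) * Real.log 2) + 2 * B ^ 2 * p)))).mono_fun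
      hm.aestronglyMeasurable (ae_of_all _ fun u => ?_)
    simp only [Real.norm_eq_abs]
    rw [abs_mul, abs_mul]
    refine le_trans ?_ (le_abs_self _)
    refine le_trans (mul_le_of_le_one_left (abs_nonneg _) ?_) (abs_pathRate_le hβ hC0 hC hN hp x u)
    exact mul_le_one₀ (Real.abs_sin_le_one u) (abs_nonneg _) (Real.abs_cos_le_one u)
  rw [intervalIntegral.integral_eq_sub_of_hasDerivAt (fun u _ => hd u) hi]
  have e1 : pathVar C (Real.pi / 2) = 1 := by simp [pathVar]
  have e2 : pathVar C 0 = (1 - C)⁻¹ := by simp [pathVar]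
  rw [e1, e2, Real.log_one, Real.log_inv]
  ring

end

/-! ### Replica symmetry along the path -/

section

variable {N k p : ℕ}

lemma integrable_replicaAvg_pathEnergy {n : ℕ} (hn : n ≤ 4) (β A B C : ℝ) (x : Fin k → ℝ) (u : ℝ)
    {f : Disorder N k p → Config N → Config N → ℝ}
    (hf : ∀ σ τ, Tame n fun ω => f (toDisorder ω) σ τ) :
    Integrable (fun ω => replicaAvg (pathEnergy β A B C x u (toDisorder ω)) (f (toDisorder ω)))
      (disorderLaw N k p) :=
  (tame_replicaAvg_pathEnergy β A B C x u hf).integrable hn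

lemma sq_pathAvg_le (β A B C : ℝ) (x : Fin k → ℝ) (u : ℝ)
    {f : Disorder N k p → Config N → Config N → ℝ}
    (hf : ∀ σ τ, Tame 2 fun ω => f (toDisorder ω) σ τ) :
    pathAvg β A B C x u f ^ 2 ≤ pathAvg β A B C x u fun d σ τ => f d σ τ ^ 2 := by
  have hT := tame_replicaAvg_pathEnergy β A B C x u hf
  have hT2 := tame_replicaAvg_pathEnergy β A B C x u
    (f := fun d σ τ => f d σ τ ^ 2) fun σ τ => (hf σ τ).pow_two
  have hL : MemLp (fun ω => replicaAvg (pathEnergy β A B C x u (toDisorder ω)) (f (toDisorder ω)))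
      2 (disorderLaw N k p) :=
    (memLp_two_iff_integrable_sq hT.1.aestronglyMeasurable).2 (hT.pow_two.integrable (by norm_num))
  have h1 := sq_integral_abs_le hL
  have h2 : pathAvg β A B C x u f ^ 2 ≤ (∫ ω, |replicaAvg (pathEnergy β A B C x u (toDisorder ω))
      (f (toDisorder ω))| ∂(disorderLaw N k p)) ^ 2 := by
    rw [← sq_abs (pathAvg β A B C x u f)]
    exact pow_le_pow_left₀ (abs_nonneg _) (abs_integral_le_integral_abs) 2
  refine (h2.trans h1).trans (integral_mono (hT.pow_two.integrable (by norm_num))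
    (hT2.integrable (by norm_num)) fun ω => ?_)
  exact gibbsAvg_sq_le _ _

lemma pathAvg_sub_const (β A B C : ℝ) (x : Fin k → ℝ) (u c : ℝ)
    {f : Disorder N k p → Config N → Config N → ℝ}
    (hf : ∀ σ τ, Tame 2 fun ω => f (toDisorder ω) σ τ) :
    pathAvg β A B C x u f - c = pathAvg β A B C x u fun d σ τ => f d σ τ - c := by
  have h : ∀ ω, replicaAvg (pathEnergy β A B C x u (toDisorder ω))
      (fun σ τ => f (toDisorder ω) σ τ - c) =
      replicaAvg (pathEnergy β A B C x u (toDisorder ω)) (f (toDisorder ω)) - c := fun ω => by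
    simp only [replicaAvg]
    rw [gibbsAvg_sub, gibbsAvg_const]
  rw [pathAvg, pathAvg]
  simp_rw [h]
  rw [integral_sub (integrable_replicaAvg_pathEnergy (by norm_num) β A B C x u hf)
    (integrable_const c)]
  simp

lemma sq_pathAvg_sub_le (β A B C : ℝ) (x : Fin k → ℝ) (u c : ℝ)
    {f : Disorder N k p → Config N → Config N → ℝ}
    (hf : ∀ σ τ, Tame 2 fun ω => f (toDisorder ω) σ τ) :
    (pathAvg β A B C x u f - c) ^ 2 ≤ pathAvg β A B C x u fun d σ τ => (f d σ τ - c) ^ 2 := by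
  rw [pathAvg_sub_const β A B C x u c hf]
  exact sq_pathAvg_le β A B C x u fun σ τ => (hf σ τ).sub (Tame.const c)

lemma pathAvg_mono {n : ℕ} (hn : n ≤ 4) (β A B C : ℝ) (x : Fin k → ℝ) (u : ℝ)
    {f g : Disorder N k p → Config N → Config N → ℝ}
    (hf : ∀ σ τ, Tame n fun ω => f (toDisorder ω) σ τ)
    (hg : ∀ σ τ, Tame n fun ω => g (toDisorder ω) σ τ) (h : ∀ d σ τ, f d σ τ ≤ g d σ τ) :
    pathAvg β A B C x u f ≤ pathAvg β A B C x u g :=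
  integral_mono (integrable_replicaAvg_pathEnergy hn β A B C x u hf)
    (integrable_replicaAvg_pathEnergy hn β A B C x u hg)
    fun _ => gibbsAvg_mono _ fun w => h _ w.1 w.2

lemma paramEnergy_rsParameters (α β q pbar : ℝ) (x : Fin k → ℝ) {u : ℝ} (hs : 0 ≤ Real.sin u)
    (hc : 0 ≤ Real.cos u) (d : Disorder N k p) :
    paramEnergy β (rsParameters α β q pbar x (Real.sin u ^ 2)) d =
      pathEnergy β √(α * β * pbar) √(β * q) (β * (1 - q)) x u d := by
  ext σ
  simp only [paramEnergy, rsParameters, pathEnergy, pathVar, ← Real.cos_sq']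
  rw [Real.sqrt_sq hs, Real.sqrt_sq hc, mul_comm (Real.sin u)]

lemma rsParameters_lt_one (α : ℝ) {β q : ℝ} (pbar : ℝ) (x : Fin k → ℝ) (hC : β * (1 - q) < 1)
    (u : ℝ) : (rsParameters α β q pbar x (Real.sin u ^ 2)).C *
      (1 - (rsParameters α β q pbar x (Real.sin u ^ 2)).ψ) < 1 := by
  have := path_denominator_pos hC u
  simp only [rsParameters, ← Real.cos_sq']
  linarith

lemma quenched_visible (α : ℝ) {β q : ℝ} (pbar : ℝ) (x : Fin k → ℝ) (hC : β * (1 - q) < 1)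
    {u : ℝ} (hs : 0 ≤ Real.sin u) (hc : 0 ≤ Real.cos u)
    (G : Disorder N k p → Config N → Config N → ℝ) :
    quenched (fun d : Disorder N k p => replicaGibbs β
      (rsParameters α β q pbar x (Real.sin u ^ 2)) d fun σ _ τ _ => G d σ τ) =
      pathAvg β √(α * β * pbar) √(β * q) (β * (1 - q)) x u G := by
  rw [quenched_eq, pathAvg]
  refine integral_congr_ae (ae_of_all _ fun ω => ?_)
  beta_reduce
  rw [replicaGibbs_visible (rsParameters_lt_one α pbar x hC u),
    paramEnergy_rsParameters α β q pbar x hs hc]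

/-- Given both neuron configurations, the mean square of p₁₂ - p̄ is the square of its conditional
mean plus a conditional variance. Dropping the variance carries the hypothesis over to the overlap
of the conditional means, the quantity in the derivative. -/
lemma le_quenched_hidden (α : ℝ) {β q : ℝ} (pbar : ℝ) (x : Fin k → ℝ) (hC : β * (1 - q) < 1)
    {u : ℝ} (hs : 0 ≤ Real.sin u) (hc : 0 ≤ Real.cos u) :
    (pathAvg (N := N) (p := p) β √(α * β * pbar) √(β * q) (β * (1 - q)) x u
      fun d σ τ => (pathOverlap β √(β * q) (β * (1 - q)) u d σ τ - pbar) ^ 2) ≤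
    quenched (fun d : Disorder N k p => replicaGibbs β
      (rsParameters α β q pbar x (Real.sin u ^ 2)) d
        fun _ z _ w => (overlapHidden z w - pbar) ^ 2) := by
  rw [quenched_eq]
  have e1 : √(rsParameters α β q pbar x (Real.sin u ^ 2)).ψ * √(β / N) =
      √(β / N) * Real.sin u := by
    simp only [rsParameters]; rw [Real.sqrt_sq hs, mul_comm]
  have e2 : (rsParameters α β q pbar x (Real.sin u ^ 2)).B *
      √(1 - (rsParameters α β q pbar x (Real.sin u ^ 2)).ψ) = √(β * q) * Real.cos u := by
    simp only [rsParameters, ← Real.cos_sq']; rw [Real.sqrt_sq hc]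
  have e3 : 1 / (1 - (rsParameters α β q pbar x (Real.sin u ^ 2)).C *
      (1 - (rsParameters α β q pbar x (Real.sin u ^ 2)).ψ)) = pathVar (β * (1 - q)) u := by
    simp only [rsParameters, ← Real.cos_sq', pathVar]
  simp_rw [replicaGibbs_hidden (rsParameters_lt_one α pbar x hC u) _ pbar e1 e2 e3,
    paramEnergy_rsParameters α β q pbar x hs hc]
  have hr := pathVar_pos hC u
  have hh : ∀ σ μ, Tame 2 fun ω : DisorderSpace N k p => pathVar (β * (1 - q)) u *
      hiddenField (√(β / N) * Real.sin u) (√(β * q) * Real.cos u) (toDisorder ω) μ σ ^ 2 :=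
    fun σ μ => (Tame.hiddenField _ _ μ σ).pow_two.const_mul _
  have ho : ∀ σ τ, Tame 4 fun ω : DisorderSpace N k p =>
      (pathOverlap β √(β * q) (β * (1 - q)) u (toDisorder ω) σ τ - pbar) ^ 2 := fun σ τ =>
    ((tame_pathOverlap β √(β * q) (β * (1 - q)) u σ τ).sub (Tame.const pbar)).pow_two
  refine pathAvg_mono (g := fun d σ τ =>
    (pathOverlap β √(β * q) (β * (1 - q)) u d σ τ - pbar) ^ 2 +
      pathVar (β * (1 - q)) u ^ 2 / p ^ 2 * ∑ μ, (pathVar (β * (1 - q)) u *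
        hiddenField (√(β / N) * Real.sin u) (√(β * q) * Real.cos u) d μ σ ^ 2 +
        pathVar (β * (1 - q)) u *
        hiddenField (√(β / N) * Real.sin u) (√(β * q) * Real.cos u) d μ τ ^ 2 + 1))
    (le_refl 4) _ _ _ _ x u ho (fun σ τ => (ho σ τ).add ?_) fun d σ τ => ?_
  · exact ((Tame.sum _ fun μ => ((hh σ μ).add (hh τ μ)).add (Tame.const 1)).const_mul _).mono
      (by norm_num)
  · have : 0 ≤ ∑ μ, (pathVar (β * (1 - q)) u *
        hiddenField (√(β / N) * Real.sin u) (√(β * q) * Real.cos u) d μ σ ^ 2 +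
        pathVar (β * (1 - q)) u *
        hiddenField (√(β / N) * Real.sin u) (√(β * q) * Real.cos u) d μ τ ^ 2 + 1) :=
      Finset.sum_nonneg fun μ _ => by positivity
    have h2 : 0 ≤ pathVar (β * (1 - q)) u ^ 2 / p ^ 2 := by positivity
    nlinarith [mul_nonneg h2 this]

lemma pathAvg_overlapVisible_nonneg (hN : 0 < N) (β A B C : ℝ) (x : Fin k → ℝ) (u : ℝ) :
    0 ≤ pathAvg (N := N) (p := p) β A B C x u fun _ => overlapVisible := by
  refine integral_nonneg fun ω => ?_
  have hN' : (0 : ℝ) < N := by exact_mod_cast hN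
  have h := mul_replicaAvg_overlapVisible hN (pathEnergy β A B C x u (toDisorder ω))
  have h2 : 0 ≤ ∑ i, gibbsAvg (pathEnergy β A B C x u (toDisorder ω))
    (fun σ => spin σ i) ^ 2 := Finset.sum_nonneg fun _ _ => sq_nonneg _
  exact nonneg_of_mul_nonneg_right (h ▸ h2) hN'

/-- At u = 0 the hidden fields are Bθ_μ and do not involve the neurons, so the Gibbs average is
trivial and only E θ_μ² = 1 is used. -/
lemma pathAvg_pathOverlap_zero (hp : 0 < p) (β A B C : ℝ) (x : Fin k → ℝ) :
    (pathAvg (N := N) (p := p) β A B C x 0 fun d => pathOverlap β B C 0 d) =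
      B ^ 2 / (1 - C) ^ 2 := by
  have hp' : (p : ℝ) ≠ 0 := by positivity
  have h : ∀ ω : DisorderSpace N k p, replicaAvg (pathEnergy β A B C x 0 (toDisorder ω))
      (pathOverlap β B C 0 (toDisorder ω)) = B ^ 2 / (1 - C) ^ 2 / p * ∑ μ, ω.2.2 μ ^ 2 := by
    intro ω
    have e : pathOverlap β B C 0 (toDisorder ω) = fun _ _ : Config N =>
        B ^ 2 / (1 - C) ^ 2 / p * ∑ μ, ω.2.2 μ ^ 2 := by
      ext σ τ
      simp only [pathOverlap, hiddenOverlap, hiddenField, pathVar, Real.sin_zero, Real.cos_zero,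
        mul_zero, zero_mul, zero_add, mul_one, one_pow, toDisorder]
      have e1 : ∀ μ, B * ω.2.2 μ * (B * ω.2.2 μ) = B ^ 2 * ω.2.2 μ ^ 2 := fun μ => by ring
      simp_rw [e1, ← Finset.mul_sum]
      rw [div_pow, one_pow]
      ring
    rw [e, replicaAvg, gibbsAvg_const]
  rw [pathAvg]
  simp_rw [h]
  rw [integral_const_mul, integral_sum_θ_sq, div_mul_cancel₀ _ hp']

end

/-! ### Limits along the path -/

section

lemma tendsto_of_sq_sub_le {a b : ℕ → ℝ} {c : ℝ} (h : ∀ᶠ N in atTop, (a N - c) ^ 2 ≤ b N)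
    (hb : Tendsto b atTop (𝓝 0)) : Tendsto a atTop (𝓝 c) := by
  have h1 : Tendsto (fun N => (a N - c) ^ 2) atTop (𝓝 0) :=
    squeeze_zero' (Eventually.of_forall fun _ => sq_nonneg _) h hb
  have h2 : Tendsto (fun N => |a N - c|) atTop (𝓝 0) := by
    simpa [Real.sqrt_sq_eq_abs] using h1.sqrt
  exact tendsto_sub_nhds_zero_iff.1 (tendsto_zero_iff_abs_tendsto_zero _ |>.2 h2)

variable {α β A B C q pbar : ℝ} {k p : ℕ → ℕ} {x : (N : ℕ) → Fin (k N) → ℝ} {u : ℝ}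

lemma tendsto_pathAvg_overlapVisible
    (hQ : Tendsto (fun N => pathAvg (N := N) (p := p N) β A B C (x N) u
      fun _ σ τ => (overlapVisible σ τ - q) ^ 2) atTop (𝓝 0)) :
    Tendsto (fun N => pathAvg (N := N) (p := p N) β A B C (x N) u fun _ => overlapVisible)
      atTop (𝓝 q) :=
  tendsto_of_sq_sub_le (Eventually.of_forall fun N =>
    sq_pathAvg_sub_le β A B C (x N) u q fun _ _ => Tame.const _) hQ

lemma tendsto_pathAvg_pathOverlap
    (hP : Tendsto (fun N => pathAvg (N := N) (p := p N) β A B C (x N) u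
      fun d σ τ => (pathOverlap β B C u d σ τ - pbar) ^ 2) atTop (𝓝 0)) :
    Tendsto (fun N => pathAvg (N := N) (p := p N) β A B C (x N) u fun d => pathOverlap β B C u d)
      atTop (𝓝 pbar) :=
  tendsto_of_sq_sub_le (Eventually.of_forall fun N =>
    sq_pathAvg_sub_le β A B C (x N) u pbar fun σ τ => tame_pathOverlap β B C u σ τ) hP

/-- Since |q₁₂| ≤ 1, q₁₂(p₁₂ - p̄) tends to 0 in mean square. What is left is p̄ q₁₂. -/
lemma tendsto_pathAvg_mul_overlap
    (hQ : Tendsto (fun N => pathAvg (N := N) (p := p N) β A B C (x N) u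
      fun _ σ τ => (overlapVisible σ τ - q) ^ 2) atTop (𝓝 0))
    (hP : Tendsto (fun N => pathAvg (N := N) (p := p N) β A B C (x N) u
      fun d σ τ => (pathOverlap β B C u d σ τ - pbar) ^ 2) atTop (𝓝 0)) :
    Tendsto (fun N => pathAvg (N := N) (p := p N) β A B C (x N) u fun d σ τ =>
      overlapVisible σ τ * pathOverlap β B C u d σ τ) atTop (𝓝 (pbar * q)) := by
  have ho : ∀ N σ τ, Tame 2 fun ω : DisorderSpace N (k N) (p N) =>
      pathOverlap β B C u (toDisorder ω) σ τ - pbar := fun N σ τ =>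
    (tame_pathOverlap β B C u σ τ).sub (Tame.const pbar)
  have h1 : Tendsto (fun N => pathAvg (N := N) (p := p N) β A B C (x N) u fun d σ τ =>
      overlapVisible σ τ * (pathOverlap β B C u d σ τ - pbar)) atTop (𝓝 0) := by
    refine tendsto_of_sq_sub_le (Eventually.of_forall fun N => ?_) hP
    rw [sub_zero]
    refine (sq_pathAvg_le β A B C (x N) u fun σ τ => (ho N σ τ).const_mul _).trans ?_
    refine pathAvg_mono (le_refl 4) β A B C (x N) u
      (fun σ τ => ((ho N σ τ).const_mul _).pow_two) (fun σ τ => (ho N σ τ).pow_two)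
      fun d σ τ => ?_
    rw [mul_pow]
    refine mul_le_of_le_one_left (sq_nonneg _) ?_
    rw [sq_le_one_iff_abs_le_one]
    exact abs_overlapVisible_le σ τ
  have h2 := h1.add ((tendsto_pathAvg_overlapVisible hQ).const_mul pbar)
  rw [zero_add] at h2
  refine h2.congr fun N => ?_
  rw [pathAvg, pathAvg, pathAvg, ← integral_const_mul, ← integral_add
    (integrable_replicaAvg_pathEnergy (n := 2) (by norm_num) β A B C (x N) u
      (f := fun d σ τ => overlapVisible σ τ * (pathOverlap β B C u d σ τ - pbar))
      fun σ τ => (ho N σ τ).const_mul _)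
    ((integrable_replicaAvg_pathEnergy (n := 0) (by norm_num) β A B C (x N) u
      (f := fun _ => overlapVisible) fun σ τ => Tame.const _).const_mul _)]
  refine integral_congr_ae (ae_of_all _ fun ω => ?_)
  simp only [replicaAvg]
  rw [← gibbsAvg_const_mul, ← gibbsAvg_add]
  congr 1
  ext w
  ring

lemma tendsto_pathRate (hp : Tendsto (fun N => (p N : ℝ) / N) atTop (𝓝 α))
    (hQ : Tendsto (fun N => pathAvg (N := N) (p := p N) β A B C (x N) u
      fun _ σ τ => (overlapVisible σ τ - q) ^ 2) atTop (𝓝 0))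
    (hP : Tendsto (fun N => pathAvg (N := N) (p := p N) β A B C (x N) u
      fun d σ τ => (pathOverlap β B C u d σ τ - pbar) ^ 2) atTop (𝓝 0)) :
    Tendsto (fun N => pathRate N (p N) β A B C (x N) u / N) atTop
      (𝓝 (-(A ^ 2 * (1 - q)) - β * (α * (pbar * q)) + B ^ 2 * (α * pbar))) := by
  have h := ((((tendsto_pathAvg_overlapVisible hQ).const_sub 1).const_mul (A ^ 2)).neg.sub
    ((hp.mul (tendsto_pathAvg_mul_overlap hQ hP)).const_mul β)).add
    ((hp.mul (tendsto_pathAvg_pathOverlap hP)).const_mul (B ^ 2))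
  refine h.congr' ?_
  filter_upwards [eventually_gt_atTop 0] with N hN
  have hN' : (N : ℝ) ≠ 0 := by positivity
  rw [pathRate]
  field_simp

/-- The limit of the increment of the free energy along the path. -/
theorem tendsto_pathFree_sub (hβ : 0 < β) (hC0 : 0 ≤ C) (hC : C < 1) (hBC : B ^ 2 + C = β)
    (hp : Tendsto (fun N => (p N : ℝ) / N) atTop (𝓝 α)) (hp_pos : ∀ᶠ N in atTop, 0 < p N)
    (hQ : ∀ u ∈ Set.Ico 0 (Real.pi / 2), Tendsto (fun N => pathAvg (N := N) (p := p N)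
      β A B C (x N) u fun _ σ τ => (overlapVisible σ τ - q) ^ 2) atTop (𝓝 0))
    (hP : ∀ u ∈ Set.Ico 0 (Real.pi / 2), Tendsto (fun N => pathAvg (N := N) (p := p N)
      β A B C (x N) u fun d σ τ => (pathOverlap β B C u d σ τ - pbar) ^ 2) atTop (𝓝 0)) :
    Tendsto (fun N => (pathFree N (p N) β A B C (x N) (Real.pi / 2) -
        pathFree N (p N) β A B C (x N) 0) / N) atTop
      (𝓝 (-(α / 2 * Real.log (1 - C)) +
        (-(A ^ 2 * (1 - q)) - β * (α * (pbar * q)) + B ^ 2 * (α * pbar)) / 2)) := by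
  set L := -(A ^ 2 * (1 - q)) - β * (α * (pbar * q)) + B ^ 2 * (α * pbar) with hL
  -- The uniform bound on the rate divided by N, as a function of y = p/N. Continuity at α then
  -- gives a constant dominating function for large N.
  set g : ℝ → ℝ := fun y => 2 * A ^ 2 + (β + B ^ 2) *
    ((1 / (1 - C)) ^ 2 * (8 * β * ((1 + y / 2) * Real.log 2) + 2 * B ^ 2 * y)) with hg
  have hgc : Continuous g := by rw [hg]; fun_prop
  have hgb : ∀ᶠ N in atTop, g ((p N : ℝ) / N) ≤ g α + 1 :=
    ((hgc.tendsto α).comp hp).eventually_le_const (by linarith)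
  have hpi : (0 : ℝ) ≤ Real.pi / 2 := by positivity
  have hint : Tendsto (fun N => ∫ u in (0 : ℝ)..(Real.pi / 2),
      Real.sin u * Real.cos u * (pathRate N (p N) β A B C (x N) u / N)) atTop
      (𝓝 (∫ u in (0 : ℝ)..(Real.pi / 2), Real.sin u * Real.cos u * L)) := by
    refine intervalIntegral.tendsto_integral_filter_of_dominated_convergence
      (fun _ => g α + 1) ?_ ?_ intervalIntegrable_const ?_
    · filter_upwards [eventually_gt_atTop 0, hp_pos] with N hN hpN
      have := measurable_deriv fun u =>
        pathFree N (p N) β A B C (x N) u + p N / 2 * Real.log (pathVar C u)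
      rw [funext fun u => (hasDerivAt_pathFree (A := A) hβ hC hBC hN hpN (x N) u).deriv] at this
      simpa only [mul_div_assoc] using (this.div_const (N : ℝ)).aestronglyMeasurable
    · filter_upwards [eventually_gt_atTop 0, hp_pos, hgb] with N hN hpN hgN
      refine ae_of_all _ fun u _ => ?_
      have hN' : (0 : ℝ) < N := by exact_mod_cast hN
      rw [Real.norm_eq_abs, abs_mul, abs_mul, abs_div, Nat.abs_cast]
      refine le_trans (mul_le_of_le_one_left (by positivity)
        (mul_le_one₀ (Real.abs_sin_le_one u) (abs_nonneg _) (Real.abs_cos_le_one u))) ?_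
      refine le_trans ?_ hgN
      rw [div_le_iff₀ hN']
      refine (abs_pathRate_le hβ hC0 hC hN hpN (x N) u).trans_eq ?_
      rw [hg]
      field_simp
    -- Replica symmetry is assumed only for ψ < 1. The endpoint u = π/2 is a null set.
    · have hne : ∀ᵐ u : ℝ, u ≠ Real.pi / 2 := by simp [ae_iff]
      filter_upwards [hne] with u hu huI
      rw [Set.uIoc_of_le hpi] at huI
      have hu' : u ∈ Set.Ico 0 (Real.pi / 2) := ⟨huI.1.le, lt_of_le_of_ne huI.2 hu⟩
      exact (tendsto_pathRate hp (hQ u hu') (hP u hu')).const_mul _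
  have hval : ∫ u in (0 : ℝ)..(Real.pi / 2), Real.sin u * Real.cos u * L = L / 2 := by
    rw [intervalIntegral.integral_mul_const, integral_sin_mul_cos₁]
    simp
    ring
  rw [hval] at hint
  refine (((hp.div_const 2).mul_const (Real.log (1 - C))).neg.add hint).congr' ?_
  filter_upwards [eventually_gt_atTop 0, hp_pos] with N hN hpN
  rw [pathFree_sub hβ hC0 hC hBC hN hpN, add_div]
  congr 1
  · ring
  · rw [← intervalIntegral.integral_div]
    simp only [mul_div_assoc]

end

/-! ### The law of the disorder at one neuron -/

section

variable {N k p : ℕ}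

lemma measurePreserving_restrict_signLaw (k : ℕ) :
    MeasurePreserving (fun (s : ℕ → ℝ) (ν : Fin k) => s ν) signLaw
      (Measure.pi fun _ : Fin k => booleanLaw) := by
  have hm : Measurable fun (s : ℕ → ℝ) (ν : Fin k) => s ν :=
    measurable_pi_lambda _ fun ν => measurable_pi_apply _
  refine ⟨hm, (Measure.pi_eq fun t ht => ?_).symm⟩
  rw [Measure.map_apply hm (MeasurableSet.univ_pi ht)]
  have e : (fun (s : ℕ → ℝ) (ν : Fin k) => s ν) ⁻¹' Set.univ.pi t =
      (↑(Finset.range k) : Set ℕ).pi fun n => if h : n < k then t ⟨n, h⟩ else Set.univ := by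
    ext s
    simp only [Set.mem_preimage, Set.mem_pi, Set.mem_univ, true_implies, Finset.coe_range,
      Set.mem_Iio]
    constructor
    · intro h n hn; rw [dif_pos hn]; exact h ⟨n, hn⟩
    · intro h ν; have := h ν ν.2; rwa [dif_pos ν.2] at this
  rw [e, Measure.infinitePi_pi _ (fun n hn => by
    rw [dif_pos (Finset.mem_range.1 hn)]; exact ht _), Finset.prod_range]
  exact Finset.prod_congr rfl fun ν _ => by rw [dif_pos ν.2]

lemma measurePreserving_restrict_siteLaw (k : ℕ) :
    MeasurePreserving (fun s : (ℕ → ℝ) × ℝ => ((fun ν : Fin k => s.1 ν), s.2)) siteLaw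
      ((Measure.pi fun _ : Fin k => booleanLaw).prod gauss) :=
  (measurePreserving_restrict_signLaw k).prod (MeasurePreserving.id gauss)

lemma measurePreserving_site (i : Fin N) :
    MeasurePreserving (fun ω : DisorderSpace N k p => ((fun ν : Fin k => ω.1.1 ν i), ω.2.1 i))
      (disorderLaw N k p) ((Measure.pi fun _ : Fin k => booleanLaw).prod gauss) := by
  have h1 : MeasurePreserving (fun (ξ : Fin k → Fin N → ℝ) (ν : Fin k) => ξ ν i)
      (Measure.pi fun _ => Measure.pi fun _ => booleanLaw)
      (Measure.pi fun _ : Fin k => booleanLaw) :=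
    measurePreserving_pi _ _ fun _ => measurePreserving_eval (fun _ : Fin N => booleanLaw) i
  exact (h1.comp measurePreserving_fst).prod
    ((measurePreserving_eval (fun _ : Fin N => gauss) i).comp measurePreserving_fst)

/-- The local field of a neuron in the decoupled network. -/
noncomputable def neuronField (β A : ℝ) (m : ℕ → ℝ) (x : Fin k → ℝ) (d : Disorder N k p)
    (i : Fin N) : ℝ := ∑ ν : Fin k, (β * m ν + x ν) * d.ξt ν i + A * d.η i

/-- The magnetizations truncated to the first `k` patterns and corrected by the field `x`. -/
noncomputable def siteVector (β : ℝ) (m : Magnetizations) (x : Fin k → ℝ) : Magnetizations :=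
  ⟨fun n => if h : n < k then m n + x ⟨n, h⟩ / β else 0, memℓp_gen <|
    summable_of_ne_finset_zero (s := Finset.range k) fun n hn => by
      rw [dif_neg (by simpa using hn)]; simp⟩

lemma siteVector_apply (β : ℝ) (m : Magnetizations) (x : Fin k → ℝ) (n : ℕ) :
    siteVector β m x n = if h : n < k then m n + x ⟨n, h⟩ / β else 0 := rfl

lemma norm_siteVector_sub_sq (β : ℝ) (m : Magnetizations) (x : Fin k → ℝ) :
    ‖siteVector β m x - m‖ ^ 2 = (∑ ν, x ν ^ 2) / β ^ 2 + ∑' n, m (k + n) ^ 2 := by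
  rw [norm_sq_eq, ← (summable_sq (siteVector β m x - m)).sum_add_tsum_nat_add k]
  congr 1
  · rw [Finset.sum_range, Finset.sum_div]
    refine Finset.sum_congr rfl fun ν _ => ?_
    rw [lp.coeFn_sub, Pi.sub_apply, siteVector_apply, dif_pos ν.2]
    simp [div_pow]
  · refine tsum_congr fun n => ?_
    rw [lp.coeFn_sub, Pi.sub_apply, siteVector_apply, dif_neg (by omega), add_comm]
    simp

/-- Absorbing x/β into the magnetizations gives the finite-N local field the same form as the
limiting one, so the limit becomes continuity in m ∈ ℓ². -/
lemma effField_siteVector {β A : ℝ} (hβ : β ≠ 0) (hA : 0 ≤ A) (m : Magnetizations)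
    (x : Fin k → ℝ) (s : (ℕ → ℝ) × ℝ) : effField β (siteVector β m x) (A ^ 2) s =
      ∑ ν : Fin k, (β * m ν + x ν) * s.1 ν + A * s.2 := by
  rw [effField, Real.sqrt_sq hA, booleanField_eq_of_support _ k
    (fun ν hν => by rw [siteVector_apply, dif_neg (by omega)]), Finset.sum_range, Finset.mul_sum]
  congr 1
  refine Finset.sum_congr rfl fun ν _ => ?_
  rw [siteVector_apply, dif_pos ν.2]
  field_simp

/-- The disorder at one neuron has the law of the first k signs together with η, whatever the
neuron. Quenched means of empirical averages are therefore exactly single-site expectations, and no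
law of large numbers is needed. -/
lemma integral_comp_neuronField {β A : ℝ} (hβ : β ≠ 0) (hA : 0 ≤ A) (m : Magnetizations)
    (x : Fin k → ℝ) (i : Fin N) {g : (Fin k → ℝ) → ℝ → ℝ} (hg : Measurable g.uncurry) :
    ∫ ω, g (fun ν => ω.1.1 ν i) (neuronField β A m x (toDisorder ω) i) ∂(disorderLaw N k p) =
      ∫ s, g (fun ν => s.1 ν) (effField β (siteVector β m x) (A ^ 2) s) ∂siteLaw := by
  simp_rw [effField_siteVector hβ hA]
  have hG : Measurable fun w : (Fin k → ℝ) × ℝ =>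
      g w.1 (∑ ν : Fin k, (β * m ν + x ν) * w.1 ν + A * w.2) := by
    refine hg.comp (measurable_fst.prodMk (Measurable.add ?_ (measurable_snd.const_mul A)))
    exact Finset.measurable_fun_sum _ fun ν _ =>
      ((measurable_pi_apply ν).comp measurable_fst).const_mul _
  exact (integral_comp_measurePreserving (measurePreserving_site i) hG.aestronglyMeasurable).trans
    (integral_comp_measurePreserving (measurePreserving_restrict_siteLaw k)
      hG.aestronglyMeasurable).symm

lemma integral_abs_effField_sub_le (β : ℝ) (m h : Magnetizations) (a : ℝ) :
    ∫ s, |effField β h a s - effField β m a s| ∂siteLaw ≤ |β| * ‖h - m‖ := by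
  have e : (fun s => |effField β h a s - effField β m a s|) =ᵐ[siteLaw]
      fun s => |β| * |booleanField (h - m) s.1| := by
    filter_upwards [effField_add β m (h - m) a] with s hs
    rw [add_sub_cancel] at hs
    rw [hs, add_sub_cancel_left, abs_mul]
  rw [integral_congr_ae e, integral_const_mul]
  exact mul_le_mul_of_nonneg_left (integral_abs_booleanField_fst_le _) (abs_nonneg β)

lemma abs_integral_comp_effField_sub_le {K : ℝ} (hK : 0 ≤ K) (β : ℝ) (m h : Magnetizations)
    (a : ℝ) {w : (ℕ → ℝ) × ℝ → ℝ} (hw : ∀ᵐ s ∂siteLaw, |w s| ≤ 1) {g : ℝ → ℝ}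
    (hg : ∀ y z, |g y - g z| ≤ K * |y - z|)
    (h1 : Integrable (fun s => w s * g (effField β h a s)) siteLaw)
    (h2 : Integrable (fun s => w s * g (effField β m a s)) siteLaw) :
    |∫ s, w s * g (effField β h a s) ∂siteLaw - ∫ s, w s * g (effField β m a s) ∂siteLaw| ≤
      K * (|β| * ‖h - m‖) := by
  have hi : Integrable (fun s => K * |effField β h a s - effField β m a s|) siteLaw :=
    (((integrable_effField β h a).sub (integrable_effField β m a)).abs).const_mul K
  rw [← integral_sub h1 h2]
  refine (abs_integral_le hi ?_).trans ?_
  · filter_upwards [hw] with s hs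
    rw [← mul_sub, abs_mul]
    exact (mul_le_of_le_one_left (abs_nonneg _) hs).trans (hg _ _)
  · rw [integral_const_mul]
    exact mul_le_mul_of_nonneg_left (integral_abs_effField_sub_le β m h a) hK

lemma tendsto_integral_comp_effField {K : ℝ} (hK : 0 ≤ K) (β : ℝ) {m : Magnetizations}
    {h : ℕ → Magnetizations} (a : ℝ) (hh : Tendsto (fun N => ‖h N - m‖ ^ 2) atTop (𝓝 0))
    {w : (ℕ → ℝ) × ℝ → ℝ} (hw : ∀ᵐ s ∂siteLaw, |w s| ≤ 1) {g : ℝ → ℝ}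
    (hg : ∀ y z, |g y - g z| ≤ K * |y - z|)
    (hi : ∀ m, Integrable (fun s => w s * g (effField β m a s)) siteLaw) :
    Tendsto (fun N => ∫ s, w s * g (effField β (h N) a s) ∂siteLaw) atTop
      (𝓝 (∫ s, w s * g (effField β m a s) ∂siteLaw)) := by
  have h0 : Tendsto (fun N => ‖h N - m‖) atTop (𝓝 0) := by
    simpa [Real.sqrt_sq (norm_nonneg _)] using hh.sqrt
  rw [← tendsto_sub_nhds_zero_iff]
  refine squeeze_zero_norm (fun N =>
    abs_integral_comp_effField_sub_le hK β m (h N) a hw hg (hi _) (hi _)) ?_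
  simpa using (h0.const_mul |β|).const_mul K

lemma ae_abs_sign_siteLaw (ν : ℕ) : ∀ᵐ s ∂siteLaw, |s.1 ν| ≤ 1 := by
  filter_upwards [ae_siteLaw_of_signLaw ae_signLaw] with s hs
  rcases hs ν with h | h <;> simp [h]

lemma integrable_sign_mul_tanh (ν : ℕ) (β : ℝ) (m : Magnetizations) (a : ℝ) :
    Integrable (fun s => s.1 ν * Real.tanh (effField β m a s)) siteLaw :=
  integrable_mul_tanh ((measurePreserving_fst (μ := signLaw) (ν := gauss)).integrable_comp_of_integrable
    (integrable_sign ν)) β m a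

lemma measurePreserving_flip (ν : ℕ) : MeasurePreserving (fun (s : ℕ → ℝ) (n : ℕ) =>
    (if n = ν then (-1 : ℝ) else 1) * s n) signLaw signLaw := by
  have h : ∀ n : ℕ, booleanLaw.map (fun y => (if n = ν then (-1 : ℝ) else 1) * y) = booleanLaw := by
    intro n
    split_ifs
    · have hm : Measurable fun y : ℝ => -1 * y := measurable_const_mul _
      rw [booleanLaw, Measure.map_add _ _ hm, Measure.map_smul, Measure.map_smul,
        Measure.map_dirac' hm, Measure.map_dirac' hm, add_comm]
      simp
    · simp
  refine ⟨measurable_pi_lambda _ fun n => (measurable_pi_apply n).const_mul _, ?_⟩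
  refine (Measure.infinitePi_map_pi (fun _ => booleanLaw)
    (f := fun n y => (if n = ν then (-1 : ℝ) else 1) * y)
    (fun _ => measurable_const_mul _)).trans ?_
  simp_rw [h]

/-- When m_ν = 0 the local field ignores the sign ν, and flipping that sign preserves the law but
negates the integrand. This settles the equations for patterns absent from the network. -/
lemma integral_sign_mul_tanh_eq_zero {m : Magnetizations} {ν : ℕ} (hm : m ν = 0) (β a : ℝ) :
    ∫ s, s.1 ν * Real.tanh (effField β m a s) ∂siteLaw = 0 := by
  set T : (ℕ → ℝ) → ℕ → ℝ := fun s n => (if n = ν then (-1 : ℝ) else 1) * s n with hT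
  have hp : MeasurePreserving (fun s : (ℕ → ℝ) × ℝ => (T s.1, s.2)) siteLaw siteLaw :=
    (measurePreserving_flip ν).prod (MeasurePreserving.id gauss)
  have h1 := integral_comp_measurePreserving hp
    (integrable_sign_mul_tanh ν β m a).aestronglyMeasurable
  have h2 : ∀ s, booleanField m (T s) = booleanField m s := fun s => by
    unfold booleanField
    congr 1
    ext n
    refine Finset.sum_congr rfl fun κ _ => ?_
    by_cases h : κ = ν
    · rw [h, hm, mul_zero, mul_zero]
    · simp [hT, h]
  have h3 : ∀ s : (ℕ → ℝ) × ℝ, (T s.1, s.2).1 ν * Real.tanh (effField β m a (T s.1, s.2)) =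
      -(s.1 ν * Real.tanh (effField β m a s)) := fun s => by
    simp only [effField, h2]
    simp [hT]
  simp_rw [h3, integral_neg] at h1
  linarith

end

/-! ### The network with decoupled hidden units -/

section

variable {N k p : ℕ}

lemma mattis_eq (ξ : Fin N → ℝ) (σ : Config N) : mattis ξ σ = 1 / (N : ℝ) * alignment ξ σ := rfl

/-- The squared distance of the Mattis vector from `m`. -/
noncomputable def mattisDeviation (m : ℕ → ℝ) (d : Disorder N k p) (σ : Config N) : ℝ :=
  ∑ ν : Fin k, (mattis (d.ξt ν) σ - m ν) ^ 2

lemma mattisDeviation_nonneg (m : ℕ → ℝ) (d : Disorder N k p) (σ : Config N) :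
    0 ≤ mattisDeviation m d σ := Finset.sum_nonneg fun _ _ => sq_nonneg _

lemma tame_mattis (ν : Fin k) (σ : Config N) :
    Tame 1 fun ω : DisorderSpace N k p => mattis ((toDisorder ω).ξt ν) σ :=
  (Tame.spinMul (Tame.ξt ν) σ).const_mul _

lemma tame_mattisDeviation (m : ℕ → ℝ) (σ : Config N) :
    Tame 2 fun ω : DisorderSpace N k p => mattisDeviation m (toDisorder ω) σ :=
  Tame.sum _ fun ν => ((tame_mattis ν σ).sub (Tame.const _)).pow_two

lemma replicaAvg_fst {S : Type*} [Fintype S] [Nonempty S] (E f : S → ℝ) :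
    replicaAvg E (fun s _ => f s) = gibbsAvg E f := gibbsAvg_prod_fst E f E

/-- The part of the decoupled energy which does not depend on the neurons. -/
noncomputable def decoupledConst (β B C : ℝ) (m : ℕ → ℝ) (d : Disorder N k p) : ℝ :=
  -(β * N / 2 * ∑ ν : Fin k, m ν ^ 2) + B ^ 2 / (2 * (1 - C)) * ∑ μ, d.θ μ ^ 2

/-- Completing the square around m: with M_ν the Mattis magnetizations, M_ν² = 2 m_ν M_ν - m_ν² +
(M_ν - m_ν)². The linear part joins the external fields and the last square is the perturbation that
replica symmetry makes small. -/
lemma pathEnergy_zero (hN : 0 < N) {C : ℝ} (hC : C < 1) (β A B : ℝ) (m : ℕ → ℝ) (x : Fin k → ℝ)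
    (d : Disorder N k p) (σ : Config N) : pathEnergy β A B C x 0 d σ =
      ∑ i, neuronField β A m x d i * spin σ i + β * N / 2 * mattisDeviation m d σ +
        decoupledConst β B C m d := by
  have hN' : (N : ℝ) ≠ 0 := by positivity
  have hC' : 1 - C ≠ 0 := by linarith
  have e1 : ∑ i, neuronField β A m x d i * spin σ i =
      ∑ ν : Fin k, (β * m ν + x ν) * alignment (d.ξt ν) σ + A * alignment d.η σ := by
    simp only [neuronField, alignment, add_mul, Finset.sum_add_distrib, Finset.mul_sum,
      Finset.sum_mul]
    rw [Finset.sum_comm, Finset.sum_comm (f := fun i ν => x ν * d.ξt ν i * spin σ i)]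
    simp only [mul_assoc]
  have e2 : mattisDeviation m d σ = (∑ ν : Fin k, alignment (d.ξt ν) σ ^ 2) / N ^ 2 -
      2 / N * (∑ ν : Fin k, m ν * alignment (d.ξt ν) σ) + ∑ ν : Fin k, m ν ^ 2 := by
    rw [mattisDeviation, Finset.sum_div, Finset.mul_sum, ← Finset.sum_sub_distrib,
      ← Finset.sum_add_distrib]
    refine Finset.sum_congr rfl fun ν _ => ?_
    rw [mattis_eq]
    field_simp
    ring
  have e3 : ∑ ν : Fin k, (β * m ν + x ν) * alignment (d.ξt ν) σ =
      β * (∑ ν : Fin k, m ν * alignment (d.ξt ν) σ) + ∑ ν : Fin k, x ν * alignment (d.ξt ν) σ := by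
    rw [Finset.mul_sum, ← Finset.sum_add_distrib]
    exact Finset.sum_congr rfl fun ν _ => by ring
  have e4 : ∑ μ, hiddenField 0 B d μ σ ^ 2 = B ^ 2 * ∑ μ, d.θ μ ^ 2 := by
    rw [Finset.mul_sum]
    exact Finset.sum_congr rfl fun μ _ => by rw [hiddenField]; ring
  rw [e1, e2, e3, pathEnergy, energy, booleanEnergy, decoupledConst]
  simp only [Real.sin_zero, Real.cos_zero, mul_zero, mul_one, pathVar, one_pow]
  rw [e4]
  field_simp
  ring

lemma tame_neuronField (β A : ℝ) (m : ℕ → ℝ) (x : Fin k → ℝ) (i : Fin N) :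
    Tame 1 fun ω : DisorderSpace N k p => neuronField β A m x (toDisorder ω) i :=
  (Tame.sum _ fun ν => (Tame.ξt ν i).const_mul _).add ((Tame.η i).const_mul A)

lemma tame_log_cosh_neuronField (β A : ℝ) (m : ℕ → ℝ) (x : Fin k → ℝ) (i : Fin N) :
    Tame 1 fun ω : DisorderSpace N k p =>
      Real.log (Real.cosh (neuronField β A m x (toDisorder ω) i)) := by
  obtain ⟨hm, K, hK, hb⟩ := tame_neuronField (N := N) (k := k) (p := p) β A m x i
  exact ⟨continuous_log_cosh.measurable.comp hm, K, hK, fun ω => (abs_log_cosh_le _).trans (hb ω)⟩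

lemma tame_tanh_neuronField (β A : ℝ) (m : ℕ → ℝ) (x : Fin k → ℝ) (i : Fin N) :
    Tame 0 fun ω : DisorderSpace N k p => Real.tanh (neuronField β A m x (toDisorder ω) i) :=
  ⟨continuous_tanh.measurable.comp (tame_neuronField β A m x i).1, 1, zero_le_one, fun ω => by
    simpa using abs_tanh_le_one _⟩

lemma tame_gibbsAvg_spin (β A B C : ℝ) (x : Fin k → ℝ) (u : ℝ) (i : Fin N) :
    Tame 0 fun ω : DisorderSpace N k p =>
      gibbsAvg (pathEnergy β A B C x u (toDisorder ω)) (fun σ => spin σ i) :=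
  tame_gibbsAvg_energy _ _ _ _ _ _ fun _ => Tame.const _

lemma integral_gibbsAvg_mattisDeviation (β A B C : ℝ) (m : ℕ → ℝ) (x : Fin k → ℝ) (u : ℝ) :
    ∫ ω, gibbsAvg (pathEnergy β A B C x u (toDisorder ω)) (mattisDeviation m (toDisorder ω))
      ∂(disorderLaw N k p) = pathAvg (N := N) (p := p) β A B C x u
        fun d σ _ => mattisDeviation m d σ := by
  rw [pathAvg]
  simp_rw [replicaAvg_fst]

lemma integral_decoupledConst (β B C : ℝ) (m : ℕ → ℝ) :
    ∫ ω, decoupledConst β B C m (toDisorder ω) ∂(disorderLaw N k p) =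
      -(β * N / 2 * ∑ ν : Fin k, m ν ^ 2) + B ^ 2 / (2 * (1 - C)) * p := by
  have h : ∀ ω : DisorderSpace N k p, decoupledConst β B C m (toDisorder ω) =
      -(β * N / 2 * ∑ ν : Fin k, m ν ^ 2) + B ^ 2 / (2 * (1 - C)) * ∑ μ, ω.2.2 μ ^ 2 :=
    fun _ => rfl
  simp_rw [h]
  rw [integral_add (integrable_const _) (((Tame.sum _ fun μ => (Tame.θ μ).pow_two).const_mul
    _).integrable (by norm_num)), integral_const_mul, integral_sum_θ_sq]
  simp

theorem abs_pathFree_zero_sub_le (hN : 0 < N) {β A B C : ℝ} (hβ : 0 < β) (hA : 0 ≤ A)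
    (hC : C < 1) (m : Magnetizations) (x : Fin k → ℝ) :
    |pathFree N p β A B C x 0 - (N * Real.log 2 +
      N * logCoshMean β (siteVector β m x) (A ^ 2) +
      (-(β * N / 2 * ∑ ν : Fin k, m ν ^ 2) + B ^ 2 / (2 * (1 - C)) * p))| ≤
    β * N / 2 * pathAvg (N := N) (p := p) β A B C x 0 fun d σ _ => mattisDeviation m d σ := by
  have hV : ∀ (d : Disorder N k p) σ, 0 ≤ β * N / 2 * mattisDeviation m d σ := fun d σ =>
    mul_nonneg (by positivity) (mattisDeviation_nonneg _ d σ)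
  have h := fun ω : DisorderSpace N k p => logSumExp_perturbed (hV (toDisorder ω))
    (fun σ => pathEnergy_zero hN hC β A B m x (toDisorder ω) σ)
  have i1 : Integrable (fun ω : DisorderSpace N k p =>
      logSumExp (pathEnergy β A B C x 0 (toDisorder ω))) (disorderLaw N k p) :=
    (Tame.logSumExp fun σ => tame_pathEnergy β A B C x 0 σ).integrable (by norm_num)
  have i2 : ∀ i, Integrable (fun ω : DisorderSpace N k p =>
      Real.log (Real.cosh (neuronField β A m x (toDisorder ω) i))) (disorderLaw N k p) :=
    fun i => (tame_log_cosh_neuronField β A m x i).integrable (by norm_num)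
  have i3 : Integrable (fun ω : DisorderSpace N k p => decoupledConst β B C m (toDisorder ω))
      (disorderLaw N k p) :=
    (((Tame.const _).add ((Tame.sum _ fun μ => (Tame.θ μ).pow_two).const_mul
      _) : Tame 2 _)).integrable (by norm_num)
  have i4 : Integrable (fun ω : DisorderSpace N k p => N * Real.log 2 +
      ∑ i, Real.log (Real.cosh (neuronField β A m x (toDisorder ω) i))) (disorderLaw N k p) :=
    (integrable_const _).add (integrable_finsetSum _ fun i _ => i2 i)
  have e1 : ∫ ω, (N * Real.log 2 + ∑ i, Real.log (Real.cosh (neuronField β A m x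
      (toDisorder ω) i)) + decoupledConst β B C m (toDisorder ω)) ∂(disorderLaw N k p) =
      N * Real.log 2 + N * logCoshMean β (siteVector β m x) (A ^ 2) +
      (-(β * N / 2 * ∑ ν : Fin k, m ν ^ 2) + B ^ 2 / (2 * (1 - C)) * p) := by
    rw [integral_add i4 i3, integral_decoupledConst, integral_add (integrable_const _)
      (integrable_finsetSum _ fun i _ => i2 i), integral_finsetSum _ fun i _ => i2 i]
    have e2 : ∀ i, ∫ ω, Real.log (Real.cosh (neuronField β A m x (toDisorder ω) i))
        ∂(disorderLaw N k p) = logCoshMean β (siteVector β m x) (A ^ 2) := fun i =>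
      integral_comp_neuronField hβ.ne' hA m x i
        (g := fun _ y => Real.log (Real.cosh y)) (continuous_log_cosh.measurable.comp measurable_snd)
    simp_rw [e2]
    simp
  have i5 : Integrable (fun ω : DisorderSpace N k p => N * Real.log 2 +
      ∑ i, Real.log (Real.cosh (neuronField β A m x (toDisorder ω) i)) +
      decoupledConst β B C m (toDisorder ω)) (disorderLaw N k p) := i4.add i3
  rw [← e1, pathFree, ← integral_sub i1 i5, ← integral_gibbsAvg_mattisDeviation,
    ← integral_const_mul]
  refine abs_integral_le ?_ (ae_of_all _ fun ω => ?_)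
  · exact ((tame_gibbsAvg_energy _ _ _ _ _ _ fun σ => tame_mattisDeviation m σ).integrable
      (by norm_num)).const_mul _
  · rw [abs_of_nonneg (h ω).1, ← gibbsAvg_const_mul]
    exact (h ω).2

/-- The mean distance between the local magnetizations and their mean-field values. -/
noncomputable def magnetizationError (N : ℕ) {k : ℕ} (p : ℕ) (β A B C : ℝ) (m : ℕ → ℝ)
    (x : Fin k → ℝ) : ℝ :=
  ∫ ω, 1 / (N : ℝ) * ∑ i, |gibbsAvg (pathEnergy β A B C x 0 (toDisorder ω)) (fun σ => spin σ i) -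
    Real.tanh (neuronField β A m x (toDisorder ω) i)| ∂(disorderLaw N k p)

lemma tame_magnetizationError (β A B C : ℝ) (m : ℕ → ℝ) (x : Fin k → ℝ) :
    Tame 0 fun ω : DisorderSpace N k p => 1 / (N : ℝ) * ∑ i,
      |gibbsAvg (pathEnergy β A B C x 0 (toDisorder ω)) (fun σ => spin σ i) -
        Real.tanh (neuronField β A m x (toDisorder ω) i)| :=
  (Tame.sum _ fun i => ((tame_gibbsAvg_spin β A B C x 0 i).sub
    (tame_tanh_neuronField β A m x i)).abs).const_mul _

/-- Jensen over the disorder and Cauchy–Schwarz over the neurons reduce to the perturbation bound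
with V = (βN/2) times the Mattis deviation. The constant is 4 · β/2. -/
lemma sq_magnetizationError_le (hN : 0 < N) {β A B C : ℝ} (hβ : 0 < β) (hC : C < 1) (m : ℕ → ℝ)
    (x : Fin k → ℝ) : magnetizationError N p β A B C m x ^ 2 ≤
    2 * β * pathAvg (N := N) (p := p) β A B C x 0 fun d σ _ => mattisDeviation m d σ := by
  have hN' : (0 : ℝ) < N := by exact_mod_cast hN
  have hT := tame_magnetizationError (N := N) (p := p) β A B C m x
  have hL := (memLp_two_iff_integrable_sq hT.1.aestronglyMeasurable).2
    (hT.pow_two.integrable (by norm_num))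
  have h1 := sq_integral_abs_le hL
  have h2 : magnetizationError N p β A B C m x ^ 2 ≤ _ :=
    (pow_le_pow_left₀ (integral_nonneg fun ω => by positivity)
      ((le_abs_self _).trans abs_integral_le_integral_abs) 2).trans h1
  refine h2.trans ?_
  rw [← integral_gibbsAvg_mattisDeviation, ← integral_const_mul]
  refine integral_mono (hT.pow_two.integrable (by norm_num))
    (((tame_gibbsAvg_energy _ _ _ _ _ _ fun σ => tame_mattisDeviation m σ).integrable
      (by norm_num)).const_mul _) fun ω => ?_
  have h3 := sum_sq_magnetization_sub_tanh_le (c := decoupledConst β B C m (toDisorder ω))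
    (fun σ => mul_nonneg (by positivity) (mattisDeviation_nonneg m (toDisorder ω) σ))
    (fun σ => pathEnergy_zero hN hC β A B m x (toDisorder ω) σ)
  rw [gibbsAvg_const_mul] at h3
  have h4 := sq_sum_le_card_mul_sum_sq (s := (Finset.univ : Finset (Fin N)))
    (f := fun i => |gibbsAvg (pathEnergy β A B C x 0 (toDisorder ω)) (fun σ => spin σ i) -
        Real.tanh (neuronField β A m x (toDisorder ω) i)|)
  simp only [sq_abs, Finset.card_univ, Fintype.card_fin] at h4
  beta_reduce
  rw [mul_pow, div_pow, one_pow, one_div, inv_mul_le_iff₀ (by positivity)]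
  refine h4.trans ((mul_le_mul_of_nonneg_left h3 hN'.le).trans_eq ?_)
  ring

lemma tame_sum_tanh_sq (β A : ℝ) (m : ℕ → ℝ) (x : Fin k → ℝ) :
    Tame 0 fun ω : DisorderSpace N k p =>
      1 / (N : ℝ) * ∑ i, Real.tanh (neuronField β A m x (toDisorder ω) i) ^ 2 :=
  (Tame.sum _ fun i => (tame_tanh_neuronField β A m x i).pow_two).const_mul _

/-- The replica average of q₁₂ is the mean of ⟨σ_i⟩² over neurons. The factor 2 comes from |a² - b²|
≤ 2|a - b| for a, b in [-1, 1]. -/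
theorem abs_pathAvg_overlapVisible_sub_le (hN : 0 < N) {β A B C : ℝ} (hβ : 0 < β) (hA : 0 ≤ A)
    (m : Magnetizations) (x : Fin k → ℝ) :
    |(pathAvg (N := N) (p := p) β A B C x 0 fun _ => overlapVisible) -
      ∫ s, Real.tanh (effField β (siteVector β m x) (A ^ 2) s) ^ 2 ∂siteLaw| ≤
      2 * magnetizationError N p β A B C m x := by
  have hN' : (0 : ℝ) < N := by exact_mod_cast hN
  have e1 : ∫ ω, 1 / (N : ℝ) * ∑ i, Real.tanh (neuronField β A m x (toDisorder ω) i) ^ 2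
      ∂(disorderLaw N k p) =
      ∫ s, Real.tanh (effField β (siteVector β m x) (A ^ 2) s) ^ 2 ∂siteLaw := by
    rw [integral_const_mul, integral_finsetSum _ fun i _ =>
      (tame_tanh_neuronField β A m x i).pow_two.integrable (by norm_num)]
    have e2 : ∀ i, ∫ ω, Real.tanh (neuronField β A m x (toDisorder ω) i) ^ 2
        ∂(disorderLaw N k p) =
        ∫ s, Real.tanh (effField β (siteVector β m x) (A ^ 2) s) ^ 2 ∂siteLaw := fun i =>
      integral_comp_neuronField hβ.ne' hA m x i
        (g := fun _ y => Real.tanh y ^ 2)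
        ((continuous_tanh.measurable.pow_const 2).comp measurable_snd)
    simp_rw [e2]
    simp only [Finset.sum_const, Finset.card_univ, Fintype.card_fin, nsmul_eq_mul]
    field_simp
  rw [← e1, pathAvg, ← integral_sub (integrable_replicaAvg_pathEnergy (n := 0) (by norm_num)
    β A B C x 0 (f := fun _ => overlapVisible) fun _ _ => Tame.const _) ((tame_sum_tanh_sq β A m x).integrable (by norm_num)),
    magnetizationError, ← integral_const_mul]
  refine abs_integral_le (((tame_magnetizationError β A B C m x).integrable
    (by norm_num)).const_mul 2) (ae_of_all _ fun ω => ?_)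
  have h := mul_replicaAvg_overlapVisible hN (pathEnergy β A B C x 0 (toDisorder ω))
  set E := pathEnergy β A B C x 0 (toDisorder ω)
  have e3 : replicaAvg E overlapVisible = 1 / (N : ℝ) * ∑ i, gibbsAvg E (fun σ => spin σ i) ^ 2 := by
    rw [← h]; field_simp
  rw [e3, ← mul_sub, ← Finset.sum_sub_distrib, abs_mul, abs_of_nonneg (by positivity),
    mul_left_comm, Finset.mul_sum]
  refine mul_le_mul_of_nonneg_left ((Finset.abs_sum_le_sum_abs _ _).trans
    (Finset.sum_le_sum fun i _ => ?_)) (by positivity)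
  set a := gibbsAvg E fun σ => spin σ i
  set b := Real.tanh (neuronField β A m x (toDisorder ω) i)
  have ha : |a| ≤ 1 := abs_gibbsAvg_le _ fun σ => (abs_spin σ i).le
  have hb : |b| ≤ 1 := abs_tanh_le_one _
  rw [sq_sub_sq, abs_mul]
  exact mul_le_mul_of_nonneg_right ((abs_add_le a b).trans (by linarith)) (abs_nonneg _)

theorem abs_pathAvg_mattis_sub_le (hN : 0 < N) {β A B C : ℝ} (hβ : 0 < β) (hA : 0 ≤ A)
    (m : Magnetizations) (x : Fin k → ℝ) (ν : Fin k) :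
    |(pathAvg (N := N) (p := p) β A B C x 0 fun d σ _ => mattis (d.ξt ν) σ) -
      ∫ s, s.1 ν * Real.tanh (effField β (siteVector β m x) (A ^ 2) s) ∂siteLaw| ≤
      magnetizationError N p β A B C m x := by
  have hN' : (0 : ℝ) < N := by exact_mod_cast hN
  have t1 : ∀ i, Tame 1 fun ω : DisorderSpace N k p => ω.1.1 ν i *
      Real.tanh (neuronField β A m x (toDisorder ω) i) := fun i =>
    (Tame.ξt ν i).mul (tame_tanh_neuronField β A m x i)
  have e1 : ∫ ω, 1 / (N : ℝ) * ∑ i, ω.1.1 ν i *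
      Real.tanh (neuronField β A m x (toDisorder ω) i) ∂(disorderLaw N k p) =
      ∫ s, s.1 ν * Real.tanh (effField β (siteVector β m x) (A ^ 2) s) ∂siteLaw := by
    rw [integral_const_mul, integral_finsetSum _ fun i _ => (t1 i).integrable (by norm_num)]
    have e2 : ∀ i, ∫ ω, ω.1.1 ν i * Real.tanh (neuronField β A m x (toDisorder ω) i)
        ∂(disorderLaw N k p) =
        ∫ s, s.1 ν * Real.tanh (effField β (siteVector β m x) (A ^ 2) s) ∂siteLaw := fun i =>
      integral_comp_neuronField hβ.ne' hA m x i
        (g := fun v y => v ν * Real.tanh y)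
        (((measurable_pi_apply ν).comp measurable_fst).mul
          (continuous_tanh.measurable.comp measurable_snd))
    simp_rw [e2]
    simp only [Finset.sum_const, Finset.card_univ, Fintype.card_fin, nsmul_eq_mul]
    field_simp
  have t2 := (Tame.sum Finset.univ t1).const_mul (1 / (N : ℝ))
  rw [← e1, pathAvg, ← integral_sub (integrable_replicaAvg_pathEnergy (n := 1) (by norm_num)
    β A B C x 0 (f := fun d σ _ => mattis (d.ξt ν) σ) fun σ τ => tame_mattis ν σ)
    (t2.integrable (by norm_num)), magnetizationError]
  have hξ : ∀ᵐ ω ∂(disorderLaw N k p), ∀ i, |ω.1.1 ν i| ≤ 1 := by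
    rw [ae_all_iff]
    exact fun i => (measurePreserving_ξt ν i).quasiMeasurePreserving.ae
      (ae_booleanLaw (P := fun y => |y| ≤ 1) (by simp) (by simp))
  refine abs_integral_le ((tame_magnetizationError β A B C m x).integrable (by norm_num)) ?_
  filter_upwards [hξ] with ω hω
  rw [replicaAvg_fst]
  set E := pathEnergy β A B C x 0 (toDisorder ω)
  have e3 : gibbsAvg E (mattis ((toDisorder ω).ξt ν)) =
      1 / (N : ℝ) * ∑ i, ω.1.1 ν i * gibbsAvg E (fun σ => spin σ i) := by
    have : mattis ((toDisorder ω).ξt ν) = fun σ => 1 / (N : ℝ) * ∑ i, ω.1.1 ν i * spin σ i := rfl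
    rw [this, gibbsAvg_const_mul, gibbsAvg_sum]
    simp_rw [gibbsAvg_const_mul]
  rw [e3, ← mul_sub, ← Finset.sum_sub_distrib, abs_mul, abs_of_nonneg (by positivity)]
  refine mul_le_mul_of_nonneg_left ((Finset.abs_sum_le_sum_abs _ _).trans
    (Finset.sum_le_sum fun i _ => ?_)) (by positivity)
  rw [← mul_sub, abs_mul]
  exact mul_le_of_le_one_left (abs_nonneg _) (hω i)

lemma sq_pathAvg_mattis_sub_le (β A B C : ℝ) (m : ℕ → ℝ) (x : Fin k → ℝ) (ν : Fin k) :
    ((pathAvg (N := N) (p := p) β A B C x 0 fun d σ _ => mattis (d.ξt ν) σ) - m ν) ^ 2 ≤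
      pathAvg (N := N) (p := p) β A B C x 0 fun d σ _ => mattisDeviation m d σ := by
  have t := fun σ : Config N => tame_mattis (p := p) ν σ
  refine (sq_pathAvg_sub_le β A B C x 0 (m ν) (f := fun d σ _ => mattis (d.ξt ν) σ)
    fun σ τ => (t σ).mono (by norm_num)).trans ?_
  refine pathAvg_mono (n := 2) (by norm_num) β A B C x 0
    (fun σ τ => ((t σ).sub (Tame.const (m ν))).pow_two) (fun σ τ => tame_mattisDeviation m σ)
    fun d σ τ => ?_
  exact Finset.single_le_sum (f := fun ν : Fin k => (mattis (d.ξt ν) σ - m ν) ^ 2)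
    (fun _ _ => sq_nonneg _) (Finset.mem_univ ν)

end

/-! ### Limits for the network with decoupled hidden units -/

section

variable {α β A B C q : ℝ} {k p : ℕ → ℕ} {x : (N : ℕ) → Fin (k N) → ℝ} {m : Magnetizations}

lemma tendsto_of_tendsto_sub {a b : ℕ → ℝ} {c : ℝ} (hb : Tendsto b atTop (𝓝 c))
    (h : Tendsto (fun N => a N - b N) atTop (𝓝 0)) : Tendsto a atTop (𝓝 c) := by
  simpa using hb.add h

lemma tendsto_siteVector (hX : Tendsto (fun N => ∑ ν, x N ν ^ 2) atTop (𝓝 0))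
    (hT : Tendsto (fun N => ∑' ν, m (k N + ν) ^ 2) atTop (𝓝 0)) :
    Tendsto (fun N => ‖siteVector β m (x N) - m‖ ^ 2) atTop (𝓝 0) := by
  simp_rw [norm_siteVector_sub_sq]
  simpa using (hX.div_const (β ^ 2)).add hT

lemma tendsto_sum_sq (hT : Tendsto (fun N => ∑' ν, m (k N + ν) ^ 2) atTop (𝓝 0)) :
    Tendsto (fun N => ∑ ν : Fin (k N), m ν ^ 2) atTop (𝓝 (‖m‖ ^ 2)) := by
  have h : ∀ N, ∑ ν : Fin (k N), m ν ^ 2 = ‖m‖ ^ 2 - ∑' ν, m (k N + ν) ^ 2 := fun N => by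
    rw [norm_sq_eq, ← (summable_sq m).sum_add_tsum_nat_add (k N), Finset.sum_range]
    simp_rw [add_comm _ (k N)]
    simp
  simp_rw [h]
  simpa using hT.const_sub (‖m‖ ^ 2)

lemma tendsto_magnetizationError (hβ : 0 < β) (hC : C < 1)
    (hM : Tendsto (fun N => pathAvg (N := N) (p := p N) β A B C (x N) 0
      fun d σ _ => mattisDeviation m d σ) atTop (𝓝 0)) :
    Tendsto (fun N => magnetizationError N (p N) β A B C m (x N)) atTop (𝓝 0) := by
  refine tendsto_of_sq_sub_le ?_ (by simpa using hM.const_mul (2 * β))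
  filter_upwards [eventually_gt_atTop 0] with N hN
  rw [sub_zero]
  exact sq_magnetizationError_le hN hβ hC m (x N)

theorem tendsto_pathFree_zero (hβ : 0 < β) (hA : 0 ≤ A) (hC : C < 1)
    (hp : Tendsto (fun N => (p N : ℝ) / N) atTop (𝓝 α))
    (hX : Tendsto (fun N => ∑ ν, x N ν ^ 2) atTop (𝓝 0))
    (hT : Tendsto (fun N => ∑' ν, m (k N + ν) ^ 2) atTop (𝓝 0))
    (hM : Tendsto (fun N => pathAvg (N := N) (p := p N) β A B C (x N) 0
      fun d σ _ => mattisDeviation m d σ) atTop (𝓝 0)) :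
    Tendsto (fun N => pathFree N (p N) β A B C (x N) 0 / N) atTop
      (𝓝 (Real.log 2 + logCoshMean β m (A ^ 2) +
        (-(β / 2 * ‖m‖ ^ 2) + B ^ 2 / (2 * (1 - C)) * α))) := by
  have h1 : Tendsto (fun N => logCoshMean β (siteVector β m (x N)) (A ^ 2)) atTop
      (𝓝 (logCoshMean β m (A ^ 2))) := by
    have := tendsto_integral_comp_effField zero_le_one β (A ^ 2) (tendsto_siteVector (β := β) hX hT)
      (w := fun _ => 1) (ae_of_all _ fun _ => by simp) (g := fun y => Real.log (Real.cosh y))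
      (fun y z => by rw [one_mul]; exact abs_log_cosh_sub_le y z)
      (fun m => by simpa using integrable_log_cosh_effField β m (A ^ 2))
    simpa [logCoshMean] using this
  have h2 := (h1.const_add (Real.log 2)).add
    (((tendsto_sum_sq hT).const_mul (β / 2)).neg.add (hp.const_mul (B ^ 2 / (2 * (1 - C)))))
  refine tendsto_of_tendsto_sub h2 ?_
  refine squeeze_zero_norm' ?_ (by simpa using hM.const_mul (β / 2))
  filter_upwards [eventually_gt_atTop 0] with N hN
  have hN' : (0 : ℝ) < N := by exact_mod_cast hN
  have h3 := abs_pathFree_zero_sub_le (p := p N) (B := B) hN hβ hA hC m (x N)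
  rw [Real.norm_eq_abs]
  refine le_of_mul_le_mul_left ?_ hN'
  calc _ = |pathFree N (p N) β A B C (x N) 0 - (N * Real.log 2 +
      N * logCoshMean β (siteVector β m (x N)) (A ^ 2) +
      (-(β * N / 2 * ∑ ν : Fin (k N), m ν ^ 2) + B ^ 2 / (2 * (1 - C)) * p N))| := by
        rw [← abs_of_pos hN', ← abs_mul, abs_of_pos hN']
        congr 1
        field_simp
    _ ≤ _ := h3
    _ = _ := by ring

theorem overlap_eq_of_tendsto (hβ : 0 < β) (hA : 0 ≤ A) (hC : C < 1)
    (hX : Tendsto (fun N => ∑ ν, x N ν ^ 2) atTop (𝓝 0))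
    (hT : Tendsto (fun N => ∑' ν, m (k N + ν) ^ 2) atTop (𝓝 0))
    (hM : Tendsto (fun N => pathAvg (N := N) (p := p N) β A B C (x N) 0
      fun d σ _ => mattisDeviation m d σ) atTop (𝓝 0))
    (hQ : Tendsto (fun N => pathAvg (N := N) (p := p N) β A B C (x N) 0
      fun _ σ τ => (overlapVisible σ τ - q) ^ 2) atTop (𝓝 0)) :
    q = ∫ s, Real.tanh (effField β m (A ^ 2) s) ^ 2 ∂siteLaw := by
  have h1 : Tendsto (fun N => ∫ s, Real.tanh (effField β (siteVector β m (x N)) (A ^ 2) s) ^ 2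
      ∂siteLaw) atTop (𝓝 (∫ s, Real.tanh (effField β m (A ^ 2) s) ^ 2 ∂siteLaw)) := by
    have := tendsto_integral_comp_effField zero_le_two β (A ^ 2) (tendsto_siteVector (β := β) hX hT)
      (w := fun _ => 1) (ae_of_all _ fun _ => by simp) (g := fun y => Real.tanh y ^ 2)
      (fun y z => by
        rw [sq_sub_sq, abs_mul]
        exact mul_le_mul ((abs_add_le _ _).trans (by
          linarith [abs_tanh_le_one y, abs_tanh_le_one z])) (abs_tanh_sub_le y z) (abs_nonneg _)
          zero_le_two)
      (fun m => by simpa using integrable_tanh_sq β m (A ^ 2))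
    simpa using this
  refine tendsto_nhds_unique (tendsto_pathAvg_overlapVisible hQ) (tendsto_of_tendsto_sub h1 ?_)
  refine squeeze_zero_norm' ?_
    (by simpa using (tendsto_magnetizationError (m := m) hβ hC hM).const_mul 2)
  filter_upwards [eventually_gt_atTop 0] with N hN
  exact abs_pathAvg_overlapVisible_sub_le hN hβ hA m (x N)

theorem magnetization_eq_of_tendsto (hβ : 0 < β) (hA : 0 ≤ A) (hC : C < 1)
    (hX : Tendsto (fun N => ∑ ν, x N ν ^ 2) atTop (𝓝 0))
    (hT : Tendsto (fun N => ∑' ν, m (k N + ν) ^ 2) atTop (𝓝 0))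
    (hM : Tendsto (fun N => pathAvg (N := N) (p := p N) β A B C (x N) 0
      fun d σ _ => mattisDeviation m d σ) atTop (𝓝 0)) (ν : ℕ) :
    m ν = ∫ s, s.1 ν * Real.tanh (effField β m (A ^ 2) s) ∂siteLaw := by
  -- The number of patterns need not tend to infinity, so the pattern ν may be eventually absent;
  -- then the tail condition forces m_ν = 0. Otherwise it is present for infinitely many N, which is
  -- enough to identify a constant.
  by_cases hν : ∀ᶠ N in atTop, k N ≤ ν
  · have h0 : m ν ^ 2 ≤ 0 := by
      refine ge_of_tendsto hT ?_
      filter_upwards [hν] with N hN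
      have hs : Summable fun n => m (k N + n) ^ 2 :=
        (summable_sq m).comp_injective (add_right_injective (k N))
      have := hs.le_tsum (ν - k N) fun _ _ => sq_nonneg _
      rwa [Nat.add_sub_cancel' hN] at this
    have h1 : m ν = 0 := by nlinarith
    rw [integral_sign_mul_tanh_eq_zero h1, h1]
  · have hf : ∃ᶠ N in atTop, ν < k N := by
      simpa [Filter.Frequently, not_lt] using hν
    have h1 := tendsto_integral_comp_effField zero_le_one β (A ^ 2) (tendsto_siteVector (β := β) hX hT)
      (ae_abs_sign_siteLaw ν) (g := Real.tanh)
      (fun y z => by rw [one_mul]; exact abs_tanh_sub_le y z)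
      (fun m => integrable_sign_mul_tanh ν β m (A ^ 2))
    have h2 : Tendsto (fun N => magnetizationError N (p N) β A B C m (x N) +
        √(pathAvg (N := N) (p := p N) β A B C (x N) 0 fun d σ _ => mattisDeviation m d σ))
        atTop (𝓝 0) := by
      simpa using (tendsto_magnetizationError (m := m) hβ hC hM).add hM.sqrt
    have h3 := h2.sub (((h1.const_sub (m ν))).abs)
    have h4 : |m ν - ∫ s, s.1 ν * Real.tanh (effField β m (A ^ 2) s) ∂siteLaw| ≤ 0 := by
      -- A nonzero defect would exceed the error terms for all large N, contradicting the finite-N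
      -- estimate at one such N with ν < k N.
      by_contra! hpos
      have h5 := h3.eventually_lt_const (u := 0) (by linarith)
      obtain ⟨N, ⟨hN1, hN2⟩, hN3⟩ := ((hf.and_eventually h5).and_eventually
        (eventually_gt_atTop 0)).exists
      have h6 := abs_pathAvg_mattis_sub_le (p := p N) (B := B) (C := C) hN3 hβ hA m (x N) ⟨ν, hN1⟩
      have h7 := Real.abs_le_sqrt (sq_pathAvg_mattis_sub_le (N := N) (p := p N) β A B C m (x N) ⟨ν, hN1⟩)
      rw [abs_le] at h6 h7
      have h8 : |m ν - ∫ s, s.1 ν * Real.tanh (effField β (siteVector β m (x N)) (A ^ 2) s)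
          ∂siteLaw| ≤ magnetizationError N (p N) β A B C m (x N) +
        √(pathAvg (N := N) (p := p N) β A B C (x N) 0 fun d σ _ => mattisDeviation m d σ) := by
        rw [abs_le]
        constructor <;> linarith [h6.1, h6.2, h7.1, h7.2]
      linarith
    exact sub_eq_zero.1 (abs_nonpos_iff.1 h4)

end

/-! ### The free energy of the mixed Hebbian network -/

section

variable {N k p : ℕ}

lemma alignment_sq_eq (ξ : Fin N → ℝ) (σ : Config N) : alignment ξ σ ^ 2 =
    2 * ∑ i, ∑ j ∈ Finset.Ioi i, ξ i * ξ j * (spin σ i * spin σ j) + ∑ i, ξ i ^ 2 := by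
  have h : ∀ i, ∑ j, ξ i * ξ j * (spin σ i * spin σ j) =
      ∑ j ∈ Finset.Ioi i, ξ i * ξ j * (spin σ i * spin σ j) +
      (ξ i ^ 2 + ∑ j ∈ Finset.Iio i, ξ i * ξ j * (spin σ i * spin σ j)) := fun i => by
    rw [← Finset.sum_filter_add_sum_filter_not Finset.univ (fun j => i < j)]
    congr 1
    · exact Finset.sum_congr (by ext; simp) fun _ _ => rfl
    · have e : Finset.univ.filter (fun j => ¬ i < j) = insert i (Finset.Iio i) := by
        ext j; simp [le_iff_eq_or_lt]
      rw [e, Finset.sum_insert (by simp), spin_mul_self]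
      ring
  have e1 : alignment ξ σ ^ 2 = ∑ i, ∑ j, ξ i * ξ j * (spin σ i * spin σ j) := by
    rw [alignment, sq, Finset.sum_mul_sum]
    exact Finset.sum_congr rfl fun _ _ => Finset.sum_congr rfl fun _ _ => by ring
  have e2 : ∑ i, ∑ j ∈ Finset.Iio i, ξ i * ξ j * (spin σ i * spin σ j) =
      ∑ i, ∑ j ∈ Finset.Ioi i, ξ i * ξ j * (spin σ i * spin σ j) := by
    rw [Finset.sum_comm' (t' := Finset.univ) (s' := fun j => Finset.Ioi j) (by simp)]
    exact Finset.sum_congr rfl fun _ _ => Finset.sum_congr rfl fun _ _ => by ring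
  rw [e1, Finset.sum_congr rfl fun i _ => h i, Finset.sum_add_distrib, Finset.sum_add_distrib, e2]
  ring

/-- The diagonal part of the energy. -/
noncomputable def diagonalEnergy (β : ℝ) (ω : DisorderSpace N k p) : ℝ :=
  β / (2 * N) * (∑ ν, ∑ i, ω.1.1 ν i ^ 2 + ∑ μ, ∑ i, ω.1.2 μ i ^ 2)

/-- At ψ = 1 the auxiliary fields vanish and r = 1. The squared alignments contain each pair i < j
twice, and diagonal terms i = j which are absent from the Hamiltonian and do not depend on the
spins. -/
lemma pathEnergy_pi_div_two (hN : 0 < N) {β : ℝ} (hβ : 0 < β) (A B C : ℝ)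
    (ω : DisorderSpace N k p) (σ : Config N) :
    pathEnergy β A B C (0 : Fin k → ℝ) (Real.pi / 2) (toDisorder ω) σ =
      -β * hamiltonian ω.1.1 ω.1.2 σ + diagonalEnergy β ω := by
  have hN' : (0 : ℝ) < N := by exact_mod_cast hN
  have e0 : √(β / N) ^ 2 = β / N := Real.sq_sqrt (by positivity)
  have e1 : ∑ μ, hiddenField √(β / N) 0 (toDisorder ω) μ σ ^ 2 =
      β / N * ∑ μ, alignment (ω.1.2 μ) σ ^ 2 := by
    rw [Finset.mul_sum]
    refine Finset.sum_congr rfl fun μ _ => ?_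
    rw [hiddenField, zero_mul, add_zero, mul_pow, e0]
    rfl
  have e2 : hamiltonian ω.1.1 ω.1.2 σ = -(1 / (N : ℝ)) *
      (∑ ν, ∑ i, ∑ j ∈ Finset.Ioi i, ω.1.1 ν i * ω.1.1 ν j * (spin σ i * spin σ j) +
        ∑ μ, ∑ i, ∑ j ∈ Finset.Ioi i, ω.1.2 μ i * ω.1.2 μ j * (spin σ i * spin σ j)) := by
    rw [hamiltonian]
    congr 1
    simp only [add_mul, Finset.sum_mul, Finset.sum_add_distrib]
    congr 1
    · rw [Finset.sum_comm]
      exact Finset.sum_congr rfl fun i _ => Finset.sum_comm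
    · rw [Finset.sum_comm]
      exact Finset.sum_congr rfl fun i _ => Finset.sum_comm
  have e3 : booleanEnergy β (0 : Fin k → ℝ) (toDisorder ω) σ =
      β / (2 * N) * ∑ ν, alignment (ω.1.1 ν) σ ^ 2 := by
    simp [booleanEnergy, toDisorder]
  rw [pathEnergy, energy, e2, e3, diagonalEnergy]
  simp only [Real.sin_pi_div_two, Real.cos_pi_div_two, mul_one, mul_zero, pathVar]
  rw [e1]
  simp_rw [alignment_sq_eq, Finset.sum_add_distrib, ← Finset.mul_sum]
  field_simp
  ring

lemma tame_diagonalEnergy (β : ℝ) : Tame 2 (diagonalEnergy (N := N) (k := k) (p := p) β) :=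
  ((Tame.sum _ fun ν => Tame.sum _ fun i => (Tame.ξt ν i).pow_two).add
    (Tame.sum _ fun ν => Tame.sum _ fun i => (Tame.ξ ν i).pow_two)).const_mul _

lemma integral_diagonalEnergy (hN : 0 < N) (β : ℝ) :
    ∫ ω, diagonalEnergy β ω ∂(disorderLaw N k p) = β / 2 * (k + p) := by
  have hN' : (N : ℝ) ≠ 0 := by positivity
  have i1 : ∀ (ν : Fin k) (i : Fin N), Integrable (fun ω : DisorderSpace N k p => ω.1.1 ν i ^ 2)
    (disorderLaw N k p) := fun ν i => (Tame.ξt ν i).pow_two.integrable (by norm_num)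
  have i2 : ∀ (ν : Fin p) (i : Fin N), Integrable (fun ω : DisorderSpace N k p => ω.1.2 ν i ^ 2)
    (disorderLaw N k p) := fun ν i => (Tame.ξ ν i).pow_two.integrable (by norm_num)
  have j1 := fun ν : Fin k => integrable_finsetSum Finset.univ fun i _ => i1 ν i
  have j2 := fun ν : Fin p => integrable_finsetSum Finset.univ fun i _ => i2 ν i
  have h1 : ∀ (ν : Fin k) (i : Fin N), ∫ ω, ω.1.1 ν i ^ 2 ∂(disorderLaw N k p) = 1 :=
    fun ν i => by
      rw [integral_comp_measurePreserving (measurePreserving_ξt ν i) (f := fun y => y ^ 2)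
        (by fun_prop), integral_booleanLaw]
      norm_num
  have h2 : ∀ (ν : Fin p) (i : Fin N), ∫ ω, ω.1.2 ν i ^ 2 ∂(disorderLaw N k p) = 1 :=
    fun ν i => by
      rw [integral_comp_measurePreserving (measurePreserving_ξ ν i) (f := fun y => y ^ 2)
        (by fun_prop), integral_gauss_sq]
  unfold diagonalEnergy
  rw [integral_const_mul, integral_add (integrable_finsetSum _ fun ν _ => j1 ν)
    (integrable_finsetSum _ fun ν _ => j2 ν), integral_finsetSum _ fun ν _ => j1 ν,
    integral_finsetSum _ fun ν _ => j2 ν]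
  simp_rw [fun ν => integral_finsetSum Finset.univ fun i _ => i1 ν i,
    fun ν => integral_finsetSum Finset.univ fun i _ => i2 ν i, h1, h2]
  simp only [Finset.sum_const, Finset.card_univ, Fintype.card_fin, nsmul_eq_mul, mul_one]
  field_simp

lemma measurable_log_partitionFunction (β : ℝ) :
    Measurable fun ω : (Fin k → Fin N → ℝ) × (Fin p → Fin N → ℝ) =>
      Real.log (partitionFunction β ω.1 ω.2) := by
  have h1 : ∀ (ν : Fin k) (i : Fin N),
      Measurable fun ω : (Fin k → Fin N → ℝ) × (Fin p → Fin N → ℝ) => ω.1 ν i := fun ν i =>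
    (measurable_pi_apply i).comp ((measurable_pi_apply ν).comp measurable_fst)
  have h2 : ∀ (μ : Fin p) (i : Fin N),
      Measurable fun ω : (Fin k → Fin N → ℝ) × (Fin p → Fin N → ℝ) => ω.2 μ i := fun μ i =>
    (measurable_pi_apply i).comp ((measurable_pi_apply μ).comp measurable_snd)
  unfold partitionFunction hamiltonian
  refine (Finset.measurable_fun_sum _ fun σ _ => Measurable.exp <| Measurable.const_mul
    (Measurable.const_mul (Finset.measurable_fun_sum _ fun i _ => Finset.measurable_fun_sum _
      fun j _ => Measurable.mul_const (Measurable.add ?_ ?_) _) _) _).log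
  · exact Finset.measurable_fun_sum _ fun ν _ => (h1 ν i).mul (h1 ν j)
  · exact Finset.measurable_fun_sum _ fun μ _ => (h2 μ i).mul (h2 μ j)

/-- All pattern entries have second moment 1, so the diagonal terms have mean β(k+p)/2. After
division by N they produce the constant -αβ/2 of the trial free energy. -/
theorem freeEnergy_eq (hN : 0 < N) {β : ℝ} (hβ : 0 < β) (A B C : ℝ) :
    freeEnergy N k p β =
      (pathFree N p β A B C (0 : Fin k → ℝ) (Real.pi / 2) - β / 2 * (k + p)) / N := by
  have hlog : ∀ ω : DisorderSpace N k p, Real.log (partitionFunction β ω.1.1 ω.1.2) =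
      logSumExp (pathEnergy β A B C (0 : Fin k → ℝ) (Real.pi / 2) (toDisorder ω)) -
        diagonalEnergy β ω := fun ω => by
    rw [funext fun σ => pathEnergy_pi_div_two hN hβ A B C ω σ, logSumExp_add_const,
      add_sub_cancel_right]
    rfl
  have h1 : ∫ ω, Real.log (partitionFunction β ω.1.1 ω.1.2) ∂(disorderLaw N k p) =
      ∫ ω, Real.log (partitionFunction β ω.1 ω.2) ∂(patternLaw N k p) :=
    integral_comp_measurePreserving measurePreserving_fst
      (measurable_log_partitionFunction β).aestronglyMeasurable
  rw [freeEnergy, ← h1]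
  simp_rw [hlog]
  rw [integral_sub ((Tame.logSumExp fun σ => tame_pathEnergy β A B C 0 _ σ).integrable
    (by norm_num)) ((tame_diagonalEnergy β).integrable (by norm_num)),
    integral_diagonalEnergy hN, pathFree]
  ring

/-- The effect of a field on the Boolean patterns on the free energy. -/
theorem abs_pathFree_sub_le (hN : 0 < N) (β A B C u : ℝ) (x : Fin k → ℝ) :
    |pathFree N p β A B C x u - pathFree N p β A B C (0 : Fin k → ℝ) u| ≤
      √(∑ ν, x ν ^ 2) * (N / 2 + 2 * ((N + k / 2) * Real.log 2)) := by
  have hN' : (0 : ℝ) < N := by exact_mod_cast hN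
  have i1 : ∀ y : Fin k → ℝ, Integrable (fun ω : DisorderSpace N k p =>
      logSumExp (pathEnergy β A B C y u (toDisorder ω))) (disorderLaw N k p) := fun y =>
    (Tame.logSumExp fun σ => tame_pathEnergy β A B C y u σ).integrable (by norm_num)
  have i2 : Integrable (fun ω : DisorderSpace N k p => maxAlignment ω.1.1) (disorderLaw N k p) :=
    Tame.maxAlignment_ξt.integrable (by norm_num)
  set X := ∑ ν, x ν ^ 2 with hX
  have hb : ∀ (ω : DisorderSpace N k p) σ, |pathEnergy β A B C x u (toDisorder ω) σ -
      pathEnergy β A B C 0 u (toDisorder ω) σ| ≤ √X * (N / 2 + 2 * maxAlignment ω.1.1) := by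
    intro ω σ
    have e1 : pathEnergy β A B C x u (toDisorder ω) σ -
        pathEnergy β A B C 0 u (toDisorder ω) σ = ∑ ν, x ν * alignment (ω.1.1 ν) σ := by
      simp only [pathEnergy, energy, booleanEnergy, Pi.zero_apply, zero_mul, Finset.sum_const_zero,
        toDisorder]
      ring
    set S := ∑ ν, alignment (ω.1.1 ν) σ ^ 2 with hS
    have hS0 : 0 ≤ S := Finset.sum_nonneg fun _ _ => sq_nonneg _
    have h1 : |∑ ν, x ν * alignment (ω.1.1 ν) σ| ≤ √X * √S := by
      rw [← Real.sqrt_mul (Finset.sum_nonneg fun _ _ => sq_nonneg _)]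
      exact Real.abs_le_sqrt (Finset.sum_mul_sq_le_sq_mul_sq _ _ _)
    have h2 := sum_alignment_sq_le hN ω.1.1 σ
    -- Scaled so that both terms are O(N): S is at most 4N times the maximal alignment, whose mean
    -- is O(N + k).
    have h3 : √S ≤ N / 2 + S / (2 * N) := by
      have h4 := Real.sq_sqrt hS0
      have h5 : 0 ≤ (√S - N) ^ 2 / (2 * N) := by positivity
      have h6 : (√S - N) ^ 2 / (2 * N) = S / (2 * N) - √S + N / 2 := by
        rw [sub_sq, h4]; field_simp
      linarith
    have h7 : S / (2 * N) ≤ 2 * maxAlignment ω.1.1 := by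
      rw [div_le_iff₀ (by positivity)]
      linarith
    rw [e1]
    exact h1.trans (mul_le_mul_of_nonneg_left (by linarith) (Real.sqrt_nonneg _))
  rw [pathFree, pathFree, ← integral_sub (i1 x) (i1 0)]
  refine (abs_integral_le (((integrable_const _).add (i2.const_mul 2)).const_mul √X)
    (ae_of_all _ fun ω => abs_logSumExp_sub_le (hb ω))).trans ?_
  have e : ∫ ω : DisorderSpace N k p, √X * (N / 2 + 2 * maxAlignment ω.1.1) ∂(disorderLaw N k p) =
      √X * (N / 2 + 2 * ∫ ω, maxAlignment ω.1.1 ∂(disorderLaw N k p)) := by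
    rw [integral_const_mul, integral_add (integrable_const _) (i2.const_mul 2), integral_const_mul]
    simp
  refine e.trans_le ?_
  have := integral_maxAlignment_ξt_le (N := N) (k := k) (p := p) hN
  gcongr

end

/-! ### Negligible corrections: the number of Boolean patterns and the external field. -/

section

variable {γ : ℝ} {k p : ℕ → ℕ}

lemma tendsto_div_of_tendsto_div_log
    (hk : Tendsto (fun N => (k N : ℝ) / Real.log N) atTop (𝓝 γ)) :
    Tendsto (fun N => (k N : ℝ) / N) atTop (𝓝 0) := by
  have h1 : Tendsto (fun N : ℕ => Real.log N / (N : ℝ)) atTop (𝓝 0) :=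
    (Real.isLittleO_log_id_atTop.tendsto_div_nhds_zero).comp tendsto_natCast_atTop_atTop
  have h2 := hk.mul h1
  rw [mul_zero] at h2
  refine h2.congr' ?_
  filter_upwards [eventually_gt_atTop 1] with N hN
  have : Real.log N ≠ 0 := (Real.log_pos (by exact_mod_cast hN)).ne'
  field_simp

lemma tendsto_pathFree_field_sub (hk : Tendsto (fun N => (k N : ℝ) / N) atTop (𝓝 0))
    {x : (N : ℕ) → Fin (k N) → ℝ} (hX : Tendsto (fun N => ∑ ν, x N ν ^ 2) atTop (𝓝 0))
    (β A B C u : ℝ) :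
    Tendsto (fun N => (pathFree N (p N) β A B C (0 : Fin (k N) → ℝ) u -
      pathFree N (p N) β A B C (x N) u) / N)
      atTop (𝓝 0) := by
  have h := hX.sqrt.mul (((hk.div_const 2).const_add 1).mul_const (Real.log 2)
    |>.const_mul 2 |>.const_add (1 / 2))
  rw [Real.sqrt_zero, zero_mul] at h
  refine squeeze_zero_norm' ?_ h
  filter_upwards [eventually_gt_atTop 0] with N hN
  have hN' : (0 : ℝ) < N := by exact_mod_cast hN
  rw [Real.norm_eq_abs, abs_div, abs_sub_comm, Nat.abs_cast, div_le_iff₀ hN']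
  refine (abs_pathFree_sub_le hN β A B C u (x N)).trans_eq ?_
  field_simp

end

end MixedHebbian

/-! ### Assembly of the main theorem. -/

theorem mainTheorem1 (α β γ : ℝ) (hβ : 0 < β) (k p : ℕ → ℕ)
    (hk : Tendsto (fun N => (k N : ℝ) / Real.log N) atTop (𝓝 γ))
    (hp : Tendsto (fun N => (p N : ℝ) / N) atTop (𝓝 α))
    (hp_pos : ∀ᶠ N in atTop, 0 < p N)
    (m : Magnetizations) (q pbar : ℝ) (hq : β * (1 - q) < 1)
    (hRS : IsReplicaSymmetric α β k p m q pbar) :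
    Tendsto (fun N => freeEnergy N (k N) (p N) β) atTop (𝓝 (trialFreeEnergy α β m q pbar)) ∧
    IsStationaryPoint α β m q pbar ∧
    SelfConsistent α β m q pbar ∧
    (0 < α → ∀ (m' : Magnetizations) (q' pbar' : ℝ), 0 ≤ pbar' → β * (1 - q') < 1 →
      (IsStationaryPoint α β m' q' pbar' ↔ SelfConsistent α β m' q' pbar')) := by
  obtain ⟨x, hX, hT, hψ⟩ := hRS
  have hpi : (0 : ℝ) < Real.pi / 2 := by positivity
  have hsc : ∀ u ∈ Set.Ico 0 (Real.pi / 2), 0 ≤ Real.sin u ∧ 0 < Real.cos u := fun u hu =>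
    ⟨Real.sin_nonneg_of_nonneg_of_le_pi hu.1 (by linarith [hu.2]),
      Real.cos_pos_of_mem_Ioo ⟨by linarith [hu.1], hu.2⟩⟩
  have hmem : ∀ u ∈ Set.Ico 0 (Real.pi / 2), Real.sin u ^ 2 ∈ Set.Ico (0 : ℝ) 1 := fun u hu =>
    ⟨sq_nonneg _, by nlinarith [Real.sin_sq_add_cos_sq u, (hsc u hu).2]⟩
  have hzero : (0 : ℝ) ∈ Set.Ico 0 (Real.pi / 2) := ⟨le_rfl, hpi⟩
  set A := √(α * β * pbar) with hA
  set B := √(β * q) with hB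
  set C := β * (1 - q) with hC
  have hM : Tendsto (fun N => pathAvg (N := N) (p := p N) β A B C (x N) 0
      fun d σ _ => mattisDeviation m d σ) atTop (𝓝 0) := by
    refine (hψ _ (hmem 0 hzero)).1.congr fun N => ?_
    exact quenched_visible α pbar (x N) hq (hsc 0 hzero).1 (hsc 0 hzero).2.le
      fun d σ _ => mattisDeviation m d σ
  have hQ : ∀ u ∈ Set.Ico 0 (Real.pi / 2), Tendsto (fun N => pathAvg (N := N) (p := p N)
      β A B C (x N) u fun _ σ τ => (overlapVisible σ τ - q) ^ 2) atTop (𝓝 0) := fun u hu => by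
    refine (hψ _ (hmem u hu)).2.1.congr fun N => ?_
    exact quenched_visible α pbar (x N) hq (hsc u hu).1 (hsc u hu).2.le
      fun _ σ τ => (overlapVisible σ τ - q) ^ 2
  have hP : ∀ u ∈ Set.Ico 0 (Real.pi / 2), Tendsto (fun N => pathAvg (N := N) (p := p N)
      β A B C (x N) u fun d σ τ => (pathOverlap β B C u d σ τ - pbar) ^ 2) atTop (𝓝 0) :=
    fun u hu => by
      refine squeeze_zero (fun N => integral_nonneg fun ω => gibbsAvg_nonneg _ fun w =>
        sq_nonneg _) (fun N => ?_) (hψ _ (hmem u hu)).2.2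
      exact le_quenched_hidden α pbar (x N) hq (hsc u hu).1 (hsc u hu).2.le
  -- The signs of α, q and p̄ are read off from finite-N quantities. They are needed because a real
  -- square root squares back only for nonnegative arguments; q ≤ 1 gives C ≥ 0, used in the uniform
  -- bounds.
  have hα : 0 ≤ α := ge_of_tendsto' hp fun N => by positivity
  have hq0 : 0 ≤ q := by
    refine ge_of_tendsto (tendsto_pathAvg_overlapVisible (hQ 0 hzero)) ?_
    filter_upwards [eventually_gt_atTop 0] with N hN
    exact pathAvg_overlapVisible_nonneg hN _ _ _ _ _ _
  have hq1 : q ≤ 1 := le_of_tendsto' (tendsto_pathAvg_overlapVisible (hQ 0 hzero)) fun N =>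
    (abs_le.1 (abs_pathAvg_overlapVisible_le _ _ _ _ _ _)).2
  have hA0 : 0 ≤ A := Real.sqrt_nonneg _
  have hB2 : B ^ 2 = β * q := Real.sq_sqrt (by positivity)
  have hBC : B ^ 2 + C = β := by rw [hB2]; ring
  have hC0 : 0 ≤ C := mul_nonneg hβ.le (by linarith)
  have hpbar : pbar = β * q / (1 - C) ^ 2 := by
    rw [← hB2]
    refine tendsto_nhds_unique (tendsto_pathAvg_pathOverlap (hP 0 hzero)) ?_
    refine tendsto_const_nhds.congr' ?_
    filter_upwards [hp_pos] with N hN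
    exact (pathAvg_pathOverlap_zero hN β A B C (x N)).symm
  have hp0 : 0 ≤ pbar := by rw [hpbar]; positivity
  have hA2 : A ^ 2 = α * β * pbar := Real.sq_sqrt (by positivity)
  have hself : SelfConsistent α β m q pbar := by
    refine ⟨hpbar, ?_, fun ν => ?_⟩
    · simp_rw [localField_eq, ← hA2]
      exact overlap_eq_of_tendsto hβ hA0 hq hX hT hM (hQ 0 hzero)
    · simp_rw [localField_eq, ← hA2]
      exact magnetization_eq_of_tendsto hβ hA0 hq hX hT hM ν
  refine ⟨?_, isStationaryPoint_of_selfConsistent hα hβ hq hp0 hself, hself, fun hα' m' q' p' hp'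
    hq' => isStationaryPoint_iff_selfConsistent hα' hβ hq' hp'⟩
  have hk0 := tendsto_div_of_tendsto_div_log hk
  -- Four contributions: removal of the field at ψ = 1, the increment along the path, the value at ψ
  -- = 0, and the diagonal terms.
  have h := (((tendsto_pathFree_field_sub (p := p) hk0 hX β A B C (Real.pi / 2)).add
    (tendsto_pathFree_sub hβ hC0 hq hBC hp hp_pos hQ hP)).add
    (tendsto_pathFree_zero (B := B) hβ hA0 hq hp hX hT hM)).sub ((hk0.add hp).const_mul (β / 2))
  -- With A² = αβp̄ and B² = βq the two terms αβp̄q cancel, so the path contributes -(αβ/2) p̄(1-q)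
  -- besides the logarithm.
  have hval : trialFreeEnergy α β m q pbar = 0 + (-(α / 2 * Real.log (1 - C)) +
      (-(A ^ 2 * (1 - q)) - β * (α * (pbar * q)) + B ^ 2 * (α * pbar)) / 2) +
      (Real.log 2 + logCoshMean β m (A ^ 2) +
        (-(β / 2 * ‖(m : Magnetizations)‖ ^ 2) + B ^ 2 / (2 * (1 - C)) * α)) -
      β / 2 * (0 + α) := by
    have hC' : 1 - C ≠ 0 := by linarith
    rw [trialFreeEnergy_eq, hA2, hB2, ← hC]
    field_simp
    ring
  rw [hval]
  refine h.congr' ?_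
  filter_upwards [eventually_gt_atTop 0] with N hN
  have hN' : (N : ℝ) ≠ 0 := by positivity
  rw [freeEnergy_eq hN hβ A B C]
  field_simp
  ring
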